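/- Let $X$ be a relatively compact (totally bounded) metric space and $m$ a finite Radon measure on $X$ with $\operatorname{supp} m=X$. Let $(\mathcal E_A,V_{1/2})$ be a Dirichlet form on the real space $L^2(X)=L^2(X,m)$ (densely defined, symmetric, non-negative, closed, Markovian), and let $A$ be the associated non-negative self-adjoint operator. Assume that $V_{1/2}\hookrightarrow L^2(X)$ is compact, that $V_{1/2}\hookrightarrow L^{2q_A}(X)$ is continuous for some $q_A\in(1,\infty)$, and that every eigenvalue of $A$ is positive. For $s\ge 0$ let $V_s=D(A^s)$ with norm $\|h\|_{V_s}^2=\sum_{\mu}\mu^{2s}\|P_\mu h\|_{L^2}^2$, where $P_\mu$ is the orthogonal projection onto $\ker(A-\mu)$, and let $V_{-s}$ be the dual of $V_s$, with $L^2(X)$ as pivot space. Put $\theta_A=\frac{q_A}{2(q_A-1)}$ and $\alpha_0=1/\theta_A$. Let $1<\alpha<2$, $\gamma=1/\alpha$, $u_0\in V_\gamma$, $u_1\in L^2(X)$, $f\in C^1(\mathbb R)$ with $f(0)=0$, and consider $$\mathbb D_t^\alpha u+Au=f(u),\qquad u(0)=u_0,\quad \partial_tu(0)=u_1, \tag{1}$$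 where $$\mathbb D_t^\alpha u(t)=\frac1{\Gamma(2-\alpha)}\,\partial_t^2\int_0^t(t-s)^{1-\alpha}\big(u(s)-u(0)-s\,\partial_tu(0)\big)\,ds,$$ with the second derivative taken in the weak sense, with values in $V_{-\gamma}$. For $T>0$, a basic solution on $(0,T)$ is a function $u\in C([0,T];V_\gamma)\cap C^1([0,T];L^2(X))$ such that: $u(0)=u_0$ and $\partial_tu(0)=u_1$; as $t\to0^+$, $\|u(t)-u_0\|_{V_\sigma}\to0$ for some $0\le\sigma<\frac1\alpha$ and $\|\partial_tu(t)-u_1\|_{V_{-\beta}}\to0$ for some $0<\beta\le1-\frac1\alpha$; and for every $\varphi\in V_\gamma$ and a.e. $t\in(0,T)$, $\langle\mathbb D_t^\alpha u(t),\varphi\rangle_{V_{-\gamma},V_\gamma}+\mathcal E_A(u(t),\varphi)=(f(u(t)),\varphi)_{L^2}$. Consider two cases. **(I)** $q_A>2$ and $\alpha<\alpha_0$; there are non-negative non-decreasing functions $Q_1,Q_2$ on $[0,\infty)$ with $|f'(s)|\le Q_1(|s|)$ and $|f(s)|\le Q_2(|s|)$ for all $s\in\mathbb R$. A weak solution of (1)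 on $(0,T)$ is a basic solution with $\mathbb D_t^\alpha u\in C([0,T];V_{-\gamma})$. **(II)** Either $q_A>2$ and $\alpha_0\le\alpha<2$, or $1<q_A\le2$; and $|f'(s)|\le C|s|^{r-1}$ for all $s\in\mathbb R$, with some $C>0$, where $r\in(1,\infty)$ is arbitrary if $q_A>2$ and $\alpha=\alpha_0$, and $r=\frac{\theta_A\alpha}{\theta_A\alpha-1}$ otherwise. Let $1\le p<\frac1{2-\alpha}$ and $\frac1p+\frac1q=1$. A weak solution of (1) on $(0,T)$ is a basic solution with $u\in L^{\rho q}((0,T);L^{2\rho}(X))$ for some $\rho>1$ and $\mathbb D_t^\alpha u\in C([0,T];V_{-\gamma})+L^q((0,T);L^2(X))$. **Theorem.** In either case there is $T^\star>0$ such that (1) has a unique weak solution on $(0,T^\star)$. Moreover, whenever $T^\star>0$ and $u$ is a weak solution of (1) on $(0,T^\star)$, $u$ is the unique one, and there are $\tau>0$ and an extension of $u$ from $[0,T^\star]$ to $[0,T^\star+\tau]$ that is the unique weak solution of (1) on $(0,T^\star+\tau)$. -/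

import Mathlib

open MeasureTheory Set Filter Topology
open scoped ENNReal ContDiff

noncomputable section

/-- Dirichlet forms on the real Hilbert space `L²(X, m)`: densely defined, symmetric, non-negative,
closed bilinear forms that are Markovian. -/
structure DirichletForm {X : Type*} [MeasurableSpace X] (m : Measure X) where
  /-- the domain `V_{1/2} = D(𝓔)` -/
  dom : Submodule ℝ (Lp ℝ 2 m)
  form : dom →ₗ[ℝ] dom →ₗ[ℝ] ℝ
  dense_dom : Dense (dom : Set (Lp ℝ 2 m))
  symm : ∀ u v, form u v = form v u
  nonneg : ∀ u, 0 ≤ form u u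
  closed : ∀ l : ℝ, 0 < l → ∀ u : ℕ → dom,
    Tendsto (fun p : ℕ × ℕ => form (u p.1 - u p.2) (u p.1 - u p.2)
      + l * ‖u p.1 - u p.2‖ ^ 2) atTop (𝓝 0) →
    ∃ v : dom, Tendsto (fun n => form (u n - v) (u n - v) + l * ‖u n - v‖ ^ 2) atTop (𝓝 0)
  markov : ∀ ε : ℝ, 0 < ε → ∃ η : ℝ → ℝ, ContDiff ℝ ∞ η ∧ (∀ t ∈ Icc (0 : ℝ) 1, η t = t) ∧
    (∀ t, -ε ≤ η t ∧ η t ≤ 1 + ε) ∧ (∀ s t, s < t → 0 ≤ η t - η s ∧ η t - η s ≤ t - s) ∧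
    ∀ u : dom, ∃ v : dom,
      ((v : Lp ℝ 2 m) : X → ℝ) =ᵐ[m] (fun x => η ((u : Lp ℝ 2 m) x)) ∧ form v v ≤ form u u

namespace DirichletForm

variable {X : Type*} [MeasurableSpace X] {m : Measure X}

/-- The graph of the self-adjoint operator `A` associated with the form: `u ∈ D(A)` and `A u = w`
mean that `u ∈ V_{1/2}` and `𝓔(u, v) = (w, v)` for all `v ∈ V_{1/2}`. -/
def IsOp (E : DirichletForm m) (u w : Lp ℝ 2 m) : Prop :=
  ∃ hu : u ∈ E.dom, ∀ v : E.dom, E.form ⟨u, hu⟩ v = inner ℝ w (v : Lp ℝ 2 m)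

/-- The eigenspace `ker (A - μ)`. -/
def eigenspace (E : DirichletForm m) (μ : ℝ) : Submodule ℝ (Lp ℝ 2 m) where
  carrier := {u | E.IsOp u (μ • u)}
  zero_mem' := by
    refine ⟨E.dom.zero_mem, fun v => ?_⟩
    have : (⟨0, E.dom.zero_mem⟩ : E.dom) = 0 := rfl
    simp [this]
  add_mem' := by
    rintro a b ⟨ha, ha'⟩ ⟨hb, hb'⟩
    refine ⟨E.dom.add_mem ha hb, fun v => ?_⟩
    have : (⟨a + b, E.dom.add_mem ha hb⟩ : E.dom) = ⟨a, ha⟩ + ⟨b, hb⟩ := rfl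
    rw [this, map_add, LinearMap.add_apply, ha', hb', smul_add, inner_add_left]
  smul_mem' := by
    rintro c a ⟨ha, ha'⟩
    refine ⟨E.dom.smul_mem c ha, fun v => ?_⟩
    have : (⟨c • a, E.dom.smul_mem c ha⟩ : E.dom) = c • ⟨a, ha⟩ := rfl
    rw [this, map_smul, LinearMap.smul_apply, ha', smul_comm μ c a]
    simp only [real_inner_smul_left, smul_eq_mul]

theorem cauchy_schwarz (E : DirichletForm m) (u v : E.dom) :
    E.form u v ^ 2 ≤ E.form u u * E.form v v := by
  have h : ∀ t : ℝ, 0 ≤ E.form v v * (t * t) + (2 * E.form u v) * t + E.form u u := by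
    intro t
    have := E.nonneg (u + t • v)
    simp only [map_add, map_smul, LinearMap.add_apply, LinearMap.smul_apply, smul_eq_mul] at this
    rw [E.symm v u] at this
    nlinarith
  have := discrim_le_zero h
  unfold discrim at this
  nlinarith

/-- Eigenspaces of `A` are closed. -/
theorem isClosed_eigenspace (E : DirichletForm m) (μ : ℝ) :
    IsClosed (E.eigenspace μ : Set (Lp ℝ 2 m)) := by
  refine IsSeqClosed.isClosed fun x y hx hxy => ?_
  choose hd he using hx
  let u : ℕ → E.dom := fun n => ⟨x n, hd n⟩
  have hu : ∀ n, (u n : Lp ℝ 2 m) = x n := fun n => rfl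
  have hform : ∀ n (v : E.dom), E.form (u n) v = μ * inner ℝ (x n) (v : Lp ℝ 2 m) := by
    intro n v
    rw [he n v, real_inner_smul_left]
  have hdiff : ∀ p : ℕ × ℕ, E.form (u p.1 - u p.2) (u p.1 - u p.2) + 1 * ‖u p.1 - u p.2‖ ^ 2
      = (μ + 1) * ‖x p.1 - x p.2‖ ^ 2 := by
    intro p
    have h1 : ‖u p.1 - u p.2‖ = ‖x p.1 - x p.2‖ := rfl
    have h2 : ((u p.1 - u p.2 : E.dom) : Lp ℝ 2 m) = x p.1 - x p.2 := rfl
    rw [h1, map_sub E.form, LinearMap.sub_apply, hform, hform, ← mul_sub, ← inner_sub_left, h2,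
      real_inner_self_eq_norm_sq]
    ring
  have hc : Tendsto (fun p : ℕ × ℕ => E.form (u p.1 - u p.2) (u p.1 - u p.2)
      + 1 * ‖u p.1 - u p.2‖ ^ 2) atTop (𝓝 0) := by
    simp only [hdiff]
    rw [← prod_atTop_atTop_eq]
    have h1 : Tendsto (fun p : ℕ × ℕ => x p.1 - x p.2) (atTop ×ˢ atTop) (𝓝 (y - y)) :=
      (hxy.comp tendsto_fst).sub (hxy.comp tendsto_snd)
    simpa using (h1.norm.pow 2).const_mul (μ + 1)
  obtain ⟨v, hv⟩ := E.closed 1 one_pos u hc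
  have hv1 : Tendsto (fun n => ‖u n - v‖ ^ 2) atTop (𝓝 0) :=
    squeeze_zero (fun n => sq_nonneg _)
      (fun n => by linarith [E.nonneg (u n - v)]) hv
  have hv2 : Tendsto (fun n => E.form (u n - v) (u n - v)) atTop (𝓝 0) :=
    squeeze_zero (fun n => E.nonneg _) (fun n => by linarith [sq_nonneg ‖u n - v‖]) hv
  have hv3 : Tendsto (fun n => ‖x n - (v : Lp ℝ 2 m)‖) atTop (𝓝 0) := by
    have := (Real.continuous_sqrt.tendsto 0).comp hv1
    simpa [Function.comp_def, Real.sqrt_sq, hu] using this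
  have hvy : (v : Lp ℝ 2 m) = y :=
    tendsto_nhds_unique (tendsto_iff_norm_sub_tendsto_zero.2 hv3) hxy
  subst hvy
  refine ⟨v.2, fun w => ?_⟩
  have h4 : Tendsto (fun n => E.form (u n - v) w) atTop (𝓝 0) := by
    have h5 : Tendsto (fun n => E.form (u n - v) w ^ 2) atTop (𝓝 0) :=
      squeeze_zero (fun n => sq_nonneg _) (fun n => E.cauchy_schwarz _ _)
        (by simpa using hv2.mul_const (E.form w w))
    have := (Real.continuous_sqrt.tendsto 0).comp h5
    simp only [Function.comp_def, Real.sqrt_sq_eq_abs, Real.sqrt_zero] at this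
    exact (tendsto_zero_iff_abs_tendsto_zero _).2 this
  have h6 : Tendsto (fun n => E.form (u n) w) atTop (𝓝 (E.form v w)) := by
    have := h4.add_const (E.form v w)
    simpa using this
  have h7 : Tendsto (fun n => E.form (u n) w) atTop
      (𝓝 (inner ℝ (μ • (v : Lp ℝ 2 m)) (w : Lp ℝ 2 m))) := by
    simp only [hform, real_inner_smul_left]
    exact ((hxy.inner tendsto_const_nhds).const_mul μ)
  exact tendsto_nhds_unique h6 h7

instance (E : DirichletForm m) (μ : ℝ) : CompleteSpace (E.eigenspace μ) :=
  (E.isClosed_eigenspace μ).completeSpace_coe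

/-- The map `h ↦ (μ ^ s • P_μ h)_μ`, where `P_μ` is the orthogonal projection of `L²(X)` onto
`ker (A - μ)`. Only the eigenvalues `μ` of `A` give non-zero entries. -/
def spectralMap (E : DirichletForm m) (s : ℝ) :
    Lp ℝ 2 m →ₗ[ℝ] PreLp (fun _ : ℝ => Lp ℝ 2 m) :=
  LinearMap.pi fun μ => (μ ^ s) • ((E.eigenspace μ).starProjection : Lp ℝ 2 m →ₗ[ℝ] Lp ℝ 2 m)

/-- `V_s = D(A^s)`: the `h ∈ L²(X)` with `∑_μ μ ^ (2 s) ‖P_μ h‖² < ∞`. This is a separate type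
because it carries its own norm, see below. -/
def V (E : DirichletForm m) (s : ℝ) : Type _ :=
  ↥((lpSubmodule ℝ (fun _ : ℝ => Lp ℝ 2 m) 2).comap (E.spectralMap s))

instance (E : DirichletForm m) (s : ℝ) : AddCommGroup (E.V s) :=
  inferInstanceAs (AddCommGroup
    ↥((lpSubmodule ℝ (fun _ : ℝ => Lp ℝ 2 m) 2).comap (E.spectralMap s)))

instance (E : DirichletForm m) (s : ℝ) : Module ℝ (E.V s) :=
  inferInstanceAs (Module ℝ
    ↥((lpSubmodule ℝ (fun _ : ℝ => Lp ℝ 2 m) 2).comap (E.spectralMap s)))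

/-- The inclusion `V_s → L²(X)`. -/
def incl (E : DirichletForm m) (s : ℝ) : E.V s →ₗ[ℝ] Lp ℝ 2 m :=
  ((lpSubmodule ℝ (fun _ : ℝ => Lp ℝ 2 m) 2).comap (E.spectralMap s)).subtype

/-- `h ↦ (μ ^ s • P_μ h)_μ` as a map from `V_s` to the `ℓ²` direct sum. -/
def toEll2 (E : DirichletForm m) (s : ℝ) : E.V s →ₗ[ℝ] lp (fun _ : ℝ => Lp ℝ 2 m) 2 where
  toFun h := ⟨E.spectralMap s (E.incl s h), h.2⟩
  map_add' a b := Subtype.ext (by simp)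
  map_smul' c a := Subtype.ext (by simp; rfl)

/-- The norm of `V_s`: `‖h‖² = ∑_μ μ ^ (2 s) ‖P_μ h‖²`. The dual `V_{-s}` is
`StrongDual ℝ (E.V s)`. -/
instance (E : DirichletForm m) (s : ℝ) : SeminormedAddCommGroup (E.V s) :=
  SeminormedAddCommGroup.induced _ _ (E.toEll2 s)

instance (E : DirichletForm m) (s : ℝ) : NormedSpace ℝ (E.V s) :=
  NormedSpace.induced ℝ _ _ (E.toEll2 s)

theorem norm_V_sq (E : DirichletForm m) (s : ℝ) (h : E.V s) :
    ‖h‖ ^ 2 = ∑' μ : ℝ, ‖(μ ^ s) • (E.eigenspace μ).starProjection (E.incl s h)‖ ^ 2 := by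
  have h1 : ‖h‖ = ‖E.toEll2 s h‖ := rfl
  have h2 := lp.norm_rpow_eq_tsum (p := 2) (by norm_num) (E.toEll2 s h)
  simp only [ENNReal.toReal_ofNat, Real.rpow_ofNat] at h2
  rw [h1, h2]
  rfl

/-- The embedding `V_{1/2} ↪ L²(X)` is compact: the unit ball of `V_{1/2}`, for the norm
`(𝓔(u, u) + ‖u‖²)^{1/2}`, is relatively compact in `L²(X)`. -/
def CompactEmbedding (E : DirichletForm m) : Prop :=
  IsCompact (closure {h : Lp ℝ 2 m | ∃ u : E.dom, (u : Lp ℝ 2 m) = h ∧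
    E.form u u + ‖u‖ ^ 2 ≤ 1})

/-- The continuous embedding `V_{1/2} ↪ L^{2 q}(X)`. -/
def SobolevEmbedding (E : DirichletForm m) (q : ℝ) : Prop :=
  ∃ C : ℝ, ∀ u : E.dom, eLpNorm ((u : Lp ℝ 2 m) : X → ℝ) (ENNReal.ofReal (2 * q)) m ≤
    ENNReal.ofReal (C * √(E.form u u + ‖u‖ ^ 2))

/-- All eigenvalues of `A` are positive, that is, `λ₁ > 0`. -/
def PositiveSpectrum (E : DirichletForm m) : Prop :=
  ∀ μ : ℝ, E.eigenspace μ ≠ ⊥ → 0 < μ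

end DirichletForm

variable {X : Type*} [MeasurableSpace X] {m : Measure X}

/-- The real function `w` belongs to `W^{1,1}(0, T)`, is equal to its continuous representative on
`[0, T]`, and has weak derivative `g`. -/
def HasWeakDerivOn (T : ℝ) (w g : ℝ → ℝ) : Prop :=
  IntervalIntegrable g volume 0 T ∧ ∀ t ∈ Icc (0 : ℝ) T, w t = w 0 + ∫ s in (0 : ℝ)..t, g s

/-- `(1 / Γ(2 - α)) ∫₀ᵗ (t - s)^{1 - α} (u(s) - u(0) - s u'(0)) ds`, where `du = u'`. -/
def caputoIntegral (α : ℝ) (u du : ℝ → Lp ℝ 2 m) (t : ℝ) : Lp ℝ 2 m :=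
  (1 / Real.Gamma (2 - α)) • ∫ s in (0 : ℝ)..t, ((t - s) ^ (1 - α)) • (u s - u 0 - s • du 0)

/-- `D` is the fractional derivative
`𝔻_t^α u = (1 / Γ(2 - α)) ∂_t² ∫₀ᵗ (t - s)^{1 - α} (u(s) - u(0) - s u'(0)) ds` on `(0, T)`, with
values in the dual `V_{-γ}` of `V_γ`, `γ = 1 / α`: after pairing with any `φ ∈ V_γ`, it is the
second weak derivative. -/
def IsCaputoDeriv (E : DirichletForm m) (α T : ℝ) (u du : ℝ → Lp ℝ 2 m)
    (D : ℝ → StrongDual ℝ (E.V (1 / α))) : Prop :=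
  ∀ φ : E.V (1 / α), ∃ g : ℝ → ℝ,
    HasWeakDerivOn T (fun t => inner ℝ (caputoIntegral α u du t) (E.incl _ φ)) g ∧
    HasWeakDerivOn T g (fun t => D t φ)

/-- The part common to both notions of weak solution on `(0, T)` of `𝔻_t^α u + A u = f(u)`,
`u(0) = u₀`, `u'(0) = u₁`. Here `du` is the time derivative of `u` and `D` is `𝔻_t^α u`. -/
structure IsWeakSolWith (E : DirichletForm m) (α : ℝ) (f : ℝ → ℝ) (u₀ : E.V (1 / α))
    (u₁ : Lp ℝ 2 m) (T : ℝ) (u : ℝ → E.V (1 / α)) (du : ℝ → Lp ℝ 2 m)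
    (D : ℝ → StrongDual ℝ (E.V (1 / α))) : Prop where
  pos : 0 < T
  continuousOn : ContinuousOn u (Icc 0 T)
  hasDeriv : ∀ t ∈ Icc (0 : ℝ) T,
    HasDerivWithinAt (fun s => E.incl _ (u s)) (du t) (Icc 0 T) t
  continuousOn_deriv : ContinuousOn du (Icc 0 T)
  caputo : IsCaputoDeriv E α T (fun s => E.incl _ (u s)) du D
  init : u 0 = u₀
  init_deriv : du 0 = u₁
  /-- `‖u(t) - u₀‖ → 0` in `V_σ` for some `0 ≤ σ < 1 / α` -/
  init_lim : ∃ σ : ℝ, 0 ≤ σ ∧ σ < 1 / α ∧ ∃ z : ℝ → E.V σ,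
    (∀ t ∈ Icc (0 : ℝ) T, E.incl σ (z t) = E.incl _ (u t) - E.incl _ u₀) ∧
    Tendsto (fun t => ‖z t‖) (𝓝[>] 0) (𝓝 0)
  /-- `‖u'(t) - u₁‖ → 0` in `V_{-β}` for some `0 < β ≤ 1 - 1 / α` -/
  init_deriv_lim : ∃ β : ℝ, 0 < β ∧ β ≤ 1 - 1 / α ∧ ∃ z : ℝ → StrongDual ℝ (E.V β),
    (∀ t ∈ Icc (0 : ℝ) T, ∀ φ : E.V β, z t φ = inner ℝ (du t - u₁) (E.incl β φ)) ∧
    Tendsto (fun t => ‖z t‖) (𝓝[>] 0) (𝓝 0)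
  /-- the variational identity; in it `u(t)` and `φ` are elements of `V_{1/2}`, and `f(u(t))` is an
  element of `L²(X)` -/
  variational : ∀ φ : E.V (1 / α), ∀ᵐ t ∂(volume.restrict (Ioo (0 : ℝ) T)),
    ∃ (a b : E.dom) (F : Lp ℝ 2 m), (a : Lp ℝ 2 m) = E.incl _ (u t) ∧
      (b : Lp ℝ 2 m) = E.incl _ φ ∧
      (F : X → ℝ) =ᵐ[m] (fun x => f ((E.incl _ (u t)) x)) ∧
      D t φ + E.form a b = inner ℝ F (E.incl _ φ)

/-- Weak solution on `(0, T)`, subcritical case: moreover `𝔻_t^α u ∈ C([0, T]; V_{-γ})`. -/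
def IsWeakSolSub (E : DirichletForm m) (α : ℝ) (f : ℝ → ℝ) (u₀ : E.V (1 / α))
    (u₁ : Lp ℝ 2 m) (T : ℝ) (u : ℝ → E.V (1 / α)) : Prop :=
  ∃ (du : ℝ → Lp ℝ 2 m) (D : ℝ → StrongDual ℝ (E.V (1 / α))),
    IsWeakSolWith E α f u₀ u₁ T u du D ∧ ContinuousOn D (Icc 0 T)

/-- `u ∈ L^a((0, T); L^b(X))`. -/
def MemBochner (T : ℝ) (a b : ℝ≥0∞) (u : ℝ → Lp ℝ 2 m) : Prop :=
  ∃ (_ : Fact (1 ≤ b)) (g : ℝ → Lp ℝ b m),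
    (∀ᵐ t ∂(volume.restrict (Ioo (0 : ℝ) T)), (g t : X → ℝ) =ᵐ[m] (u t : X → ℝ)) ∧
    MemLp g a (volume.restrict (Ioo (0 : ℝ) T))

/-- Weak solution on `(0, T)`, critical and supercritical case: moreover
`u ∈ L^{rq}((0, T); L^{2r}(X))` for some `r > 1`, and
`𝔻_t^α u ∈ C([0, T]; V_{-γ}) + L^q((0, T); L²(X))`. -/
def IsWeakSolSuper (E : DirichletForm m) (α : ℝ) (q : ℝ≥0∞) (f : ℝ → ℝ) (u₀ : E.V (1 / α))
    (u₁ : Lp ℝ 2 m) (T : ℝ) (u : ℝ → E.V (1 / α)) : Prop :=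
  ∃ (du : ℝ → Lp ℝ 2 m) (D : ℝ → StrongDual ℝ (E.V (1 / α))),
    IsWeakSolWith E α f u₀ u₁ T u du D ∧
    (∃ r : ℝ, 1 < r ∧
      MemBochner T (ENNReal.ofReal r * q) (ENNReal.ofReal (2 * r)) (fun s => E.incl _ (u s))) ∧
    ∃ (D₁ : ℝ → StrongDual ℝ (E.V (1 / α))) (D₂ : ℝ → Lp ℝ 2 m),
      ContinuousOn D₁ (Icc 0 T) ∧ MemLp D₂ q (volume.restrict (Ioo (0 : ℝ) T)) ∧
      ∀ᵐ t ∂(volume.restrict (Ioo (0 : ℝ) T)), ∀ φ : E.V (1 / α),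
        D t φ = D₁ t φ + inner ℝ (D₂ t) (E.incl _ φ)

/-- `u` is the unique weak solution on `(0, T)`, for the notion `P` of weak solution: any weak
solution on `(0, T)` agrees with `u` on `[0, T]`. -/
def IsUniqueSol {Y : Type*} (P : ℝ → (ℝ → Y) → Prop) (T : ℝ) (u : ℝ → Y) : Prop :=
  P T u ∧ ∀ w, P T w → EqOn w u (Icc 0 T)

/-- `θ_A = q_A / (2 (q_A - 1))`. -/
def thetaA (qA : ℝ) : ℝ := qA / (2 * (qA - 1))

/-- The critical value `α₀ = 1 / θ_A`. -/
def alphaZero (qA : ℝ) : ℝ := 1 / thetaA qA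

/-- The growth condition with exponent `r`. -/
def Hf1 (f : ℝ → ℝ) (r : ℝ) : Prop :=
  f 0 = 0 ∧ ∃ C : ℝ, 0 < C ∧ ∀ s : ℝ, |deriv f s| ≤ C * |s| ^ (r - 1)

/-- The condition on `f` without growth restriction. -/
def Hf2 (f : ℝ → ℝ) : Prop :=
  f 0 = 0 ∧ ∃ Q₁ Q₂ : ℝ → ℝ, MonotoneOn Q₁ (Ici 0) ∧ MonotoneOn Q₂ (Ici 0) ∧
    (∀ s ∈ Ici (0 : ℝ), 0 ≤ Q₁ s ∧ 0 ≤ Q₂ s) ∧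
    ∀ s : ℝ, |deriv f s| ≤ Q₁ |s| ∧ |f s| ≤ Q₂ |s|

end

/-! Put `z = A^{1/α} u`, a function with values in `L²`. Expansion in eigenvectors of `A` and
inversion of the fractional integral turn the equation into one scalar Volterra equation for each
eigenvalue, and Mittag-Leffler kernels solve these. Reassembled, they say that a weak solution, in
either case, is the same thing as a continuous solution in `L²` of `z = z₀ + K * N(z)`. Here `z₀` is
the free evolution of the data, `K(t) = A^{1/α} t^{α-1} E_{α,α}(-A t^α)` and `N(z) = f(A^{-1/α} z)`.
The two directions are `isVolterraSol_of_isWeakSolWith` and `isWeakSolWith_of_isVolterraSol`.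

The kernel satisfies `‖K(t)‖ ≤ C t^{α-2}`, which is integrable at `0` because `α > 1`. By scaling it
is enough to treat the eigenvalue `1`. There the bound follows from Laplace inversion, since `p^α +
1` stays away from `0` in the right half plane when `α < 2` (`exists_mlKernel_bounds`).

The nonlinearity `N` is Lipschitz on bounded sets of `L²`. This rests on embeddings of `V_γ`: into
`L^∞` if `γ > θ_A`, which is case (I), and into `L^{2r}` if `r (θ_A - γ) ≤ θ_A`, which the exponents
of case (II) are made to satisfy. Both embeddings come from ultracontractivity: the Markov property
makes resolvents contract `L¹`, the Sobolev inequality gives Nash's inequality, and iterating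
resolvents bounds the spectral sums of an `L¹` function (`sum_coord_sq_le`).

With `K` weakly singular and `N` locally Lipschitz, the equation truncated outside a ball is a
contraction for an exponentially weighted norm, so it is uniquely solvable on every interval.
Removing the truncation gives uniqueness, local existence and extension (`volterra_unique`,
`volterra_extend`). -/

noncomputable section

open scoped Pointwise
universe u

/-! ### Eigenvector bases of symmetric operators. -/

/-- A symmetric operator whose eigenspaces are closed and span a dense subspace has a Hilbert basis
of eigenvectors. -/
theorem exists_hilbertBasis_eigenvectors {H : Type u} [NormedAddCommGroup H]
    [InnerProductSpace ℝ H] [CompleteSpace H] (T : H →L[ℝ] H)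
    (hT : (T : H →ₗ[ℝ] H).IsSymmetric)
    (htop : (⨆ κ : ℝ, Module.End.eigenspace (T : H →ₗ[ℝ] H) κ)ᗮ = ⊥) :
    ∃ (ι : Type u) (b : HilbertBasis ι ℝ H) (κ : ι → ℝ), ∀ i, T (b i) = κ i • b i := by
  have hclosed : ∀ κ : ℝ, IsClosed (Module.End.eigenspace (T : H →ₗ[ℝ] H) κ : Set H) := by
    intro κ
    have : (Module.End.eigenspace (T : H →ₗ[ℝ] H) κ : Set H) = {x | T x = κ • x} := by
      ext x; simp
    rw [this]
    exact isClosed_eq T.continuous (continuous_const_smul κ)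
  have : ∀ κ : ℝ, CompleteSpace (Module.End.eigenspace (T : H →ₗ[ℝ] H) κ) :=
    fun κ => (hclosed κ).completeSpace_coe
  choose w c hc using fun κ : ℝ =>
    exists_hilbertBasis ℝ (Module.End.eigenspace (T : H →ₗ[ℝ] H) κ)
  have hon : Orthonormal ℝ (fun a : Σ κ : ℝ, w κ =>
      ((c a.1 a.2 : Module.End.eigenspace (T : H →ₗ[ℝ] H) a.1) : H)) :=
    (hT.orthogonalFamily_eigenspaces).orthonormal_sigma_orthonormal
      (v_family := fun κ i => c κ i) (fun κ => (c κ).orthonormal)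
  refine ⟨Σ κ : ℝ, w κ, HilbertBasis.mkOfOrthogonalEqBot hon ?_, fun a => a.1, fun a => ?_⟩
  · rw [eq_bot_iff, ← htop]
    intro x hx
    rw [Submodule.mem_orthogonal] at hx ⊢
    intro y hy
    -- Orthogonality to the basis vectors passes to a whole eigenspace, because its elements are
    -- convergent series in those vectors.
    have hle : (⨆ κ : ℝ, Module.End.eigenspace (T : H →ₗ[ℝ] H) κ) ≤
        LinearMap.ker ((innerSL ℝ x : H →L[ℝ] ℝ) : H →ₗ[ℝ] ℝ) := by
      refine iSup_le fun κ z hz => ?_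
      rw [LinearMap.mem_ker]
      have h1 := (((c κ).hasSum_repr ⟨z, hz⟩).mapL
        ((innerSL ℝ x).comp (Module.End.eigenspace (T : H →ₗ[ℝ] H) κ).subtypeL))
      have h2 : ∀ i, ((innerSL ℝ x).comp (Module.End.eigenspace (T : H →ₗ[ℝ] H) κ).subtypeL)
          ((c κ).repr ⟨z, hz⟩ i • c κ i) = 0 := by
        intro i
        have h3 := hx _ (Submodule.subset_span ⟨⟨κ, i⟩, rfl⟩)
        rw [real_inner_comm] at h3
        simp only [ContinuousLinearMap.map_smul, ContinuousLinearMap.comp_apply,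
          Submodule.subtypeL_apply, innerSL_apply_apply]
        rw [h3, smul_zero]
      simp only [h2] at h1
      exact h1.unique hasSum_zero
    have := hle hy
    rw [LinearMap.mem_ker] at this
    rw [real_inner_comm]
    exact this
  · rw [HilbertBasis.coe_mkOfOrthogonalEqBot]
    have := (c a.1 a.2).2
    rwa [Module.End.mem_eigenspace_iff] at this

/-! ### The energy space and the spectral resolution of `A`. -/

namespace DirichletForm

variable {X : Type u} [MeasurableSpace X] {m : Measure X}

/-- The form domain with the energy inner product `𝓔(u, v) + (u, v)`. -/
def EnergySpace (E : DirichletForm m) : Type _ := E.dom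

instance (E : DirichletForm m) : AddCommGroup E.EnergySpace := inferInstanceAs (AddCommGroup E.dom)

instance (E : DirichletForm m) : Module ℝ E.EnergySpace := inferInstanceAs (Module ℝ E.dom)

/-- The identity, from the energy space to the form domain. -/
def toDom (E : DirichletForm m) : E.EnergySpace →ₗ[ℝ] E.dom := LinearMap.id

@[reducible]
def energyCore (E : DirichletForm m) : InnerProductSpace.Core ℝ E.EnergySpace where
  inner u v := E.form (E.toDom u) (E.toDom v) +
    inner ℝ (E.toDom u : Lp ℝ 2 m) (E.toDom v : Lp ℝ 2 m)
  conj_inner_symm u v := by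
    simp only [conj_trivial]
    rw [E.symm, real_inner_comm]
  re_inner_nonneg u := by
    simp only [RCLike.re_to_real]
    exact add_nonneg (E.nonneg _) real_inner_self_nonneg
  add_left u v w := by
    simp only [map_add, LinearMap.add_apply, Submodule.coe_add, inner_add_left]
    ring
  smul_left u v r := by
    simp only [map_smul, LinearMap.smul_apply, Submodule.coe_smul, real_inner_smul_left,
      smul_eq_mul, conj_trivial]
    ring
  definite u h := by
    have h1 := E.nonneg (E.toDom u)
    have h2 : 0 ≤ inner ℝ (E.toDom u : Lp ℝ 2 m) (E.toDom u : Lp ℝ 2 m) :=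
      real_inner_self_nonneg
    have h3 : inner ℝ (E.toDom u : Lp ℝ 2 m) (E.toDom u : Lp ℝ 2 m) = (0 : ℝ) := by linarith
    have h4 : E.toDom u = 0 := Subtype.ext (inner_self_eq_zero.1 h3)
    exact h4

instance (E : DirichletForm m) : NormedAddCommGroup E.EnergySpace :=
  E.energyCore.toNormedAddCommGroup

instance (E : DirichletForm m) : InnerProductSpace ℝ E.EnergySpace :=
  InnerProductSpace.ofCore E.energyCore.toCore

theorem energy_inner (E : DirichletForm m) (u v : E.EnergySpace) :
    inner ℝ u v = E.form (E.toDom u) (E.toDom v) +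
      inner ℝ (E.toDom u : Lp ℝ 2 m) (E.toDom v : Lp ℝ 2 m) := rfl

theorem energy_norm_sq (E : DirichletForm m) (u : E.EnergySpace) :
    ‖u‖ ^ 2 = E.form (E.toDom u) (E.toDom u) + ‖E.toDom u‖ ^ 2 := by
  rw [← real_inner_self_eq_norm_sq, energy_inner, real_inner_self_eq_norm_sq]
  rfl

/-- For this norm, completeness is the closedness axiom with `l = 1`. -/
instance (E : DirichletForm m) : CompleteSpace E.EnergySpace := by
  refine Metric.complete_of_cauchySeq_tendsto fun u hu => ?_
  have key : ∀ a b : E.EnergySpace, E.form (E.toDom a - E.toDom b) (E.toDom a - E.toDom b)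
      + 1 * ‖E.toDom a - E.toDom b‖ ^ 2 = dist a b ^ 2 := by
    intro a b
    rw [dist_eq_norm, energy_norm_sq, one_mul, map_sub E.toDom]
  obtain ⟨v, hv⟩ := E.closed 1 one_pos (fun n => E.toDom (u n)) (by
    simp only [key]
    have h := cauchySeq_iff_tendsto_dist_atTop_0.1 hu
    simpa using h.pow 2)
  refine ⟨(show E.EnergySpace from v), ?_⟩
  rw [tendsto_iff_dist_tendsto_zero]
  have h2 : ∀ n, E.form (E.toDom (u n) - v) (E.toDom (u n) - v) + 1 * ‖E.toDom (u n) - v‖ ^ 2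
      = dist (u n) (show E.EnergySpace from v) ^ 2 := fun n => key _ _
  simp only [h2] at hv
  have := (Real.continuous_sqrt.tendsto 0).comp hv
  rw [Real.sqrt_zero] at this
  exact this.congr fun n => Real.sqrt_sq dist_nonneg

/-- The embedding of the energy space into `L²`. -/
def energyIncl (E : DirichletForm m) : E.EnergySpace →L[ℝ] Lp ℝ 2 m :=
  LinearMap.mkContinuous (E.dom.subtype.comp E.toDom) 1 fun u => by
    rw [one_mul]
    refine le_of_sq_le_sq ?_ (norm_nonneg _)
    rw [energy_norm_sq]
    have := E.nonneg (E.toDom u)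
    simp only [LinearMap.comp_apply, Submodule.subtype_apply]
    have h : ‖(E.toDom u : Lp ℝ 2 m)‖ = ‖E.toDom u‖ := rfl
    rw [h]; linarith
where le_of_sq_le_sq {a b : ℝ} (h : a ^ 2 ≤ b ^ 2) (hb : 0 ≤ b) : a ≤ b := abs_le_of_sq_le_sq' h hb |>.2

theorem energyIncl_apply (E : DirichletForm m) (u : E.EnergySpace) :
    E.energyIncl u = (E.toDom u : Lp ℝ 2 m) := rfl

theorem isCompactOperator_energyIncl (E : DirichletForm m) (h : E.CompactEmbedding) :
    IsCompactOperator E.energyIncl := by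
  refine (isCompactOperator_iff_exists_mem_nhds_image_subset_compact _).2
    ⟨Metric.closedBall 0 1, Metric.closedBall_mem_nhds _ one_pos, _, h, ?_⟩
  rintro _ ⟨u, hu, rfl⟩
  refine subset_closure ⟨E.toDom u, rfl, ?_⟩
  rw [← energy_norm_sq]
  rw [mem_closedBall_zero_iff] at hu
  nlinarith [norm_nonneg u]

/-- The resolvent `(1 + A)⁻¹`. -/
def resolventOne (E : DirichletForm m) : Lp ℝ 2 m →L[ℝ] Lp ℝ 2 m :=
  E.energyIncl.comp (ContinuousLinearMap.adjoint E.energyIncl)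

theorem resolventOne_isSymmetric (E : DirichletForm m) :
    (E.resolventOne : Lp ℝ 2 m →ₗ[ℝ] Lp ℝ 2 m).IsSymmetric := by
  intro x y
  simp only [resolventOne, ContinuousLinearMap.coe_coe, ContinuousLinearMap.comp_apply]
  rw [← ContinuousLinearMap.adjoint_inner_right, ContinuousLinearMap.adjoint_inner_left]

/-- The adjoint `y` of the embedding at `x` is the Riesz representative of `v ↦ (x, v)` for the
energy product, so `𝓔(y, v) + (y, v) = (x, v)`. Since `y` equals `κ x` in `L²`, division by `κ`
gives the eigenvalue `1 / κ - 1`. -/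
theorem isOp_of_resolventOne (E : DirichletForm m) {x : Lp ℝ 2 m} (hx : x ≠ 0) {κ : ℝ}
    (h : E.resolventOne x = κ • x) : E.IsOp x ((1 / κ - 1) • x) := by
  set y := ContinuousLinearMap.adjoint E.energyIncl x with hy
  have h1 : (E.toDom y : Lp ℝ 2 m) = κ • x := h
  -- If `κ = 0` then `y = 0`, so `x` is orthogonal to the dense form domain.
  have hκ : κ ≠ 0 := by
    rintro rfl
    have h2 : y = 0 := by
      have : E.toDom y = 0 := Subtype.ext (by rw [h1]; simp)
      exact this
    have h3 : ∀ v ∈ E.dom, inner ℝ x v = (0 : ℝ) := by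
      intro v hv
      have := ContinuousLinearMap.adjoint_inner_left E.energyIncl
        (show E.EnergySpace from (⟨v, hv⟩ : E.dom)) x
      rw [← hy, h2, inner_zero_left] at this
      exact this.symm
    refine hx (E.dense_dom.eq_zero_of_inner_left ℝ fun v hv => h3 v hv)
  have h4 : κ⁻¹ • (E.toDom y : Lp ℝ 2 m) = x := by rw [h1, smul_smul, inv_mul_cancel₀ hκ, one_smul]
  have hxd : x ∈ E.dom := by
    rw [← h4]; exact E.dom.smul_mem _ (E.toDom y).2
  refine ⟨hxd, fun v => ?_⟩
  have h5 : (⟨x, hxd⟩ : E.dom) = κ⁻¹ • E.toDom y := Subtype.ext h4.symm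
  have h6 := ContinuousLinearMap.adjoint_inner_left E.energyIncl (show E.EnergySpace from v) x
  rw [← hy, energy_inner] at h6
  have h7 : E.toDom (show E.EnergySpace from v) = v := rfl
  rw [energyIncl_apply, h7, h1, real_inner_smul_left] at h6
  rw [h5, map_smul, LinearMap.smul_apply, smul_eq_mul, real_inner_smul_left]
  have h8 : E.form (E.toDom y) v = (1 - κ) * inner ℝ x (v : Lp ℝ 2 m) := by linarith
  rw [h8]
  field_simp

/-- A Hilbert basis of eigenvectors of `A`, with eigenvalues that are bounded below by a positive
number and have finite multiplicities. -/
structure EigenBasis (E : DirichletForm m) (ι : Type*) where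
  basis : HilbertBasis ι ℝ (Lp ℝ 2 m)
  ev : ι → ℝ
  low : ℝ
  low_pos : 0 < low
  low_le : ∀ i, low ≤ ev i
  isOp : ∀ i, E.IsOp (basis i) (ev i • basis i)
  finite_le : ∀ K : ℝ, {i | ev i ≤ K}.Finite

/-- Distinct orthonormal vectors are at distance `√2`, so a sequence of them has no convergent
subsequence. -/
theorem finite_of_isCompact_orthonormal {H ι : Type*} [NormedAddCommGroup H]
    [InnerProductSpace ℝ H] {v : ι → H} (hv : Orthonormal ℝ v) {S : Set ι} {K : Set H}
    (hK : IsCompact K) (hS : ∀ i ∈ S, v i ∈ K) : S.Finite := by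
  by_contra hinf
  have hinf : S.Infinite := hinf
  let s := hinf.natEmbedding
  obtain ⟨a, -, φ, hφ, hlim⟩ := hK.tendsto_subseq (x := fun n => v (s n)) fun n => hS _ (s n).2
  have hc := hlim.cauchySeq
  rw [Metric.cauchySeq_iff] at hc
  obtain ⟨N, hN⟩ := hc 1 one_pos
  have h1 := hN N le_rfl (N + 1) (Nat.le_succ N)
  have hne : (s (φ N) : ι) ≠ s (φ (N + 1)) := by
    intro h
    have := s.injective (Subtype.ext h)
    have h2 := hφ (Nat.lt_succ_self N)
    simp only [Nat.succ_eq_add_one] at h2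
    omega
  simp only [Function.comp_def, dist_eq_norm] at h1
  have h2 : ‖v (s (φ N)) - v (s (φ (N + 1)))‖ ^ 2 = 2 := by
    rw [norm_sub_sq_real, hv.1, hv.1, hv.2 hne]; norm_num
  nlinarith [norm_nonneg (v (s (φ N)) - v (s (φ (N + 1))))]

/-- The resolvent is compact and symmetric, so it has a Hilbert basis of eigenvectors. Positivity of
the spectrum enters through `1 / κ - 1 > 0`. Finite multiplicities come from the compactness of the
embedding itself, and they turn positivity into a uniform lower bound. -/
theorem exists_eigenBasis (E : DirichletForm m) (hc : E.CompactEmbedding)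
    (hp : E.PositiveSpectrum) : ∃ ι : Type u, Nonempty (E.EigenBasis ι) := by
  have hcomp : IsCompactOperator E.resolventOne :=
    (E.isCompactOperator_energyIncl hc).comp_clm _
  obtain ⟨ι, b, κ, hb⟩ := exists_hilbertBasis_eigenvectors E.resolventOne
    E.resolventOne_isSymmetric
    (ContinuousLinearMap.orthogonalComplement_iSup_eigenspaces_eq_bot hcomp
      E.resolventOne_isSymmetric)
  have hne : ∀ i, b i ≠ 0 := fun i => b.orthonormal.ne_zero i
  have hop : ∀ i, E.IsOp (b i) ((1 / κ i - 1) • b i) :=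
    fun i => E.isOp_of_resolventOne (hne i) (hb i)
  have hpos : ∀ i, 0 < 1 / κ i - 1 := by
    intro i
    refine hp _ fun h => hne i ?_
    have : b i ∈ E.eigenspace (1 / κ i - 1) := hop i
    rw [h] at this
    simpa using this
  have hfin : ∀ K : ℝ, {i | 1 / κ i - 1 ≤ K}.Finite := by
    intro K
    -- A unit eigenvector with eigenvalue at most `K` has squared energy norm at most `|K| + 1`, so
    -- it lies in this dilate of the compact set.
    have hK : IsCompact (√(|K| + 1) • closure {h : Lp ℝ 2 m | ∃ u : E.dom, (u : Lp ℝ 2 m) = h ∧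
      E.form u u + ‖u‖ ^ 2 ≤ 1}) := IsCompact.smul (√(|K| + 1)) hc
    refine finite_of_isCompact_orthonormal b.orthonormal hK fun i hi => ?_
    obtain ⟨hd, hf⟩ := hop i
    have hK0 : (0 : ℝ) < |K| + 1 := by positivity
    have hs : 0 < √(|K| + 1) := Real.sqrt_pos.2 hK0
    refine ⟨(√(|K| + 1))⁻¹ • b i, subset_closure ⟨(√(|K| + 1))⁻¹ • ⟨b i, hd⟩, rfl, ?_⟩, ?_⟩
    · have h1 : ‖(⟨b i, hd⟩ : E.dom)‖ = 1 := b.orthonormal.1 i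
      have h2 : (√(|K| + 1))⁻¹ * (√(|K| + 1))⁻¹ = (|K| + 1)⁻¹ := by
        rw [← mul_inv, Real.mul_self_sqrt hK0.le]
      simp only [map_smul, LinearMap.smul_apply, smul_eq_mul]
      rw [hf, norm_smul, h1, real_inner_smul_left, real_inner_self_eq_norm_sq, b.orthonormal.1 i,
        Real.norm_of_nonneg (by positivity), ← mul_assoc, h2, mul_one, one_pow]
      have h3 : 1 / κ i - 1 ≤ |K| := le_trans hi (le_abs_self K)
      rw [sq, h2, mul_one, show (|K| + 1)⁻¹ * (1 / κ i - 1) + (|K| + 1)⁻¹ =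
        (|K| + 1)⁻¹ * (1 / κ i - 1 + 1) by ring, inv_mul_le_iff₀ hK0]
      linarith
    · simp only [smul_smul]
      rw [mul_inv_cancel₀ hs.ne', one_smul]
  -- Only finitely many eigenvalues are at most `1`. The lower bound is the least of them, or `1` if
  -- there are none.
  obtain ⟨l, hl, hle⟩ : ∃ l : ℝ, 0 < l ∧ ∀ i, l ≤ 1 / κ i - 1 := by
    rcases ({i | 1 / κ i - 1 ≤ 1} : Set ι).eq_empty_or_nonempty with h0 | h0
    · refine ⟨1, one_pos, fun i => ?_⟩
      by_contra h
      have : i ∈ ({i | 1 / κ i - 1 ≤ 1} : Set ι) := (not_le.1 h).le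
      rw [h0] at this
      exact this
    · obtain ⟨j, hj, hmin⟩ := exists_min_image _ (fun i => 1 / κ i - 1) (hfin 1) h0
      refine ⟨1 / κ j - 1, hpos j, fun i => ?_⟩
      by_cases hi : 1 / κ i - 1 ≤ 1
      · exact hmin i hi
      · exact le_trans hj (not_le.1 hi).le
  exact ⟨ι, ⟨⟨b, _, l, hl, hle, hop, hfin⟩⟩⟩

end DirichletForm

/-! ### Diagonal operators in a Hilbert basis. -/

section Diagonal

variable {ι H : Type*} [NormedAddCommGroup H] [InnerProductSpace ℝ H] (b : HilbertBasis ι ℝ H)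

theorem HilbertBasis.hasSum_repr_mul (x y : H) :
    HasSum (fun i => b.repr x i * b.repr y i) (inner ℝ x y) := by
  have := b.hasSum_inner_mul_inner x y
  simp only [b.repr_apply_apply]
  refine this.congr_fun fun i => ?_
  rw [real_inner_comm x (b i)]

theorem HilbertBasis.hasSum_repr_sq (x : H) :
    HasSum (fun i => b.repr x i ^ 2) (‖x‖ ^ 2) := by
  have := b.hasSum_repr_mul x x
  rw [real_inner_self_eq_norm_sq] at this
  simpa only [sq] using this

theorem HilbertBasis.ext_repr {x y : H} (h : ∀ i, b.repr x i = b.repr y i) : x = y :=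
  b.repr.injective (lp.ext (funext h))

theorem HilbertBasis.repr_add_apply (x y : H) (i : ι) :
    b.repr (x + y) i = b.repr x i + b.repr y i := by
  rw [map_add]; rfl

theorem HilbertBasis.repr_smul_apply (c : ℝ) (x : H) (i : ι) :
    b.repr (c • x) i = c * b.repr x i := by
  rw [map_smul]; rfl

theorem HilbertBasis.exists_repr_eq {c : ι → ℝ} (hc : Summable fun i => c i ^ 2) :
    ∃ x : H, ∀ i, b.repr x i = c i := by
  have hm : Memℓp c 2 := by
    refine memℓp_gen ?_
    simpa using hc
  refine ⟨b.repr.symm ⟨c, hm⟩, fun i => ?_⟩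
  rw [LinearIsometryEquiv.apply_symm_apply]

theorem HilbertBasis.norm_le_of_repr {x y : H} {K : ℝ} (hK : 0 ≤ K)
    (h : ∀ i, |b.repr y i| ≤ K * |b.repr x i|) : ‖y‖ ≤ K * ‖x‖ := by
  refine (abs_le_of_sq_le_sq' ?_ (by positivity)).2
  rw [mul_pow]
  refine hasSum_le (fun i => ?_) (b.hasSum_repr_sq y) ((b.hasSum_repr_sq x).mul_left (K ^ 2))
  rw [← sq_abs, ← sq_abs (b.repr x i), ← mul_pow]
  exact pow_le_pow_left₀ (abs_nonneg _) (h i) 2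

theorem HilbertBasis.exists_diag {a : ι → ℝ} (h : ∃ K, ∀ i, |a i| ≤ K) (x : H) :
    ∃ y : H, ∀ i, b.repr y i = a i * b.repr x i := by
  obtain ⟨K, hK⟩ := h
  refine b.exists_repr_eq ?_
  refine Summable.of_nonneg_of_le (fun i => sq_nonneg _) (fun i => ?_)
    ((b.hasSum_repr_sq x).summable.mul_left (K ^ 2))
  rw [mul_pow]
  refine mul_le_mul_of_nonneg_right ?_ (sq_nonneg _)
  exact sq_le_sq' (by linarith [neg_abs_le (a i), hK i]) ((le_abs_self _).trans (hK i))

open Classical in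
/-- The diagonal operator with bounded entries `a` in the Hilbert basis `b`
(zero if `a` is unbounded). -/
def HilbertBasis.diag (a : ι → ℝ) : H →L[ℝ] H :=
  if h : ∃ K, ∀ i, |a i| ≤ K then
    LinearMap.mkContinuousOfExistsBound
      { toFun := fun x => (b.exists_diag h x).choose
        map_add' := fun x y => b.ext_repr fun i => by
          refine ((b.exists_diag h (x + y)).choose_spec i).trans ?_
          rw [b.repr_add_apply, b.repr_add_apply, (b.exists_diag h x).choose_spec,
            (b.exists_diag h y).choose_spec, mul_add]
        map_smul' := fun c x => b.ext_repr fun i => by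
          refine ((b.exists_diag h (c • x)).choose_spec i).trans ?_
          rw [RingHom.id_apply, b.repr_smul_apply, b.repr_smul_apply,
            (b.exists_diag h x).choose_spec, mul_left_comm] }
      ⟨|h.choose|, fun x => b.norm_le_of_repr (abs_nonneg _) fun i => by
        simp only [LinearMap.coe_mk, AddHom.coe_mk]
        rw [(b.exists_diag h x).choose_spec, abs_mul]
        exact mul_le_mul_of_nonneg_right ((h.choose_spec i).trans (le_abs_self _))
          (abs_nonneg _)⟩
  else 0

variable {b}

theorem HilbertBasis.repr_diag {a : ι → ℝ} {K : ℝ} (h : ∀ i, |a i| ≤ K) (x : H) (i : ι) :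
    b.repr (b.diag a x) i = a i * b.repr x i := by
  have h' : ∃ K, ∀ i, |a i| ≤ K := ⟨K, h⟩
  rw [HilbertBasis.diag, dif_pos h']
  exact (b.exists_diag h' x).choose_spec i

theorem HilbertBasis.norm_diag_apply_le {a : ι → ℝ} {K : ℝ} (hK : 0 ≤ K) (h : ∀ i, |a i| ≤ K)
    (x : H) : ‖b.diag a x‖ ≤ K * ‖x‖ := by
  refine b.norm_le_of_repr hK fun i => ?_
  rw [HilbertBasis.repr_diag h, abs_mul]
  exact mul_le_mul_of_nonneg_right (h i) (abs_nonneg _)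

/-- Only strong continuity is claimed. It is dominated convergence in Parseval's sum, with
dominating terms `(2K)² x_i²`. -/
theorem HilbertBasis.continuousOn_diag {a : ℝ → ι → ℝ} {S : Set ℝ} {K : ℝ}
    (hK : ∀ t ∈ S, ∀ i, |a t i| ≤ K) (hc : ∀ i, ContinuousOn (fun t => a t i) S) (x : H) :
    ContinuousOn (fun t => b.diag (a t) x) S := by
  intro t₀ ht₀
  rw [ContinuousWithinAt, tendsto_iff_norm_sub_tendsto_zero]
  have hsq : Tendsto (fun t => ‖b.diag (a t) x - b.diag (a t₀) x‖ ^ 2) (𝓝[S] t₀) (𝓝 0) := by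
    have heq : ∀ t ∈ S, ‖b.diag (a t) x - b.diag (a t₀) x‖ ^ 2 =
        ∑' i, ((a t i - a t₀ i) * b.repr x i) ^ 2 := by
      intro t ht
      rw [← (b.hasSum_repr_sq _).tsum_eq]
      refine tsum_congr fun i => ?_
      rw [map_sub, lp.coeFn_sub, Pi.sub_apply, HilbertBasis.repr_diag (hK t ht),
        HilbertBasis.repr_diag (hK t₀ ht₀), sub_mul]
    have h0 : Tendsto (fun t => ∑' i, ((a t i - a t₀ i) * b.repr x i) ^ 2) (𝓝[S] t₀)
        (𝓝 (∑' i, ((a t₀ i - a t₀ i) * b.repr x i) ^ 2)) := by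
      refine tendsto_tsum_of_dominated_convergence
        (bound := fun i => (2 * K) ^ 2 * b.repr x i ^ 2)
        ((b.hasSum_repr_sq x).summable.mul_left _) (fun i => ?_) ?_
      · exact ((((hc i) t₀ ht₀).sub_const _).mul_const _).pow 2
      · filter_upwards [self_mem_nhdsWithin] with t ht i
        rw [Real.norm_of_nonneg (sq_nonneg _), mul_pow]
        refine mul_le_mul_of_nonneg_right ?_ (sq_nonneg _)
        have h1 := abs_le.1 (hK t ht i)
        have h2 := abs_le.1 (hK t₀ ht₀ i)
        exact sq_le_sq' (by linarith) (by linarith)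
    simp only [sub_self, zero_mul, ne_eq, OfNat.ofNat_ne_zero, not_false_eq_true, zero_pow,
      tsum_zero] at h0
    exact h0.congr' (by filter_upwards [self_mem_nhdsWithin] with t ht using (heq t ht).symm)
  have := (Real.continuous_sqrt.tendsto 0).comp hsq
  rw [Real.sqrt_zero] at this
  exact this.congr fun t => Real.sqrt_sq (norm_nonneg _)

end Diagonal

/-! ### The spaces `V_s` and the form in coordinates. -/

namespace DirichletForm

variable {X : Type u} [MeasurableSpace X] {m : Measure X} {E : DirichletForm m} {ι : Type*}

namespace EigenBasis

variable (B : E.EigenBasis ι)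

/-- The coordinates of an element of `L²`. -/
def coord (h : Lp ℝ 2 m) (i : ι) : ℝ := B.basis.repr h i

theorem coord_eq_inner (h : Lp ℝ 2 m) (i : ι) : B.coord h i = inner ℝ (B.basis i) h :=
  B.basis.repr_apply_apply h i

theorem ev_pos (i : ι) : 0 < B.ev i := B.low_pos.trans_le (B.low_le i)

theorem mem_dom (i : ι) : B.basis i ∈ E.dom := (B.isOp i).1

theorem form_basis (i : ι) (v : E.dom) :
    E.form ⟨B.basis i, B.mem_dom i⟩ v = B.ev i * B.coord v i := by
  obtain ⟨_, h⟩ := B.isOp i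
  rw [h, real_inner_smul_left, coord_eq_inner]

theorem starProjection_basis_of_eq (i : ι) :
    (E.eigenspace (B.ev i)).starProjection (B.basis i) = B.basis i :=
  Submodule.starProjection_eq_self_iff.2 (B.isOp i)

/-- By symmetry of the form, eigenvectors with distinct eigenvalues are orthogonal. -/
theorem starProjection_basis_of_ne {i : ι} {κ : ℝ} (h : B.ev i ≠ κ) :
    (E.eigenspace κ).starProjection (B.basis i) = 0 := by
  rw [Submodule.starProjection_apply_eq_zero_iff, Submodule.mem_orthogonal]
  rintro x ⟨hx, hx'⟩
  have h1 := hx' ⟨_, B.mem_dom i⟩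
  rw [E.symm, B.form_basis, coord_eq_inner, real_inner_smul_left, real_inner_comm] at h1
  have h2 : (B.ev i - κ) * inner ℝ x (B.basis i) = 0 := by
    simp only at h1 ⊢
    linarith
  exact (mul_eq_zero.1 h2).resolve_left (sub_ne_zero.2 h)

open Classical in
theorem coord_starProjection (κ : ℝ) (h : Lp ℝ 2 m) (i : ι) :
    B.coord ((E.eigenspace κ).starProjection h) i = if B.ev i = κ then B.coord h i else 0 := by
  rw [coord_eq_inner, coord_eq_inner, ← Submodule.inner_starProjection_left_eq_right]
  split_ifs with hi
  · rw [← hi, B.starProjection_basis_of_eq]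
  · rw [B.starProjection_basis_of_ne hi, inner_zero_left]

/-- Links the norm of `V_s`, a sum over real numbers `κ`, to sums over basis indices: several basis
vectors may share an eigenvalue, and they form a fibre of `ev`. -/
theorem hasSum_fiber (s κ : ℝ) (h : Lp ℝ 2 m) :
    HasSum (fun i : {i // B.ev i = κ} => (B.ev i ^ s * B.coord h i) ^ 2)
      (‖(κ ^ s) • (E.eigenspace κ).starProjection h‖ ^ 2) := by
  have h1 := B.basis.hasSum_repr_sq ((κ ^ s) • (E.eigenspace κ).starProjection h)
  have h2 := hasSum_subtype_iff_indicator (f := fun i => (B.ev i ^ s * B.coord h i) ^ 2)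
    (s := {i | B.ev i = κ}) (a := ‖(κ ^ s) • (E.eigenspace κ).starProjection h‖ ^ 2)
  refine h2.2 (h1.congr_fun fun i => ?_)
  rw [map_smul, lp.coeFn_smul, Pi.smul_apply, smul_eq_mul]
  have h3 := B.coord_starProjection κ h i
  rw [coord] at h3
  rw [h3]
  by_cases hi : B.ev i = κ
  · rw [indicator_of_mem (by exact hi), if_pos hi, ← hi]
  · rw [indicator_of_notMem (by exact hi), if_neg hi]; simp

theorem mem_V_iff (s : ℝ) (h : Lp ℝ 2 m) :
    Memℓp (fun κ : ℝ => (κ ^ s) • (E.eigenspace κ).starProjection h) 2 ↔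
      Summable fun i => (B.ev i ^ s * B.coord h i) ^ 2 := by
  rw [memℓp_gen_iff (by norm_num)]
  simp only [ENNReal.toReal_ofNat, Real.rpow_ofNat]
  rw [← (Equiv.sigmaFiberEquiv B.ev).summable_iff, summable_sigma_of_nonneg
    (fun x => by simp only [Function.comp_apply]; positivity)]
  have h1 : ∀ κ : ℝ, HasSum (fun y : {i // B.ev i = κ} =>
    ((fun i => (B.ev i ^ s * B.coord h i) ^ 2) ∘ (Equiv.sigmaFiberEquiv B.ev)) ⟨κ, y⟩) _ :=
    fun κ => B.hasSum_fiber s κ h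
  constructor
  · intro hs
    refine ⟨fun κ => (h1 κ).summable, hs.congr fun κ => ((h1 κ).tsum_eq).symm⟩
  · rintro ⟨-, hs⟩
    exact hs.congr fun κ => (h1 κ).tsum_eq

theorem hasSum_norm_V_sq (s : ℝ) (h : E.V s) :
    HasSum (fun i => (B.ev i ^ s * B.coord (E.incl s h) i) ^ 2) (‖h‖ ^ 2) := by
  have hs : Summable fun i => (B.ev i ^ s * B.coord (E.incl s h) i) ^ 2 :=
    (B.mem_V_iff s _).1 h.2
  have h1 := (Equiv.sigmaFiberEquiv B.ev).hasSum_iff.2 hs.hasSum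
  have h2 := h1.sigma (fun κ => B.hasSum_fiber s κ (E.incl s h))
  rw [E.norm_V_sq, h2.tsum_eq]
  exact hs.hasSum

theorem exists_V {s : ℝ} {h : Lp ℝ 2 m} (hs : Summable fun i => (B.ev i ^ s * B.coord h i) ^ 2) :
    ∃ v : E.V s, E.incl s v = h :=
  ⟨⟨h, (B.mem_V_iff s h).2 hs⟩, rfl⟩

/-- The Hilbert basis of the energy space obtained by normalizing the eigenvectors. -/
def energyVec (i : ι) : E.EnergySpace :=
  (√(1 + B.ev i))⁻¹ • (show E.EnergySpace from (⟨B.basis i, B.mem_dom i⟩ : E.dom))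

theorem inner_energyVec (i : ι) (u : E.EnergySpace) :
    inner ℝ (B.energyVec i) u = √(1 + B.ev i) * B.coord (E.toDom u) i := by
  have h1 : 0 < 1 + B.ev i := by linarith [B.ev_pos i]
  have h2 : E.toDom (B.energyVec i) = (√(1 + B.ev i))⁻¹ • ⟨B.basis i, B.mem_dom i⟩ := rfl
  rw [energy_inner, h2, map_smul, LinearMap.smul_apply, B.form_basis, Submodule.coe_smul,
    real_inner_smul_left, ← coord_eq_inner, smul_eq_mul, ← mul_add]
  have h3 : √(1 + B.ev i) ≠ 0 := (Real.sqrt_pos.2 h1).ne'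
  field_simp
  rw [Real.sq_sqrt h1.le]
  ring

theorem coord_basis_self (i : ι) : B.coord (B.basis i) i = 1 := by
  rw [coord_eq_inner, real_inner_self_eq_norm_sq, B.basis.orthonormal.1]; norm_num

theorem coord_basis_of_ne {i j : ι} (h : i ≠ j) : B.coord (B.basis i) j = 0 := by
  rw [coord_eq_inner, B.basis.orthonormal.2 h.symm]

theorem coord_smul (c : ℝ) (h : Lp ℝ 2 m) (i : ι) : B.coord (c • h) i = c * B.coord h i := by
  rw [coord_eq_inner, inner_smul_right, coord_eq_inner]

theorem coord_add (g h : Lp ℝ 2 m) (i : ι) : B.coord (g + h) i = B.coord g i + B.coord h i := by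
  rw [coord_eq_inner, inner_add_right, coord_eq_inner, coord_eq_inner]

theorem coord_sub (g h : Lp ℝ 2 m) (i : ι) : B.coord (g - h) i = B.coord g i - B.coord h i := by
  rw [coord_eq_inner, inner_sub_right, coord_eq_inner, coord_eq_inner]

theorem coord_ext {g h : Lp ℝ 2 m} (H : ∀ i, B.coord g i = B.coord h i) : g = h :=
  B.basis.ext_repr H

theorem orthonormal_energyVec : Orthonormal ℝ B.energyVec := by
  have h2 : ∀ i, E.toDom (B.energyVec i) = (√(1 + B.ev i))⁻¹ • ⟨B.basis i, B.mem_dom i⟩ :=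
    fun i => rfl
  refine ⟨fun i => ?_, fun i j hij => ?_⟩
  · have h1 : 0 < 1 + B.ev i := by linarith [B.ev_pos i]
    have h3 : √(1 + B.ev i) ≠ 0 := (Real.sqrt_pos.2 h1).ne'
    have h4 : inner ℝ (B.energyVec i) (B.energyVec i) = (1 : ℝ) := by
      rw [B.inner_energyVec, h2, Submodule.coe_smul, B.coord_smul, B.coord_basis_self, mul_one,
        mul_inv_cancel₀ h3]
    rw [real_inner_self_eq_norm_sq] at h4
    exact (pow_eq_one_iff_of_nonneg (norm_nonneg _) two_ne_zero).1 h4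
  · simp only
    rw [B.inner_energyVec, h2, Submodule.coe_smul, B.coord_smul, B.coord_basis_of_ne hij.symm]
    ring

/-- The normalized eigenvectors as a Hilbert basis of the energy space. -/
def energyBasis : HilbertBasis ι ℝ E.EnergySpace :=
  HilbertBasis.mkOfOrthogonalEqBot B.orthonormal_energyVec (by
    rw [eq_bot_iff]
    intro u hu
    rw [Submodule.mem_orthogonal] at hu
    have h : (E.toDom u : Lp ℝ 2 m) = 0 := by
      refine B.coord_ext fun i => ?_
      have h1 := hu _ (Submodule.subset_span ⟨i, rfl⟩)
      rw [B.inner_energyVec] at h1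
      have h3 : √(1 + B.ev i) ≠ 0 := (Real.sqrt_pos.2 (by linarith [B.ev_pos i])).ne'
      rw [(mul_eq_zero.1 h1).resolve_left h3, coord_eq_inner, inner_zero_right]
    have h2 : E.toDom u = 0 := Subtype.ext h
    exact (Submodule.mem_bot ℝ).2 h2)

theorem energyBasis_repr (u : E.EnergySpace) (i : ι) :
    B.energyBasis.repr u i = √(1 + B.ev i) * B.coord (E.toDom u) i := by
  rw [B.energyBasis.repr_apply_apply, energyBasis, HilbertBasis.coe_mkOfOrthogonalEqBot,
    B.inner_energyVec]

theorem hasSum_coord_mul (g h : Lp ℝ 2 m) :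
    HasSum (fun i => B.coord g i * B.coord h i) (inner ℝ g h) :=
  B.basis.hasSum_repr_mul g h

theorem hasSum_coord_sq (h : Lp ℝ 2 m) : HasSum (fun i => B.coord h i ^ 2) (‖h‖ ^ 2) :=
  B.basis.hasSum_repr_sq h

/-- Parseval in the energy space minus Parseval in `L²`: the weights are `(1 + λ) - 1`. -/
theorem hasSum_form (u v : E.dom) :
    HasSum (fun i => B.ev i * (B.coord u i * B.coord v i)) (E.form u v) := by
  have h1 := B.energyBasis.hasSum_repr_mul (show E.EnergySpace from u)
    (show E.EnergySpace from v)
  have h2 := h1.sub (B.hasSum_coord_mul u v)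
  have h3 : inner ℝ (show E.EnergySpace from u) (show E.EnergySpace from v)
    = E.form u v + inner ℝ (u : Lp ℝ 2 m) (v : Lp ℝ 2 m) := rfl
  rw [h3, add_sub_cancel_right] at h2
  refine h2.congr_fun fun i => ?_
  have h4 := Real.mul_self_sqrt (show 0 ≤ 1 + B.ev i by linarith [B.ev_pos i])
  rw [B.energyBasis_repr, B.energyBasis_repr]
  have h5 : ∀ w : E.dom, E.toDom (show E.EnergySpace from w) = w := fun _ => rfl
  rw [h5, h5]
  linear_combination (-(B.coord u i * B.coord v i)) * h4

/-- Riesz–Fischer in the energy space yields an element with the right coefficients, and it is `h`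
because its `L²` coordinates agree with those of `h`. -/
theorem mem_dom_of_summable {h : Lp ℝ 2 m} (hs : Summable fun i => B.ev i * B.coord h i ^ 2) :
    h ∈ E.dom := by
  have h1 : Summable fun i => (√(1 + B.ev i) * B.coord h i) ^ 2 := by
    refine (hs.add (B.hasSum_coord_sq h).summable).congr fun i => ?_
    rw [mul_pow, Real.sq_sqrt (by linarith [B.ev_pos i])]
    ring
  obtain ⟨u, hu⟩ := B.energyBasis.exists_repr_eq h1
  have h2 : (E.toDom u : Lp ℝ 2 m) = h := by
    refine B.coord_ext fun i => ?_
    have h3 := hu i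
    rw [B.energyBasis_repr] at h3
    exact mul_left_cancel₀ (Real.sqrt_pos.2 (by linarith [B.ev_pos i])).ne' h3
  rw [← h2]
  exact (E.toDom u).2

theorem countable_index (B : E.EigenBasis ι) : Countable ι := by
  have : (univ : Set ι) = ⋃ n : ℕ, {i | B.ev i ≤ n} := by
    ext i
    simp only [mem_univ, mem_iUnion, mem_ofPred_eq, true_iff]
    exact exists_nat_ge (B.ev i)
  rw [← countable_univ_iff, this]
  exact countable_iUnion fun n => (B.finite_le n).countable

end EigenBasis
end DirichletForm

/-! ### Resolvents: the Markov property and contraction in `L¹`. -/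

namespace DirichletForm

variable {X : Type u} [MeasurableSpace X] {m : Measure X} {E : DirichletForm m} {ι : Type*}

namespace EigenBasis

/-- The resolvent `(1 + τ A)⁻¹`. -/
def res (B : E.EigenBasis ι) (τ : ℝ) : Lp ℝ 2 m →L[ℝ] Lp ℝ 2 m :=
  B.basis.diag fun i => 1 / (1 + τ * B.ev i)

variable (B : E.EigenBasis ι) {τ : ℝ}

theorem one_le_one_add_mul_ev (hτ : 0 < τ) (i : ι) : 1 ≤ 1 + τ * B.ev i := by
  have := mul_pos hτ (B.ev_pos i)
  linarith

theorem coord_res (hτ : 0 < τ) (g : Lp ℝ 2 m) (i : ι) :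
    B.coord (B.res τ g) i = 1 / (1 + τ * B.ev i) * B.coord g i := by
  refine HilbertBasis.repr_diag (K := 1) (fun i => ?_) g i
  have := B.one_le_one_add_mul_ev hτ i
  rw [abs_of_pos (by positivity), div_le_one (by positivity)]
  exact this

theorem res_mem_dom (hτ : 0 < τ) (g : Lp ℝ 2 m) : B.res τ g ∈ E.dom := by
  refine B.mem_dom_of_summable ?_
  refine Summable.of_nonneg_of_le (fun i => mul_nonneg (B.ev_pos i).le (sq_nonneg _))
    (fun i => ?_) ((B.hasSum_coord_sq g).summable.mul_left (1 / τ))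
  rw [B.coord_res hτ, mul_pow, ← mul_assoc]
  refine mul_le_mul_of_nonneg_right ?_ (sq_nonneg _)
  have h1 := B.ev_pos i
  have h2 := B.one_le_one_add_mul_ev hτ i
  have h3 := mul_pos hτ h1
  rw [div_pow, one_pow, mul_one_div, div_le_div_iff₀ (by positivity) hτ]
  nlinarith

theorem form_res (hτ : 0 < τ) (g : Lp ℝ 2 m) (v : E.dom) :
    τ * E.form ⟨B.res τ g, B.res_mem_dom hτ g⟩ v + inner ℝ (B.res τ g) (v : Lp ℝ 2 m) =
      inner ℝ g (v : Lp ℝ 2 m) := by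
  have h1 := ((B.hasSum_form ⟨B.res τ g, B.res_mem_dom hτ g⟩ v).mul_left τ).add
    (B.hasSum_coord_mul (B.res τ g) v)
  refine (h1.congr_fun fun i => ?_).unique (B.hasSum_coord_mul g v)
  have h2 := B.one_le_one_add_mul_ev hτ i
  simp only [B.coord_res hτ]
  field_simp
  ring

theorem inner_res_comm (hτ : 0 < τ) (g h : Lp ℝ 2 m) :
    inner ℝ (B.res τ g) h = inner ℝ g (B.res τ h) := by
  refine ((B.hasSum_coord_mul _ h).congr_fun fun i => ?_).unique (B.hasSum_coord_mul g _)
  rw [B.coord_res hτ, B.coord_res hτ]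
  ring

/-- The resolvent of `g` is the unique minimizer of `v ↦ τ 𝓔(v, v) + ‖v - g‖²`. Composing it with
the contraction `η` increases neither term, so it is unchanged by `η` and takes its values in the
range of `η`. -/
theorem res_markov_aux (hτ : 0 < τ) {g : Lp ℝ 2 m} (hg : ∀ᵐ x ∂m, 0 ≤ g x ∧ g x ≤ 1)
    {ε : ℝ} (hε : 0 < ε) : ∀ᵐ x ∂m, -ε ≤ B.res τ g x ∧ B.res τ g x ≤ 1 + ε := by
  obtain ⟨η, -, hη1, hη2, hη3, hη4⟩ := E.markov ε hε
  set u : E.dom := ⟨B.res τ g, B.res_mem_dom hτ g⟩ with hu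
  obtain ⟨v, hv, hvu⟩ := hη4 u
  -- Since `η` fixes `[0, 1]` and is monotone and nonexpansive, it moves no point away from a value
  -- `c` of `g`.
  have hpt : ∀ t c : ℝ, 0 ≤ c → c ≤ 1 → |η t - c| ≤ |t - c| := by
    intro t c hc0 hc1
    rcases lt_or_ge t 0 with h | h
    · have h1 := hη3 t 0 h
      rw [hη1 0 (by simp)] at h1
      rw [abs_of_nonpos (by linarith), abs_of_nonpos (by linarith)]
      linarith
    · rcases le_or_gt t 1 with h' | h'
      · rw [hη1 t ⟨h, h'⟩]
      · have h1 := hη3 1 t h'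
        rw [hη1 1 (by simp)] at h1
        rw [abs_of_nonneg (by linarith), abs_of_nonneg (by linarith)]
        linarith
  have hnorm : ‖(v : Lp ℝ 2 m) - g‖ ≤ ‖(u : Lp ℝ 2 m) - g‖ := by
    refine Lp.norm_le_norm_of_ae_le ?_
    filter_upwards [hv, hg, Lp.coeFn_sub (v : Lp ℝ 2 m) g, Lp.coeFn_sub (u : Lp ℝ 2 m) g]
      with x h1 h2 h3 h4
    rw [h3, h4, Pi.sub_apply, Pi.sub_apply, h1]
    exact hpt _ _ h2.1 h2.2
  -- The Euler–Lagrange identity in the direction `v - u` cancels the first order terms of the two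
  -- expansions below, and `‖v - u‖² ≤ 0` remains.
  have h1 := B.form_res hτ g (v - u)
  rw [← hu] at h1
  have h2 : E.form v v = E.form u u + 2 * E.form u (v - u) + E.form (v - u) (v - u) := by
    simp only [map_sub, LinearMap.sub_apply]
    rw [E.symm v u]
    ring
  have h3 : ‖(v : Lp ℝ 2 m) - g‖ ^ 2 = ‖(u : Lp ℝ 2 m) - g‖ ^ 2
      + 2 * inner ℝ ((u : Lp ℝ 2 m) - g) ((v - u : E.dom) : Lp ℝ 2 m)
      + ‖((v - u : E.dom) : Lp ℝ 2 m)‖ ^ 2 := by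
    rw [← norm_add_sq_real]
    congr 2
    push_cast
    abel
  rw [inner_sub_left] at h3
  have h4 : ‖(v : Lp ℝ 2 m) - g‖ ^ 2 ≤ ‖(u : Lp ℝ 2 m) - g‖ ^ 2 :=
    pow_le_pow_left₀ (norm_nonneg _) hnorm 2
  have h5 := E.nonneg (v - u)
  have h6 : ‖((v - u : E.dom) : Lp ℝ 2 m)‖ ^ 2 ≤ 0 := by
    have h7 : 0 ≤ τ * (E.form u u - E.form v v) := mul_nonneg hτ.le (by linarith)
    have h8 : 0 ≤ τ * E.form (v - u) (v - u) := mul_nonneg hτ.le h5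
    have h9 : (u : Lp ℝ 2 m) = B.res τ g := rfl
    rw [h9] at h3
    nlinarith
  have h7 : ((v - u : E.dom) : Lp ℝ 2 m) = 0 := by
    rw [← norm_eq_zero]
    exact pow_eq_zero_iff two_ne_zero |>.1 (le_antisymm h6 (sq_nonneg _))
  have h8 : (v : Lp ℝ 2 m) = B.res τ g := by
    rw [Submodule.coe_sub] at h7
    exact sub_eq_zero.1 h7
  rw [h8] at hv
  filter_upwards [hv] with x hx
  rw [hx]
  exact hη2 _

/-- The resolvent is Markovian. -/
theorem res_markov (hτ : 0 < τ) {g : Lp ℝ 2 m} (hg : ∀ᵐ x ∂m, 0 ≤ g x ∧ g x ≤ 1) :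
    ∀ᵐ x ∂m, 0 ≤ B.res τ g x ∧ B.res τ g x ≤ 1 := by
  have h : ∀ n : ℕ, ∀ᵐ x ∂m, -(1 / ((n : ℝ) + 1)) ≤ B.res τ g x ∧
      B.res τ g x ≤ 1 + 1 / ((n : ℝ) + 1) :=
    fun n => B.res_markov_aux hτ hg (by positivity)
  filter_upwards [ae_all_iff.2 h] with x hx
  have hlim := tendsto_one_div_add_atTop_nhds_zero_nat (𝕜 := ℝ)
  constructor
  · have := hlim.neg
    rw [neg_zero] at this
    exact le_of_tendsto this (Eventually.of_forall fun n => (hx n).1)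
  · have := hlim.const_add 1
    rw [add_zero] at this
    exact ge_of_tendsto this (Eventually.of_forall fun n => (hx n).2)

theorem abs_res_le_one (hτ : 0 < τ) {g : Lp ℝ 2 m} (hg : ∀ᵐ x ∂m, |g x| ≤ 1) :
    ∀ᵐ x ∂m, |B.res τ g x| ≤ 1 := by
  have hdec : g = Lp.posPart g - Lp.negPart g := by
    refine Lp.ext ?_
    filter_upwards [Lp.coeFn_sub (Lp.posPart g) (Lp.negPart g), Lp.coeFn_posPart g,
      Lp.coeFn_negPart_eq_max g] with x h1 h2 h3
    rw [h1, Pi.sub_apply, h2, h3]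
    rcases le_total 0 (g x) with h | h
    · rw [max_eq_left h, max_eq_right (by linarith), sub_zero]
    · rw [max_eq_right h, max_eq_left (by linarith)]; ring
  have hp : ∀ᵐ x ∂m, 0 ≤ Lp.posPart g x ∧ Lp.posPart g x ≤ 1 := by
    filter_upwards [Lp.coeFn_posPart g, hg] with x h1 h2
    rw [h1]
    exact ⟨le_max_right _ _, max_le (abs_le.1 h2).2 zero_le_one⟩
  have hn : ∀ᵐ x ∂m, 0 ≤ Lp.negPart g x ∧ Lp.negPart g x ≤ 1 := by
    filter_upwards [Lp.coeFn_negPart_eq_max g, hg] with x h1 h2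
    rw [h1]
    exact ⟨le_max_right _ _, max_le (by linarith [(abs_le.1 h2).1]) zero_le_one⟩
  have heq : B.res τ g = B.res τ (Lp.posPart g) - B.res τ (Lp.negPart g) := by
    rw [← map_sub, ← hdec]
  rw [heq]
  filter_upwards [B.res_markov hτ hp, B.res_markov hτ hn,
    Lp.coeFn_sub (B.res τ (Lp.posPart g)) (B.res τ (Lp.negPart g))] with x h1 h2 h3
  rw [h3, Pi.sub_apply, abs_le]
  constructor <;> linarith

variable [IsFiniteMeasure m]

theorem real_inner_eq_mul (a b : ℝ) : inner ℝ a b = a * b := by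
  rw [mul_comm]; rfl

theorem integrable_of_Lp_two {X : Type*} [MeasurableSpace X] {m : Measure X} [IsFiniteMeasure m]
    (g : Lp ℝ 2 m) : Integrable g m :=
  (Lp.memLp g).integrable one_le_two

theorem exists_sign (g : Lp ℝ 2 m) : ∃ s : Lp ℝ 2 m, (∀ᵐ x ∂m, |s x| ≤ 1) ∧
    ∀ᵐ x ∂m, s x * g x = |g x| := by
  have hmeas : StronglyMeasurable (fun x => if 0 ≤ g x then (1 : ℝ) else -1) := by
    refine StronglyMeasurable.ite ?_ stronglyMeasurable_const stronglyMeasurable_const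
    exact measurableSet_le measurable_const (Lp.stronglyMeasurable g).measurable
  have hmem : MemLp (fun x => if 0 ≤ g x then (1 : ℝ) else -1) 2 m := by
    refine MemLp.of_bound hmeas.aestronglyMeasurable 1 (Eventually.of_forall fun x => ?_)
    split_ifs <;> simp
  refine ⟨hmem.toLp _, ?_, ?_⟩
  · filter_upwards [hmem.coeFn_toLp] with x hx
    rw [hx]
    split_ifs <;> simp
  · filter_upwards [hmem.coeFn_toLp] with x hx
    rw [hx]
    split_ifs with h
    · rw [one_mul, abs_of_nonneg h]
    · rw [abs_of_neg (not_le.1 h)]; ring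

/-- Dual to the `L^∞` contraction: pair the resolvent with its own sign and move it to the other
factor by symmetry. -/
theorem integral_abs_res_le (hτ : 0 < τ) (g : Lp ℝ 2 m) :
    ∫ x, |B.res τ g x| ∂m ≤ ∫ x, |g x| ∂m := by
  obtain ⟨s, hs1, hs2⟩ := exists_sign (B.res τ g)
  have h1 : ∫ x, |B.res τ g x| ∂m = inner ℝ s (B.res τ g) := by
    rw [L2.inner_def]
    refine integral_congr_ae ?_
    filter_upwards [hs2] with x hx
    rw [← hx, real_inner_eq_mul]
  rw [h1, ← B.inner_res_comm hτ, L2.inner_def]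
  refine integral_mono_ae (L2.integrable_inner _ _) (integrable_of_Lp_two g).abs ?_
  filter_upwards [B.abs_res_le_one hτ hs1] with x hx
  rw [real_inner_eq_mul]
  calc B.res τ s x * g x ≤ |B.res τ s x * g x| := le_abs_self _
    _ = |B.res τ s x| * |g x| := abs_mul _ _
    _ ≤ 1 * |g x| := mul_le_mul_of_nonneg_right hx (abs_nonneg _)
    _ = |g x| := one_mul _

end EigenBasis
end DirichletForm

/-! ### Nash's inequality and ultracontractivity. -/

namespace DirichletForm

variable {X : Type u} [MeasurableSpace X] {m : Measure X} {E : DirichletForm m} {ι : Type*}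

theorem lintegral_enorm_sq (g : Lp ℝ 2 m) : ∫⁻ x, ‖g x‖ₑ ^ (2 : ℝ) ∂m = ENNReal.ofReal (‖g‖ ^ 2) := by
  have h1 := Lp.enorm_def g
  rw [eLpNorm_eq_lintegral_rpow_enorm_toReal two_ne_zero ENNReal.ofNat_ne_top] at h1
  simp only [ENNReal.toReal_ofNat] at h1
  have h2 : (∫⁻ x, ‖g x‖ₑ ^ (2 : ℝ) ∂m) = ‖g‖ₑ ^ (2 : ℝ) := by
    rw [h1, ← ENNReal.rpow_mul]; norm_num
  rw [h2, ENNReal.rpow_ofNat, ← ofReal_norm, ENNReal.ofReal_pow (norm_nonneg _)]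

theorem lintegral_enorm_one [IsFiniteMeasure m] (g : Lp ℝ 2 m) :
    ∫⁻ x, ‖g x‖ₑ ∂m = ENNReal.ofReal (∫ x, |g x| ∂m) := by
  have := ofReal_integral_norm_eq_lintegral_enorm (EigenBasis.integrable_of_Lp_two g)
  simpa [Real.norm_eq_abs] using this.symm

namespace EigenBasis

variable (B : E.EigenBasis ι)

theorem low_mul_norm_sq_le (u : E.dom) : B.low * ‖u‖ ^ 2 ≤ E.form u u := by
  refine hasSum_le (fun i => ?_) ((B.hasSum_coord_sq u).mul_left B.low) (B.hasSum_form u u)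
  rw [← sq]
  exact mul_le_mul_of_nonneg_right (B.low_le i) (sq_nonneg _)

/-- Nash's inequality. -/
theorem nash [IsFiniteMeasure m] (B : E.EigenBasis ι) {q : ℝ} (hq : 1 < q) (hs : E.SobolevEmbedding q) :
    ∃ C : ℝ, 0 < C ∧ ∀ u : E.dom, (‖u‖ ^ 2) ^ (1 + (q - 1) / q) ≤
      C * E.form u u * (∫ x, |(u : Lp ℝ 2 m) x| ∂m) ^ (2 * ((q - 1) / q)) := by
  obtain ⟨C₀, hC₀⟩ := hs
  refine ⟨(|C₀| + 1) ^ 2 * (1 + 1 / B.low), by have := B.low_pos; positivity, fun u => ?_⟩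
  set a := ∫ x, |(u : Lp ℝ 2 m) x| ∂m with ha
  have ha0 : 0 ≤ a := integral_nonneg fun x => abs_nonneg _
  set D := (|C₀| + 1) ^ 2 * (E.form u u + ‖u‖ ^ 2) with hD
  have hform := E.nonneg u
  have hD0 : 0 ≤ D := by positivity
  -- The spectral gap absorbs `‖u‖²` into the form, at the cost of the factor `1 + 1 / low`.
  have hDle : D ≤ (|C₀| + 1) ^ 2 * (1 + 1 / B.low) * E.form u u := by
    rw [hD, mul_assoc]
    refine mul_le_mul_of_nonneg_left ?_ (by positivity)
    have := B.low_mul_norm_sq_le u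
    rw [add_mul, one_mul, one_div, add_le_add_iff_left, ← div_eq_inv_mul, le_div_iff₀ B.low_pos]
    linarith
  have hq0 : 0 < q := by linarith
  have h2q : 0 < 2 * q - 1 := by linarith
  have h1 : ∫⁻ x, ‖(u : Lp ℝ 2 m) x‖ₑ ^ (2 * q) ∂m ≤ ENNReal.ofReal (D ^ q) := by
    have h2 := hC₀ u
    rw [eLpNorm_eq_lintegral_rpow_enorm_toReal (by simp; linarith) ENNReal.ofReal_ne_top,
      ENNReal.toReal_ofReal (by linarith)] at h2
    have h3 : ENNReal.ofReal (C₀ * √(E.form u u + ‖u‖ ^ 2)) ≤ ENNReal.ofReal (√D) := by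
      refine ENNReal.ofReal_le_ofReal ?_
      rw [hD, Real.sqrt_mul (by positivity), Real.sqrt_sq (by positivity)]
      exact mul_le_mul_of_nonneg_right (by linarith [le_abs_self C₀]) (Real.sqrt_nonneg _)
    have h4 := ENNReal.rpow_le_rpow (h2.trans h3) (show 0 ≤ 2 * q by linarith)
    rw [← ENNReal.rpow_mul, one_div, inv_mul_cancel₀ (by linarith), ENNReal.rpow_one] at h4
    refine h4.trans (le_of_eq ?_)
    rw [ENNReal.ofReal_rpow_of_nonneg (Real.sqrt_nonneg _) (by linarith), Real.sqrt_eq_rpow,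
      ← Real.rpow_mul hD0]
    congr 2
    ring
  have hmeas : AEMeasurable (fun x => ‖(u : Lp ℝ 2 m) x‖ₑ) m :=
    (Lp.aestronglyMeasurable (u : Lp ℝ 2 m)).enorm
  -- Hölder's interpolation of `L²` between `L¹` and `L^{2q}`.
  have h5 := ENNReal.lintegral_mul_norm_pow_le hmeas (hmeas.pow_const (2 * q))
    (p := (2 * q - 2) / (2 * q - 1)) (q := 1 / (2 * q - 1))
    (div_nonneg (by linarith) h2q.le) (by positivity) (by field_simp; ring)
  have h6 : ∀ x, ‖(u : Lp ℝ 2 m) x‖ₑ ^ ((2 * q - 2) / (2 * q - 1)) *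
      (‖(u : Lp ℝ 2 m) x‖ₑ ^ (2 * q)) ^ (1 / (2 * q - 1)) = ‖(u : Lp ℝ 2 m) x‖ₑ ^ (2 : ℝ) := by
    intro x
    rw [← ENNReal.rpow_mul, ← ENNReal.rpow_add_of_nonneg _ _
      (div_nonneg (by linarith) h2q.le) (by positivity)]
    congr 1
    field_simp; ring
  simp only [h6] at h5
  rw [lintegral_enorm_sq, lintegral_enorm_one] at h5
  have h7 : ENNReal.ofReal (‖(u : Lp ℝ 2 m)‖ ^ 2) ≤
      ENNReal.ofReal (a ^ ((2 * q - 2) / (2 * q - 1)) * (D ^ q) ^ (1 / (2 * q - 1))) := by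
    refine h5.trans ?_
    rw [ENNReal.ofReal_mul (by positivity), ← ENNReal.ofReal_rpow_of_nonneg ha0
      (div_nonneg (by linarith) h2q.le), ← ENNReal.ofReal_rpow_of_nonneg (x := D ^ q)
      (by positivity) (by positivity)]
    gcongr
  rw [ENNReal.ofReal_le_ofReal_iff (by positivity)] at h7
  have h8 : 0 ≤ 1 + (q - 1) / q := by
    have : 0 ≤ (q - 1) / q := div_nonneg (by linarith) hq0.le
    linarith
  -- The exponent is `(2q - 1) / q`, chosen so that `D` appears to the power one.
  calc (‖u‖ ^ 2) ^ (1 + (q - 1) / q)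
      ≤ (a ^ ((2 * q - 2) / (2 * q - 1)) * (D ^ q) ^ (1 / (2 * q - 1))) ^ (1 + (q - 1) / q) :=
        Real.rpow_le_rpow (by positivity) h7 h8
    _ = D * a ^ (2 * ((q - 1) / q)) := by
        rw [Real.mul_rpow (by positivity) (by positivity), ← Real.rpow_mul ha0,
          ← Real.rpow_mul hD0, ← Real.rpow_mul hD0, mul_comm]
        congr 1
        · rw [show q * (1 / (2 * q - 1)) * (1 + (q - 1) / q) = 1 by
            have h9 : 2 * q - 1 ≠ 0 := h2q.ne'
            rw [mul_one_div, div_mul_eq_mul_div, mul_add, mul_div_cancel₀ _ hq0.ne', mul_one,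
              show q + (q - 1) = 2 * q - 1 by ring, div_self h9], Real.rpow_one]
        · congr 1
          field_simp
          ring
    _ ≤ _ := mul_le_mul_of_nonneg_right hDle (by positivity)

/-- A discrete form of the inequality `y' ≤ -c y ^ (1 + δ)`. -/
theorem discrete_nash {y : ℕ → ℝ} {δ s : ℝ} (hδ0 : 0 < δ) (hδ1 : δ ≤ 1) (hs0 : 0 < s)
    (hy0 : ∀ n, 0 ≤ y n) (hstep : ∀ n, y (n + 1) + s * y (n + 1) ^ (1 + δ) ≤ y n)
    (hsmall : s * y 0 ^ δ ≤ 1) (n : ℕ) (hn : 0 < n) : y n ≤ (n * (s * δ / 4)) ^ (-1 / δ) := by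
  rcases (hy0 n).eq_or_lt with h0 | hpos
  · rw [← h0]; positivity
  have hanti : Antitone y := antitone_nat_of_succ_le fun k => by
    have := hstep k
    have h2 : 0 ≤ s * y (k + 1) ^ (1 + δ) := mul_nonneg hs0.le (Real.rpow_nonneg (hy0 _) _)
    linarith
  have hposk : ∀ k ≤ n, 0 < y k := fun k hk => hpos.trans_le (hanti hk)
  -- Discrete form of `(y^{-δ})' ≥ c δ`: the quantity `y^{-δ}` grows by at least `s δ / 4` at each
  -- step.
  have hind : ∀ k ≤ n, k * (s * δ / 4) ≤ y k ^ (-δ) := by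
    intro k
    induction k with
    | zero => intro _; simp; exact Real.rpow_nonneg (hy0 _) _
    | succ k ih =>
      intro hk
      have h1 := ih (by omega)
      have hyk := hposk (k + 1) hk
      set z := s * y (k + 1) ^ δ with hz
      have hz0 : 0 < z := mul_pos hs0 (Real.rpow_pos_of_pos hyk _)
      -- The smallness of the step, with the monotonicity of `y`, keeps the relative decrement `z`
      -- at most `1`. This is what allows the linear bound `(1 + z)^{-δ} ≤ 1 - δ z / 4`.
      have hz1 : z ≤ 1 := le_trans (mul_le_mul_of_nonneg_left
        (Real.rpow_le_rpow hyk.le (hanti (Nat.zero_le _)) hδ0.le) hs0.le) hsmall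
      have h2 : y (k + 1) * (1 + z) ≤ y k := by
        refine le_trans (le_of_eq ?_) (hstep k)
        rw [hz, Real.rpow_add hyk, Real.rpow_one]; ring
      have h3 : y k ^ (-δ) ≤ (y (k + 1) * (1 + z)) ^ (-δ) :=
        Real.rpow_le_rpow_of_nonpos (by positivity) h2 (by linarith)
      rw [Real.mul_rpow hyk.le (by positivity)] at h3
      have h4 : (1 + z) ^ (-δ) ≤ 1 - δ * z / 4 := by
        rw [Real.rpow_def_of_pos (by positivity)]
        have h5 : z / 2 ≤ Real.log (1 + z) := by
          refine le_trans ?_ (Real.le_log_one_add_of_nonneg hz0.le)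
          rw [div_le_div_iff₀ (by norm_num) (by positivity)]
          nlinarith
        have h6 : Real.exp (Real.log (1 + z) * -δ) ≤ Real.exp (-(δ * z / 2)) := by
          refine Real.exp_le_exp.2 ?_
          nlinarith
        refine h6.trans ?_
        have h7 := Real.add_one_le_exp (δ * z / 2)
        have hdz : δ * z ≤ 1 := by nlinarith
        have hdz0 : 0 < δ * z := mul_pos hδ0 hz0
        rw [Real.exp_neg, inv_le_iff_one_le_mul₀ (Real.exp_pos _)]
        nlinarith
      have h8 : y (k + 1) ^ (-δ) * (1 - δ * z / 4) = y (k + 1) ^ (-δ) - s * δ / 4 := by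
        have : y (k + 1) ^ (-δ) * y (k + 1) ^ δ = 1 := by
          rw [← Real.rpow_add hyk]; simp
        rw [hz]
        linear_combination (-(δ * s / 4)) * this
      have h9 := mul_le_mul_of_nonneg_left h4 (Real.rpow_nonneg hyk.le (-δ))
      push_cast
      linarith
  have h1 := hind n le_rfl
  have h2 : 0 < n * (s * δ / 4) := by positivity
  have h3 := Real.rpow_le_rpow_of_nonpos h2 h1 (show -1 / δ ≤ 0 from
    div_nonpos_of_nonpos_of_nonneg (by norm_num) hδ0.le)
  rw [← Real.rpow_mul hpos.le, show -δ * (-1 / δ) = 1 by field_simp, Real.rpow_one] at h3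
  exact h3

/-- Dissipation in one implicit Euler step `g = (1 + τ A) v`: the squared norm of `g` is the left
side plus `‖τ A v‖²`, read coordinate by coordinate. -/
theorem norm_sq_res_add_le {τ : ℝ} (hτ : 0 < τ) (g : Lp ℝ 2 m) :
    ‖B.res τ g‖ ^ 2 + 2 * τ * E.form ⟨B.res τ g, B.res_mem_dom hτ g⟩ ⟨B.res τ g, B.res_mem_dom hτ g⟩
      ≤ ‖g‖ ^ 2 := by
  refine hasSum_le (fun i => ?_) ((B.hasSum_coord_sq (B.res τ g)).add
    ((B.hasSum_form ⟨B.res τ g, B.res_mem_dom hτ g⟩ ⟨B.res τ g, B.res_mem_dom hτ g⟩).mul_left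
      (2 * τ))) (B.hasSum_coord_sq g)
  have h1 := B.one_le_one_add_mul_ev hτ i
  simp only
  rw [B.coord_res hτ]
  have h2 : B.coord g i = (1 + τ * B.ev i) * (1 / (1 + τ * B.ev i) * B.coord g i) := by field_simp
  set w := 1 / (1 + τ * B.ev i) * B.coord g i
  rw [h2]
  nlinarith [mul_nonneg (sq_nonneg (τ * B.ev i)) (sq_nonneg w)]

theorem coord_res_iterate {τ : ℝ} (hτ : 0 < τ) (g : Lp ℝ 2 m) (i : ι) (n : ℕ) :
    B.coord g i = (1 + τ * B.ev i) ^ n * B.coord ((B.res τ)^[n] g) i := by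
  induction n with
  | zero => simp
  | succ n ih =>
    have h1 := B.one_le_one_add_mul_ev hτ i
    rw [Function.iterate_succ_apply', B.coord_res hτ, ih]
    field_simp
    ring

/-- Ultracontractivity, in the form of a bound of spectral sums of `L¹` functions. -/
theorem sum_coord_sq_le [IsFiniteMeasure m] {q : ℝ} (hq : 1 < q) (hs : E.SobolevEmbedding q) :
    ∃ C : ℝ, 0 < C ∧ ∀ (N : ℝ), 0 < N → ∀ g : Lp ℝ 2 m,
      ∑ i ∈ (B.finite_le N).toFinset, B.coord g i ^ 2 ≤
        C * N ^ (2 * thetaA q) * (∫ x, |g x| ∂m) ^ 2 := by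
  obtain ⟨C₀, hC₀, hnash⟩ := B.nash hq hs
  have hq0 : 0 < q := by linarith
  set δ := (q - 1) / q with hδ
  have hδ0 : 0 < δ := div_pos (by linarith) hq0
  have hδ1 : δ ≤ 1 := by rw [hδ, div_le_one hq0]; linarith
  have hθ : 2 * thetaA q = 1 / δ := by
    rw [thetaA, hδ]
    have : q - 1 ≠ 0 := by linarith
    field_simp
  refine ⟨Real.exp 2 * (2 / C₀ * δ / 4) ^ (-1 / δ), by positivity, fun N hN g => ?_⟩
  set M := ∫ x, |g x| ∂m with hM
  have hM0 : 0 ≤ M := integral_nonneg fun x => abs_nonneg _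
  rcases hM0.eq_or_lt with h0 | hMpos
  · have hg : g = 0 := by
      have h1 := (integral_eq_zero_iff_of_nonneg (fun x => abs_nonneg _)
        (integrable_of_Lp_two g).abs).1 (hM.symm.trans h0.symm)
      refine Lp.ext ?_
      filter_upwards [h1, Lp.coeFn_zero ℝ 2 m] with x hx hx'
      rw [hx']
      exact abs_eq_zero.1 hx
    have h1 : ∀ i, B.coord g i = 0 := fun i => by
      rw [hg, B.coord_eq_inner, inner_zero_right]
    simp only [h1, ← h0]
    simp
  -- The second entry of the maximum is the size needed for the smallness condition of
  -- `discrete_nash`.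
  obtain ⟨n, hn⟩ := exists_nat_gt (max 1 (2 / C₀ / M ^ (2 * δ) / N * (‖g‖ ^ 2) ^ δ))
  have hn1 : (1 : ℝ) < n := (le_max_left _ _).trans_lt hn
  have hn0 : 0 < n := by
    have : (0 : ℝ) < n := by linarith
    exact_mod_cast this
  have hnr : (0 : ℝ) < n := by linarith
  -- The `n` implicit Euler steps amount to the total time `1 / N`. They play the role of the heat
  -- semigroup `e^{-A/N}`.
  set τ : ℝ := 1 / (N * n) with hτd
  have hτ : 0 < τ := by positivity
  set u : ℕ → Lp ℝ 2 m := fun k => (B.res τ)^[k] g with hu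
  have hsucc : ∀ k, u (k + 1) = B.res τ (u k) := fun k => Function.iterate_succ_apply' _ _ _
  have hL1 : ∀ k, ∫ x, |u k x| ∂m ≤ M := by
    intro k
    induction k with
    | zero => exact le_rfl
    | succ k ih => rw [hsucc]; exact (B.integral_abs_res_le hτ _).trans ih
  have hMδ : 0 < M ^ (2 * δ) := Real.rpow_pos_of_pos hMpos _
  set s := 2 * τ / (C₀ * M ^ (2 * δ)) with hsd
  have hs0 : 0 < s := by positivity
  -- Dissipation combined with Nash's inequality; the `L¹` norms of the iterates never exceed `M`.
  have hstep : ∀ k, ‖u (k + 1)‖ ^ 2 + s * (‖u (k + 1)‖ ^ 2) ^ (1 + δ) ≤ ‖u k‖ ^ 2 := by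
    intro k
    have h1 := B.norm_sq_res_add_le hτ (u k)
    have h2 := hnash ⟨B.res τ (u k), B.res_mem_dom hτ _⟩
    have h3 : (∫ x, |B.res τ (u k) x| ∂m) ^ (2 * δ) ≤ M ^ (2 * δ) := by
      rw [← hsucc]
      exact Real.rpow_le_rpow (integral_nonneg fun x => abs_nonneg _) (hL1 _) (by positivity)
    have h4 := E.nonneg ⟨B.res τ (u k), B.res_mem_dom hτ (u k)⟩
    set F := E.form ⟨B.res τ (u k), B.res_mem_dom hτ (u k)⟩ ⟨B.res τ (u k), B.res_mem_dom hτ (u k)⟩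
    have h5 : (‖u (k + 1)‖ ^ 2) ^ (1 + δ) ≤ C₀ * F * M ^ (2 * δ) := by
      rw [hsucc]
      exact h2.trans (mul_le_mul_of_nonneg_left h3 (by positivity))
    rw [hsucc] at h5 ⊢
    refine le_trans ?_ h1
    rw [add_le_add_iff_left]
    calc s * (‖B.res τ (u k)‖ ^ 2) ^ (1 + δ) ≤ s * (C₀ * F * M ^ (2 * δ)) :=
          mul_le_mul_of_nonneg_left h5 hs0.le
      _ = 2 * τ * F := by rw [hsd]; field_simp
  have hsmall : s * (‖u 0‖ ^ 2) ^ δ ≤ 1 := by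
    have h1 := (le_max_right _ _).trans hn.le
    have h2 : s * (‖u 0‖ ^ 2) ^ δ =
        (2 / C₀ / M ^ (2 * δ) / N * (‖g‖ ^ 2) ^ δ) / n := by
      have : u 0 = g := rfl
      rw [this, hsd, hτd]; field_simp
    rw [h2, div_le_one hnr]
    exact h1
  have hfin := discrete_nash (y := fun k => ‖u k‖ ^ 2) hδ0 hδ1 hs0 (fun k => sq_nonneg _) hstep
    hsmall n hn0
  have h6 : (n * (s * δ / 4) : ℝ) = (2 / C₀ * δ / 4) * (1 / N * M ^ (-(2 * δ))) := by
    rw [hsd, hτd, Real.rpow_neg hM0]; field_simp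
  have h7 : (n * (s * δ / 4) : ℝ) ^ (-1 / δ) = (2 / C₀ * δ / 4) ^ (-1 / δ) * (N ^ (1 / δ) * M ^ 2) := by
    rw [h6, Real.mul_rpow (by positivity) (by positivity), Real.mul_rpow (by positivity)
      (by positivity), ← Real.rpow_mul hM0, one_div, Real.inv_rpow hN.le, ← Real.rpow_neg hN.le]
    congr 2
    · congr 1; ring
    · rw [show -(2 * δ) * (-1 / δ) = 2 by field_simp]; norm_cast
  -- On frequencies at most `N`, undoing the `n` steps costs at most `(1 + 1/n)^n ≤ e`, hence `e²`
  -- after squaring.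
  have h8 : ∑ i ∈ (B.finite_le N).toFinset, B.coord g i ^ 2 ≤ Real.exp 2 * ‖u n‖ ^ 2 := by
    rw [← (B.hasSum_coord_sq (u n)).tsum_eq, ← tsum_mul_left]
    refine le_trans (Finset.sum_le_sum fun i hi => ?_)
      (((B.hasSum_coord_sq (u n)).summable.mul_left _).sum_le_tsum _
        fun i _ => mul_nonneg (Real.exp_pos _).le (sq_nonneg _))
    rw [Set.Finite.mem_toFinset] at hi
    have hi : B.ev i ≤ N := hi
    rw [B.coord_res_iterate hτ g i n, mul_pow]
    refine mul_le_mul_of_nonneg_right ?_ (sq_nonneg _)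
    have h9 : (1 + τ * B.ev i) ^ n ≤ Real.exp 1 := by
      have h10 : 1 + τ * B.ev i ≤ Real.exp (1 / n) := by
        refine le_trans ?_ (Real.add_one_le_exp _)
        have : τ * B.ev i ≤ 1 / n := by
          rw [hτd, div_mul_eq_mul_div, one_mul, div_le_div_iff₀ (by positivity) hnr]
          nlinarith
        linarith
      have h11 := pow_le_pow_left₀ (by linarith [B.one_le_one_add_mul_ev hτ i]) h10 n
      rw [← Real.exp_nat_mul] at h11
      rwa [mul_one_div, div_self hnr.ne'] at h11
    have h12 := B.one_le_one_add_mul_ev hτ i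
    calc ((1 + τ * B.ev i) ^ n) ^ 2 ≤ (Real.exp 1) ^ 2 := pow_le_pow_left₀ (by positivity) h9 2
      _ = Real.exp 2 := by rw [← Real.exp_nat_mul]; norm_num
  refine h8.trans ?_
  rw [hθ]
  calc Real.exp 2 * ‖u n‖ ^ 2
      ≤ Real.exp 2 * ((2 / C₀ * δ / 4) ^ (-1 / δ) * (N ^ (1 / δ) * M ^ 2)) := by
        rw [← h7]; exact mul_le_mul_of_nonneg_left hfin (Real.exp_pos _).le
    _ = _ := by ring

end EigenBasis
end DirichletForm

/-! ### Embeddings of `V_γ` into `L^∞` and `L^{2ρ}`. -/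

theorem lintegral_rpow_Ioo {s b : ℝ} (hs : -1 < s) (hb : 0 ≤ b) :
    ∫⁻ x in Ioo 0 b, ENNReal.ofReal (x ^ s) = ENNReal.ofReal (b ^ (s + 1) / (s + 1)) := by
  have h1 : ∫ x in (0 : ℝ)..b, x ^ s = b ^ (s + 1) / (s + 1) := by
    rw [integral_rpow (Or.inl hs), Real.zero_rpow (by linarith), sub_zero]
  rw [intervalIntegral.integral_of_le hb] at h1
  have h2 : IntegrableOn (fun x : ℝ => x ^ s) (Ioc 0 b) :=
    (intervalIntegrable_iff_integrableOn_Ioc_of_le hb).1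
      (intervalIntegral.intervalIntegrable_rpow' hs)
  rw [← h1, ofReal_integral_eq_lintegral_ofReal h2, restrict_Ioo_eq_restrict_Ioc]
  exact (ae_restrict_iff' measurableSet_Ioc).2
    (Eventually.of_forall fun x hx => Real.rpow_nonneg hx.1.le _)

namespace DirichletForm

variable {X : Type u} [MeasurableSpace X] {m : Measure X} {E : DirichletForm m} {ι : Type*}

theorem meas_le_abs_le (d : Lp ℝ 2 m) {ε : ℝ} (hε : 0 < ε) :
    m {x | ε ≤ |d x|} ≤ ENNReal.ofReal (‖d‖ ^ 2 / ε ^ 2) := by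
  have h1 := meas_ge_le_lintegral_div (μ := m) (f := fun x => ‖d x‖ₑ ^ (2 : ℝ))
    ((Lp.aestronglyMeasurable d).enorm.pow_const 2) (ε := ENNReal.ofReal (ε ^ 2))
    (by simp; positivity) ENNReal.ofReal_ne_top
  rw [lintegral_enorm_sq, ← ENNReal.ofReal_div_of_pos (by positivity)] at h1
  refine le_trans (measure_mono fun x hx => ?_) h1
  have hx : ε ≤ |d x| := hx
  change ENNReal.ofReal (ε ^ 2) ≤ ‖d x‖ₑ ^ (2 : ℝ)
  rw [← ofReal_norm, ENNReal.ofReal_rpow_of_nonneg (norm_nonneg _) (by norm_num)]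
  refine ENNReal.ofReal_le_ofReal ?_
  rw [Real.rpow_two]
  exact pow_le_pow_left₀ hε.le hx 2

/-- Duality of `L¹` and `L^∞`; testing `h` and `-h` against indicator functions is enough. -/
theorem ae_abs_le_of_inner_le [IsFiniteMeasure m] {h : Lp ℝ 2 m} {K : ℝ}
    (hK : ∀ g : Lp ℝ 2 m, inner ℝ g h ≤ K * ∫ x, |g x| ∂m) : ∀ᵐ x ∂m, |h x| ≤ K := by
  have key : ∀ h : Lp ℝ 2 m, (∀ g : Lp ℝ 2 m, inner ℝ g h ≤ K * ∫ x, |g x| ∂m) →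
      ∀ᵐ x ∂m, h x ≤ K := by
    intro h hK
    refine ae_le_of_forall_setIntegral_le (EigenBasis.integrable_of_Lp_two h)
      (integrable_const K) fun s hs hfin => ?_
    have h1 := hK (indicatorConstLp 2 hs hfin.ne (1 : ℝ))
    rw [L2.inner_indicatorConstLp_one] at h1
    refine h1.trans (le_of_eq ?_)
    rw [setIntegral_const, smul_eq_mul, mul_comm]
    congr 1
    have h2 : ∫ x, |indicatorConstLp 2 hs hfin.ne (1 : ℝ) x| ∂m
        = ∫ x, s.indicator (fun _ => (1 : ℝ)) x ∂m := by
      refine integral_congr_ae ?_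
      filter_upwards [indicatorConstLp_coeFn (p := 2) (hs := hs) (hμs := hfin.ne) (c := (1 : ℝ))]
        with x hx
      rw [hx, abs_of_nonneg (indicator_nonneg (fun _ _ => zero_le_one) _)]
    rw [h2, integral_indicator hs]
    simp
  have h1 := key h hK
  have h2 := key (-h) fun g => by
    have h3 := hK (-g)
    rw [inner_neg_left] at h3
    rw [inner_neg_right]
    refine h3.trans (le_of_eq ?_)
    congr 1
    refine integral_congr_ae ?_
    filter_upwards [Lp.coeFn_neg g] with x hx
    rw [hx, Pi.neg_apply, abs_neg]
  filter_upwards [h1, h2, Lp.coeFn_neg h] with x hx1 hx2 hx3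
  rw [hx3, Pi.neg_apply] at hx2
  exact abs_le.2 ⟨by linarith, hx1⟩

namespace EigenBasis

variable (B : E.EigenBasis ι)

theorem abs_ev_rpow_neg_le {γ : ℝ} (hγ : 0 ≤ γ) (i : ι) : |B.ev i ^ (-γ)| ≤ B.low ^ (-γ) := by
  rw [abs_of_pos (Real.rpow_pos_of_pos (B.ev_pos i) _)]
  exact Real.rpow_le_rpow_of_nonpos B.low_pos (B.low_le i) (by linarith)

/-- The negative power `A ^ (-γ)`. -/
def negPow (γ : ℝ) : Lp ℝ 2 m →L[ℝ] Lp ℝ 2 m := B.basis.diag fun i => B.ev i ^ (-γ)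

theorem coord_negPow {γ : ℝ} (hγ : 0 ≤ γ) (z : Lp ℝ 2 m) (i : ι) :
    B.coord (B.negPow γ z) i = B.ev i ^ (-γ) * B.coord z i :=
  HilbertBasis.repr_diag (B.abs_ev_rpow_neg_le hγ) z i

theorem norm_negPow_le {γ : ℝ} (hγ : 0 ≤ γ) (z : Lp ℝ 2 m) :
    ‖B.negPow γ z‖ ≤ B.low ^ (-γ) * ‖z‖ :=
  HilbertBasis.norm_diag_apply_le (Real.rpow_nonneg B.low_pos.le _) (B.abs_ev_rpow_neg_le hγ) z

theorem inner_negPow_comm {γ : ℝ} (hγ : 0 ≤ γ) (g h : Lp ℝ 2 m) :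
    inner ℝ (B.negPow γ g) h = inner ℝ g (B.negPow γ h) := by
  refine ((B.hasSum_coord_mul _ h).congr_fun fun i => ?_).unique (B.hasSum_coord_mul g _)
  rw [B.coord_negPow hγ, B.coord_negPow hγ]
  ring

theorem norm_sq_le_of_sum_le {h : Lp ℝ 2 m} {K : ℝ}
    (H : ∀ S : Finset ι, ∑ i ∈ S, B.coord h i ^ 2 ≤ K) : ‖h‖ ^ 2 ≤ K :=
  hasSum_le_of_sum_le (B.hasSum_coord_sq h) H

/-- Dyadic decomposition: on the block attached to `N k`, the weight is at most `(N k / 2)^{-2γ}`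
and ultracontractivity contributes `(N k)^{2θ}`. The scales are left free because they increase when
`γ > θ` and decrease when `γ < θ`. -/
theorem exists_weighted_bound [IsFiniteMeasure m] {q γ : ℝ} (hq : 1 < q)
    (hs : E.SobolevEmbedding q) : ∃ C : ℝ, 0 < C ∧ ∀ (N : ℕ → ℝ), (∀ k, 0 < N k) →
      Summable (fun k => N k ^ (2 * (thetaA q - γ))) → 0 ≤ γ →
      ∀ S : Finset ι, (∀ i ∈ S, ∃ k, B.ev i ≤ N k ∧ N k ≤ 2 * B.ev i) → ∀ g : Lp ℝ 2 m,
      ∑ i ∈ S, (B.ev i ^ (-γ) * B.coord g i) ^ 2 ≤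
        C * (∑' k, N k ^ (2 * (thetaA q - γ))) * (∫ x, |g x| ∂m) ^ 2 := by
  classical
  obtain ⟨C, hC, hb⟩ := B.sum_coord_sq_le hq hs
  refine ⟨2 ^ (2 * γ) * C, by positivity, fun N hN hsum hγ S hS g => ?_⟩
  choose! k hk1 hk2 using hS
  set M := ∫ x, |g x| ∂m
  have hfib := Finset.sum_fiberwise_of_maps_to (s := S) (t := S.image k) (g := k)
    (fun i hi => Finset.mem_image_of_mem k hi) (fun i => (B.ev i ^ (-γ) * B.coord g i) ^ 2)
  rw [← hfib]
  have hle : ∀ κ ∈ S.image k, ∑ i ∈ S with k i = κ, (B.ev i ^ (-γ) * B.coord g i) ^ 2 ≤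
      2 ^ (2 * γ) * C * M ^ 2 * N κ ^ (2 * (thetaA q - γ)) := by
    intro κ _
    calc ∑ i ∈ S with k i = κ, (B.ev i ^ (-γ) * B.coord g i) ^ 2
        ≤ ∑ i ∈ S with k i = κ, (N κ / 2) ^ (-(2 * γ)) * B.coord g i ^ 2 := by
          refine Finset.sum_le_sum fun i hi => ?_
          rw [Finset.mem_filter] at hi
          have h1 := hk2 i hi.1
          rw [hi.2] at h1
          rw [mul_pow]
          refine mul_le_mul_of_nonneg_right ?_ (sq_nonneg _)
          rw [← Real.rpow_natCast (B.ev i ^ (-γ)), ← Real.rpow_mul (B.ev_pos i).le]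
          rw [show -γ * ((2 : ℕ) : ℝ) = -(2 * γ) by push_cast; ring]
          exact Real.rpow_le_rpow_of_nonpos (by have := hN κ; positivity) (by linarith)
            (by linarith)
      _ = (N κ / 2) ^ (-(2 * γ)) * ∑ i ∈ S with k i = κ, B.coord g i ^ 2 := by
          rw [Finset.mul_sum]
      _ ≤ (N κ / 2) ^ (-(2 * γ)) * (C * N κ ^ (2 * thetaA q) * M ^ 2) := by
          refine mul_le_mul_of_nonneg_left ?_ (Real.rpow_nonneg (by have := hN κ; positivity) _)
          refine le_trans (Finset.sum_le_sum_of_subset_of_nonneg ?_ fun i _ _ => sq_nonneg _)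
            (hb (N κ) (hN κ) g)
          intro i hi
          rw [Finset.mem_filter] at hi
          rw [Set.Finite.mem_toFinset]
          have h1 := hk1 i hi.1
          rw [hi.2] at h1
          exact h1
      _ = _ := by
          rw [Real.div_rpow (hN κ).le zero_le_two, Real.rpow_neg zero_le_two, mul_sub,
            sub_eq_add_neg, Real.rpow_add (hN κ)]
          field_simp
  refine (Finset.sum_le_sum hle).trans ?_
  rw [← Finset.mul_sum]
  calc _ ≤ 2 ^ (2 * γ) * C * M ^ 2 * ∑' k, N k ^ (2 * (thetaA q - γ)) :=
        mul_le_mul_of_nonneg_left (hsum.sum_le_tsum _ fun j _ => Real.rpow_nonneg (hN j).le _)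
          (by positivity)
    _ = _ := by ring

/-- The operator is symmetric, so its bound from `L¹` to `L²` is also a bound from `L²` to `L^∞`.
The weight `w` is a frequency cut-off, either constant or the indicator of low frequencies. -/
theorem abs_ae_le_of_norm_negPow [IsFiniteMeasure m] {γ K : ℝ} (hγ : 0 ≤ γ) (w : ι → ℝ)
    (hw0 : ∀ i, 0 ≤ w i) (hw1 : ∀ i, w i ≤ 1) (hK : 0 ≤ K)
    (H : ∀ g : Lp ℝ 2 m, ∀ S : Finset ι, (∀ i ∈ S, w i ≠ 0) →
      ∑ i ∈ S, (B.ev i ^ (-γ) * B.coord g i) ^ 2 ≤ K ^ 2 * (∫ x, |g x| ∂m) ^ 2)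
    (z : Lp ℝ 2 m) :
    ∀ᵐ x ∂m, |B.basis.diag (fun i => w i * B.ev i ^ (-γ)) z x| ≤ K * ‖z‖ := by
  classical
  have hbd : ∀ i, |w i * B.ev i ^ (-γ)| ≤ B.low ^ (-γ) := fun i => by
    rw [abs_mul, abs_of_nonneg (hw0 i)]
    calc w i * |B.ev i ^ (-γ)| ≤ 1 * |B.ev i ^ (-γ)| :=
          mul_le_mul_of_nonneg_right (hw1 i) (abs_nonneg _)
      _ ≤ _ := by rw [one_mul]; exact B.abs_ev_rpow_neg_le hγ i
  refine ae_abs_le_of_inner_le fun g => ?_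
  set D := B.basis.diag (fun i => w i * B.ev i ^ (-γ))
  have hcD : ∀ h i, B.coord (D h) i = w i * B.ev i ^ (-γ) * B.coord h i :=
    fun h i => HilbertBasis.repr_diag hbd h i
  have h1 : inner ℝ g (D z) = inner ℝ (D g) z := by
    refine ((B.hasSum_coord_mul g _).congr_fun fun i => ?_).unique (B.hasSum_coord_mul _ z)
    rw [hcD, hcD]; ring
  have hM : 0 ≤ ∫ x, |g x| ∂m := integral_nonneg fun x => abs_nonneg _
  have h2 : ‖D g‖ ^ 2 ≤ (K * ∫ x, |g x| ∂m) ^ 2 := by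
    refine B.norm_sq_le_of_sum_le fun S => ?_
    rw [mul_pow]
    refine le_trans ?_ (H g (S.filter fun i => w i ≠ 0) fun i hi => (Finset.mem_filter.1 hi).2)
    rw [Finset.sum_filter]
    refine Finset.sum_le_sum fun i _ => ?_
    rw [hcD]
    split_ifs with hi
    · rw [mul_assoc, mul_pow]
      refine mul_le_of_le_one_left (sq_nonneg _) ?_
      exact pow_le_one₀ (hw0 i) (hw1 i)
    · simp only [not_not] at hi
      rw [hi]; simp
  have h3 : ‖D g‖ ≤ K * ∫ x, |g x| ∂m := (abs_le_of_sq_le_sq' h2 (by positivity)).2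
  calc inner ℝ g (D z) = inner ℝ (D g) z := h1
    _ ≤ ‖D g‖ * ‖z‖ := real_inner_le_norm _ _
    _ ≤ (K * ∫ x, |g x| ∂m) * ‖z‖ := mul_le_mul_of_nonneg_right h3 (norm_nonneg _)
    _ = _ := by ring

/-- `V_γ ↪ L^∞` for `γ > θ_A`. -/
theorem ae_abs_negPow_le [IsFiniteMeasure m] {q γ : ℝ} (hq : 1 < q)
    (hs : E.SobolevEmbedding q) (hγ0 : 0 ≤ γ) (hγ : thetaA q < γ) :
    ∃ C : ℝ, 0 ≤ C ∧ ∀ z : Lp ℝ 2 m, ∀ᵐ x ∂m, |B.negPow γ z x| ≤ C * ‖z‖ := by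
  obtain ⟨C, hC, hb⟩ := B.exists_weighted_bound (γ := γ) hq hs
  have hl := B.low_pos
  -- Scales rising from the bottom of the spectrum; the series is geometric of ratio `2^{2(θ - γ)} <
  -- 1`.
  have hN : ∀ k : ℕ, 0 < B.low * 2 ^ (k + 1) := fun k => by positivity
  have hpow : ∀ k : ℕ, (B.low * 2 ^ (k + 1)) ^ (2 * (thetaA q - γ)) =
      (B.low * 2) ^ (2 * (thetaA q - γ)) * ((2 : ℝ) ^ (2 * (thetaA q - γ))) ^ k := by
    intro k
    rw [← Real.rpow_natCast ((2 : ℝ) ^ (2 * (thetaA q - γ))), ← Real.rpow_mul zero_le_two,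
      mul_comm (2 * (thetaA q - γ)) (k : ℝ), Real.rpow_mul zero_le_two, Real.rpow_natCast,
      ← Real.mul_rpow (by positivity) (by positivity)]
    congr 1; ring
  have hsum : Summable fun k : ℕ => (B.low * 2 ^ (k + 1)) ^ (2 * (thetaA q - γ)) := by
    simp only [hpow]
    refine Summable.mul_left _ (summable_geometric_of_lt_one (by positivity) ?_)
    exact Real.rpow_lt_one_of_one_lt_of_neg one_lt_two (by linarith)
  set T := ∑' k : ℕ, (B.low * 2 ^ (k + 1)) ^ (2 * (thetaA q - γ)) with hT
  have hT0 : 0 ≤ T := tsum_nonneg fun k => Real.rpow_nonneg (hN k).le _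
  refine ⟨√(C * T), Real.sqrt_nonneg _, fun z => ?_⟩
  have := B.abs_ae_le_of_norm_negPow (K := √(C * T)) hγ0 (fun _ => 1) (fun _ => zero_le_one)
    (fun _ => le_rfl) (Real.sqrt_nonneg _) (fun g S _ => ?_) z
  · simpa only [one_mul, negPow] using this
  · rw [Real.sq_sqrt (by positivity)]
    refine hb _ hN hsum hγ0 S (fun i _ => ?_) g
    obtain ⟨n, hn1, hn2⟩ := exists_nat_pow_near (x := B.ev i / B.low) (y := 2)
      ((one_le_div hl).2 (B.low_le i)) one_lt_two
    rw [le_div_iff₀ hl] at hn1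
    rw [div_lt_iff₀ hl] at hn2
    exact ⟨n, by linarith, by rw [pow_succ]; linarith⟩

open Classical in
/-- Bound of the low frequency part of an element of `V_γ`, for `γ < θ_A`. -/
theorem ae_abs_lowFreq_le [IsFiniteMeasure m] {q γ : ℝ} (hq : 1 < q)
    (hs : E.SobolevEmbedding q) (hγ0 : 0 ≤ γ) (hγ : γ < thetaA q) :
    ∃ C : ℝ, 0 < C ∧ ∀ N : ℝ, 0 < N → ∀ z : Lp ℝ 2 m, ∀ᵐ x ∂m,
      |B.basis.diag (fun i => (if B.ev i ≤ N then 1 else 0) * B.ev i ^ (-γ)) z x| ≤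
        C * N ^ (thetaA q - γ) * ‖z‖ := by
  obtain ⟨C, hC, hb⟩ := B.exists_weighted_bound (γ := γ) hq hs
  set T := ∑' k : ℕ, ((2 : ℝ) ^ (-(2 * (thetaA q - γ)))) ^ k with hT
  have hgeo : Summable fun k : ℕ => ((2 : ℝ) ^ (-(2 * (thetaA q - γ)))) ^ k :=
    summable_geometric_of_lt_one (by positivity)
      (Real.rpow_lt_one_of_one_lt_of_neg one_lt_two (by linarith))
  have hT0 : 0 < T := hgeo.tsum_pos (fun k => by positivity) 0 (by positivity)
  refine ⟨√(C * T), by positivity, fun N hN z => ?_⟩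
  -- Here the scales descend from the cut-off `N`, and convergence comes from `γ < θ`.
  have hpos : ∀ k : ℕ, 0 < N / 2 ^ k := fun k => by positivity
  have hpow : ∀ k : ℕ, (N / 2 ^ k) ^ (2 * (thetaA q - γ)) =
      N ^ (2 * (thetaA q - γ)) * ((2 : ℝ) ^ (-(2 * (thetaA q - γ)))) ^ k := by
    intro k
    rw [← Real.rpow_natCast ((2 : ℝ) ^ (-(2 * (thetaA q - γ)))), ← Real.rpow_mul zero_le_two,
      mul_comm (-(2 * (thetaA q - γ))) (k : ℝ), Real.rpow_mul zero_le_two, Real.rpow_natCast,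
      Real.div_rpow hN.le (by positivity), Real.rpow_neg (by positivity), div_eq_mul_inv]
  have hsum : Summable fun k : ℕ => (N / 2 ^ k) ^ (2 * (thetaA q - γ)) := by
    simp only [hpow]
    exact hgeo.mul_left _
  refine B.abs_ae_le_of_norm_negPow hγ0 _ (fun i => by split_ifs <;> simp)
    (fun i => by split_ifs <;> simp) (by positivity) (fun g S hS => ?_) z
  have h1 : (√(C * T) * N ^ (thetaA q - γ)) ^ 2 =
      C * ∑' k : ℕ, (N / 2 ^ k) ^ (2 * (thetaA q - γ)) := by
    simp only [hpow]
    rw [tsum_mul_left, mul_pow, Real.sq_sqrt (by positivity), ← Real.rpow_natCast,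
      ← Real.rpow_mul hN.le, mul_comm (thetaA q - γ) ((2 : ℕ) : ℝ)]
    push_cast
    ring
  rw [h1]
  refine hb _ hpos hsum hγ0 S (fun i hi => ?_) g
  have h2 : B.ev i ≤ N := by
    by_contra h
    exact hS i hi (if_neg h)
  obtain ⟨n, hn1, hn2⟩ := exists_nat_pow_near (x := N / B.ev i) (y := 2)
    ((one_le_div (B.ev_pos i)).2 h2) one_lt_two
  rw [le_div_iff₀ (B.ev_pos i)] at hn1
  rw [div_lt_iff₀ (B.ev_pos i), pow_succ] at hn2
  have h2n : (0 : ℝ) < 2 ^ n := by positivity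
  exact ⟨n, by rw [le_div_iff₀ h2n]; linarith, by rw [div_le_iff₀ h2n]; linarith⟩

/-- The Sobolev embedding `V_γ ↪ L^{2ρ}`, `ρ = θ_A / (θ_A - γ)`, for `γ < θ_A`. -/
theorem eLpNorm_negPow_le_of_lt [IsFiniteMeasure m] {q γ : ℝ} (hq : 1 < q)
    (hs : E.SobolevEmbedding q) (hγ0 : 0 < γ) (hγ : γ < thetaA q) :
    ∃ C : ℝ, 0 ≤ C ∧ ∀ z : Lp ℝ 2 m,
      eLpNorm (B.negPow γ z) (ENNReal.ofReal (2 * (thetaA q / (thetaA q - γ)))) m ≤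
        ENNReal.ofReal (C * ‖z‖) := by
  classical
  obtain ⟨C, hC, hlow⟩ := B.ae_abs_lowFreq_le hq hs hγ0.le hγ
  set ε := thetaA q - γ with hε
  have hε0 : 0 < ε := by linarith
  set p := 2 * (thetaA q / ε) with hp
  have hp2 : p - 2 = 2 * γ / ε := by rw [hp]; field_simp; rw [hε]; ring
  have hp2pos : 0 < p - 2 := by rw [hp2]; positivity
  have hp0 : 0 < p := by linarith
  set K₀ := p * (4 * ((2 * C) ^ (p - 2) / (p - 2))) with hK₀
  refine ⟨K₀ ^ (1 / p), by positivity, fun z => ?_⟩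
  -- Needed to integrate a series over `ι` term by term.
  have : Countable ι := B.countable_index
  rcases (norm_nonneg z).eq_or_lt with hz0 | hz0
  · have hz : z = 0 := norm_eq_zero.1 hz0.symm
    rw [hz, map_zero, eLpNorm_congr_ae (Lp.coeFn_zero ℝ 2 m)]
    simp
  set h := B.negPow γ z with hh
  set K := ‖z‖ with hK
  -- The level below which index `i` belongs to the high frequency part: `t < Λ i` says that `ev i`
  -- exceeds the cut-off `N` chosen at level `t`.
  set Λ : ι → ℝ := fun i => 2 * C * K * B.ev i ^ ε with hΛ
  have hΛ0 : ∀ i, 0 < Λ i := fun i => by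
    have := Real.rpow_pos_of_pos (B.ev_pos i) ε
    positivity
  -- At each level `t` the cut-off is chosen so that the low frequency part is at most `t / 2` in
  -- absolute value. Where `|h| > t`, the high frequency part is then at least `t / 2`, and
  -- Chebyshev's inequality applies to it.
  have hdist : ∀ t : ℝ, 0 < t → m {x | t < |h x|} ≤
      ∑' i, ENNReal.ofReal (4 * B.coord h i ^ 2) *
        (Iio (Λ i)).indicator (fun t => ENNReal.ofReal (t ^ (-2 : ℝ))) t := by
    intro t ht
    set N := (t / (2 * C * K)) ^ (1 / ε) with hN
    have hN0 : 0 < N := by positivity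
    have hNε : N ^ ε = t / (2 * C * K) := by
      rw [hN, ← Real.rpow_mul (by positivity), one_div_mul_cancel hε0.ne', Real.rpow_one]
    set l := B.basis.diag (fun i => (if B.ev i ≤ N then 1 else 0) * B.ev i ^ (-γ)) z with hl
    have hcl : ∀ i, B.coord l i = if B.ev i ≤ N then B.coord h i else 0 := by
      intro i
      have h1 : ∀ i, |(if B.ev i ≤ N then 1 else 0) * B.ev i ^ (-γ)| ≤ B.low ^ (-γ) := by
        intro i
        split_ifs
        · rw [one_mul]; exact B.abs_ev_rpow_neg_le hγ0.le i
        · simp only [zero_mul, abs_zero]; exact Real.rpow_nonneg B.low_pos.le _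
      have h2 : B.coord l i = _ := HilbertBasis.repr_diag h1 z i
      rw [h2, hh, B.coord_negPow hγ0.le]
      split_ifs
      · rw [one_mul]; rfl
      · rw [zero_mul, zero_mul]
    have hae : ∀ᵐ x ∂m, t < |h x| → t / 2 ≤ |(h - l) x| := by
      filter_upwards [hlow N hN0 z, Lp.coeFn_sub h l] with x h1 h2 h3
      rw [h2, Pi.sub_apply]
      have h4 : |l x| ≤ t / 2 := by
        refine h1.trans (le_of_eq ?_)
        rw [hNε, ← hK]; field_simp
      have h5 := abs_sub_abs_le_abs_sub (h x) (l x)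
      linarith
    have hsub : m {x | t < |h x|} ≤ m {x | t / 2 ≤ |(h - l) x|} := measure_mono_ae hae
    refine hsub.trans ((meas_le_abs_le (h - l) (half_pos ht)).trans ?_)
    have h6 := (B.hasSum_coord_sq (h - l)).mul_left (4 * t ^ (-2 : ℝ))
    have h7 : ‖h - l‖ ^ 2 / (t / 2) ^ 2 = 4 * t ^ (-2 : ℝ) * ‖h - l‖ ^ 2 := by
      rw [Real.rpow_neg ht.le, Real.rpow_two]; field_simp; norm_num
    rw [h7, ← h6.tsum_eq, ENNReal.ofReal_tsum_of_nonneg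
      (fun i => mul_nonneg (by positivity) (sq_nonneg _)) h6.summable]
    refine ENNReal.tsum_le_tsum fun i => ?_
    rw [B.coord_sub, hcl]
    by_cases hi : B.ev i ≤ N
    · rw [if_pos hi]; simp
    · rw [if_neg hi, sub_zero]
      have h8 : t < Λ i := by
        have h9 : N ^ ε < B.ev i ^ ε := Real.rpow_lt_rpow hN0.le (not_le.1 hi) hε0
        rw [hNε, div_lt_iff₀ (by positivity)] at h9
        rw [hΛ]; simp only; linarith
      rw [indicator_of_mem (by exact h8), ← ENNReal.ofReal_mul (by positivity)]
      exact ENNReal.ofReal_le_ofReal (le_of_eq (by ring))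
  -- Layer cake formula, with the distribution function bounded by the series above and integrated
  -- term by term over `(0, Λ i)`.
  have hmain : ∫⁻ x, ENNReal.ofReal (|h x| ^ p) ∂m ≤ ENNReal.ofReal (K₀ * K ^ p) := by
    rw [lintegral_rpow_eq_lintegral_meas_lt_mul m (Eventually.of_forall fun x => abs_nonneg _)
      (Lp.aestronglyMeasurable h).aemeasurable.abs hp0]
    have h1 : ∫⁻ t in Ioi (0 : ℝ), m {x | t < |h x|} * ENNReal.ofReal (t ^ (p - 1)) ≤
        ∫⁻ t in Ioi (0 : ℝ), ∑' i, ENNReal.ofReal (4 * B.coord h i ^ 2) *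
          (Iio (Λ i)).indicator (fun t => ENNReal.ofReal (t ^ (p - 3))) t := by
      refine setLIntegral_mono' measurableSet_Ioi fun t ht => ?_
      have ht : 0 < t := ht
      refine (mul_le_mul_left (hdist t ht) _).trans (le_of_eq ?_)
      rw [← ENNReal.tsum_mul_right]
      refine tsum_congr fun i => ?_
      rw [mul_assoc]
      congr 1
      by_cases hi : t ∈ Iio (Λ i)
      · rw [indicator_of_mem hi, indicator_of_mem hi, ← ENNReal.ofReal_mul (by positivity),
          ← Real.rpow_add ht]
        congr 2; ring
      · rw [indicator_of_notMem hi, indicator_of_notMem hi, zero_mul]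
    have hmeas : ∀ i, Measurable ((Iio (Λ i)).indicator
        (fun t => ENNReal.ofReal (t ^ (p - 3)))) := fun i =>
      (ENNReal.measurable_ofReal.comp (measurable_id.pow_const _)).indicator measurableSet_Iio
    have h2 : ∀ i, ∫⁻ t in Ioi (0 : ℝ), ENNReal.ofReal (4 * B.coord h i ^ 2) *
          (Iio (Λ i)).indicator (fun t => ENNReal.ofReal (t ^ (p - 3))) t =
        ENNReal.ofReal ((4 * ((2 * C) ^ (p - 2) / (p - 2)) * K ^ (p - 2)) * B.coord z i ^ 2) := by
      intro i
      rw [lintegral_const_mul _ (hmeas i), lintegral_indicator measurableSet_Iio,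
        Measure.restrict_restrict measurableSet_Iio, inter_comm, Ioi_inter_Iio,
        lintegral_rpow_Ioo (by linarith) (hΛ0 i).le, ← ENNReal.ofReal_mul (by positivity)]
      congr 1
      have h3 : B.coord h i = B.ev i ^ (-γ) * B.coord z i := B.coord_negPow hγ0.le z i
      have h4 := B.ev_pos i
      -- Since `(p - 2) ε = 2γ`, the level contributes `ev^{2γ}`, which cancels the weight
      -- `ev^{-2γ}` and leaves the coordinates of `z`.
      have h5 : Λ i ^ (p - 3 + 1) = (2 * C) ^ (p - 2) * K ^ (p - 2) * (B.ev i ^ γ) ^ 2 := by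
        rw [show p - 3 + 1 = p - 2 by ring, hΛ]
        simp only
        rw [Real.mul_rpow (by positivity) (by positivity),
          Real.mul_rpow (by positivity) (by positivity), ← Real.rpow_mul h4.le,
          ← Real.rpow_natCast (B.ev i ^ γ), ← Real.rpow_mul h4.le, hp2]
        congr 2
        field_simp
        push_cast
        ring
      rw [h5, h3, Real.rpow_neg h4.le, show p - 3 + 1 = p - 2 by ring]
      have h6 : 0 < B.ev i ^ γ := Real.rpow_pos_of_pos h4 _
      field_simp
    calc ENNReal.ofReal p * ∫⁻ t in Ioi (0 : ℝ), m {x | t < |h x|} * ENNReal.ofReal (t ^ (p - 1))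
        ≤ ENNReal.ofReal p * ∑' i, ENNReal.ofReal
            ((4 * ((2 * C) ^ (p - 2) / (p - 2)) * K ^ (p - 2)) * B.coord z i ^ 2) := by
          refine mul_le_mul_right (h1.trans (le_of_eq ?_)) _
          rw [lintegral_tsum fun i => ((hmeas i).const_mul _).aemeasurable]
          exact tsum_congr h2
      _ = ENNReal.ofReal (K₀ * K ^ p) := by
          have h3 := (B.hasSum_coord_sq z).mul_left
            (4 * ((2 * C) ^ (p - 2) / (p - 2)) * K ^ (p - 2))
          rw [← ENNReal.ofReal_tsum_of_nonneg (fun i => by positivity) h3.summable, h3.tsum_eq,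
            ← ENNReal.ofReal_mul hp0.le]
          congr 1
          have h4 : K ^ p = K ^ (p - 2) * K ^ 2 := by
            rw [← Real.rpow_natCast K 2, ← Real.rpow_add hz0]
            congr 1; push_cast; ring
          rw [h4, hK₀]
          ring
  rw [eLpNorm_eq_lintegral_rpow_enorm_toReal (by simp; exact hp0) ENNReal.ofReal_ne_top,
    ENNReal.toReal_ofReal hp0.le]
  have h1 : ∫⁻ x, ‖h x‖ₑ ^ p ∂m = ∫⁻ x, ENNReal.ofReal (|h x| ^ p) ∂m := by
    refine lintegral_congr fun x => ?_
    rw [← ofReal_norm, ENNReal.ofReal_rpow_of_nonneg (norm_nonneg _) hp0.le, Real.norm_eq_abs]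
  rw [h1]
  refine (ENNReal.rpow_le_rpow hmain (by positivity)).trans (le_of_eq ?_)
  rw [ENNReal.ofReal_rpow_of_nonneg (by positivity) (by positivity),
    Real.mul_rpow (by positivity) (by positivity), ← Real.rpow_mul (norm_nonneg _),
    mul_one_div_cancel hp0.ne', Real.rpow_one]

end EigenBasis
end DirichletForm

/-! ### Local Lipschitz continuity of the nonlinearity. -/

theorem abs_sub_le_of_abs_deriv_le {f : ℝ → ℝ} (hf : ContDiff ℝ 1 f) {K M a b : ℝ}
    (hK : ∀ s, |s| ≤ M → |deriv f s| ≤ K) (ha : |a| ≤ M) (hb : |b| ≤ M) :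
    |f a - f b| ≤ K * |a - b| := by
  have hd : Differentiable ℝ f := hf.differentiable (by norm_num)
  have := Convex.norm_image_sub_le_of_norm_deriv_le (f := f) (s := Icc (-M) M) (C := K)
    (fun x _ => hd x) (fun x hx => hK x (abs_le.2 hx)) (convex_Icc _ _)
    (abs_le.1 hb) (abs_le.1 ha)
  simpa [Real.norm_eq_abs] using this

namespace DirichletForm

variable {X : Type u} [MeasurableSpace X] {m : Measure X} {E : DirichletForm m} {ι : Type*}

/-- A superposition operator, composed with `T`, is locally Lipschitz on `L²` if it satisfies the
corresponding estimate of functions. -/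
theorem exists_superposition (T : Lp ℝ 2 m →L[ℝ] Lp ℝ 2 m) {f : ℝ → ℝ} (hf : Continuous f)
    (hf0 : f 0 = 0)
    (H : ∀ R : ℝ, ∃ L : ℝ, 0 ≤ L ∧ ∀ z w : Lp ℝ 2 m, ‖z‖ ≤ R → ‖w‖ ≤ R →
      eLpNorm (fun x => f (T z x) - f (T w x)) 2 m ≤ ENNReal.ofReal (L * ‖z - w‖)) :
    ∃ N : Lp ℝ 2 m → Lp ℝ 2 m, (∀ z, (N z : X → ℝ) =ᵐ[m] fun x => f (T z x)) ∧
      ∀ R : ℝ, ∃ L : ℝ, 0 ≤ L ∧ ∀ z w : Lp ℝ 2 m, ‖z‖ ≤ R → ‖w‖ ≤ R →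
        ‖N z - N w‖ ≤ L * ‖z - w‖ := by
  have hmem : ∀ z : Lp ℝ 2 m, MemLp (fun x => f (T z x)) 2 m := by
    intro z
    refine ⟨hf.comp_aestronglyMeasurable (Lp.aestronglyMeasurable (T z)), ?_⟩
    obtain ⟨L, -, hL⟩ := H ‖z‖
    have h1 := hL z 0 le_rfl (by simp)
    refine lt_of_eq_of_lt (eLpNorm_congr_ae ?_) (h1.trans_lt ENNReal.ofReal_lt_top)
    rw [map_zero]
    filter_upwards [Lp.coeFn_zero ℝ 2 m] with x hx
    rw [hx, Pi.zero_apply, hf0, sub_zero]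
  refine ⟨fun z => (hmem z).toLp _, fun z => (hmem z).coeFn_toLp, fun R => ?_⟩
  obtain ⟨L, hL0, hL⟩ := H R
  refine ⟨L, hL0, fun z w hz hw => ?_⟩
  rw [← MemLp.toLp_sub, Lp.norm_toLp]
  refine ENNReal.toReal_le_of_le_ofReal (by positivity) ?_
  exact hL z w hz hw

namespace EigenBasis

variable (B : E.EigenBasis ι)

theorem negPow_negPow {a b : ℝ} (ha : 0 ≤ a) (hb : 0 ≤ b) (z : Lp ℝ 2 m) :
    B.negPow a (B.negPow b z) = B.negPow (a + b) z := by
  refine B.coord_ext fun i => ?_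
  rw [B.coord_negPow ha, B.coord_negPow hb, B.coord_negPow (add_nonneg ha hb), ← mul_assoc,
    ← Real.rpow_add (B.ev_pos i)]
  congr 2; ring

/-- Reduces to the power `θ - θ / r`, whose Sobolev exponent is exactly `2r` and which does not
exceed `γ`; the remaining power of `A` is bounded on `L²`. So `γ ≥ θ` is allowed. -/
theorem eLpNorm_negPow_le [IsFiniteMeasure m] {q γ r : ℝ} (hq : 1 < q)
    (hs : E.SobolevEmbedding q) (hr : 1 < r) (hγ : r * (thetaA q - γ) ≤ thetaA q) :
    ∃ C : ℝ, 0 ≤ C ∧ ∀ z : Lp ℝ 2 m,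
      eLpNorm (B.negPow γ z) (ENNReal.ofReal (2 * r)) m ≤ ENNReal.ofReal (C * ‖z‖) := by
  have hθ : 0 < thetaA q := by
    unfold thetaA
    exact div_pos (by linarith) (by linarith)
  set θ := thetaA q with hθd
  have hr0 : 0 < r := by linarith
  have hθr : 0 < θ / r := by positivity
  have hθr' : θ / r < θ := div_lt_self hθ hr
  have hle : θ - θ / r ≤ γ := by
    have : θ - γ ≤ θ / r := by rw [le_div_iff₀ hr0]; linarith
    linarith
  obtain ⟨C, hC, h⟩ := B.eLpNorm_negPow_le_of_lt (γ := θ - θ / r) hq hs (by linarith)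
    (by rw [← hθd]; linarith)
  rw [← hθd, sub_sub_cancel, div_div_cancel₀ hθ.ne'] at h
  refine ⟨C * B.low ^ (-(γ - (θ - θ / r))), mul_nonneg hC (Real.rpow_nonneg B.low_pos.le _),
    fun z => ?_⟩
  have h1 := h (B.negPow (γ - (θ - θ / r)) z)
  rw [B.negPow_negPow (by linarith) (by linarith), add_sub_cancel] at h1
  refine h1.trans (ENNReal.ofReal_le_ofReal ?_)
  rw [mul_assoc]
  exact mul_le_mul_of_nonneg_left (B.norm_negPow_le (by linarith) z) hC

/-- The nonlinearity is locally Lipschitz from `V_γ` to `L²` if `γ > θ_A`. -/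
theorem exists_nonlinearity_of_lt [IsFiniteMeasure m] {q γ : ℝ} (hq : 1 < q)
    (hs : E.SobolevEmbedding q) (hγ0 : 0 ≤ γ) (hγ : thetaA q < γ) {f : ℝ → ℝ}
    (hf : ContDiff ℝ 1 f) (hf0 : f 0 = 0) :
    ∃ N : Lp ℝ 2 m → Lp ℝ 2 m, (∀ z, (N z : X → ℝ) =ᵐ[m] fun x => f (B.negPow γ z x)) ∧
      ∀ R : ℝ, ∃ L : ℝ, 0 ≤ L ∧ ∀ z w : Lp ℝ 2 m, ‖z‖ ≤ R → ‖w‖ ≤ R →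
        ‖N z - N w‖ ≤ L * ‖z - w‖ := by
  refine exists_superposition _ hf.continuous hf0 fun R => ?_
  obtain ⟨C, hC, hb⟩ := B.ae_abs_negPow_le hq hs hγ0 hγ
  -- The `L^∞` bound confines the arguments of `f` to a compact interval, where `f'` is bounded; no
  -- growth condition enters.
  obtain ⟨K, hK⟩ := (isCompact_Icc (a := -(C * R)) (b := C * R)).exists_bound_of_continuousOn
    (hf.continuous_deriv le_rfl).continuousOn
  refine ⟨|K| * B.low ^ (-γ), mul_nonneg (abs_nonneg _) (Real.rpow_nonneg B.low_pos.le _),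
    fun z w hz hw => ?_⟩
  have h1 : eLpNorm (fun x => f (B.negPow γ z x) - f (B.negPow γ w x)) 2 m ≤
      ENNReal.ofReal |K| * eLpNorm (B.negPow γ (z - w)) 2 m := by
    refine eLpNorm_le_mul_eLpNorm_of_ae_le_mul ?_ 2
    rw [map_sub]
    filter_upwards [hb z, hb w, Lp.coeFn_sub (B.negPow γ z) (B.negPow γ w)] with x h1 h2 h3
    rw [h3, Pi.sub_apply]
    refine abs_sub_le_of_abs_deriv_le hf (M := C * R)
      (fun s hs => (hK s (abs_le.1 hs)).trans (le_abs_self K)) ?_ ?_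
    · exact h1.trans (mul_le_mul_of_nonneg_left hz hC)
    · exact h2.trans (mul_le_mul_of_nonneg_left hw hC)
  refine h1.trans ?_
  have h2 : eLpNorm (B.negPow γ (z - w)) 2 m = ENNReal.ofReal ‖B.negPow γ (z - w)‖ := by
    rw [ofReal_norm, Lp.enorm_def]
  rw [h2, ← ENNReal.ofReal_mul (abs_nonneg _), mul_assoc]
  exact ENNReal.ofReal_le_ofReal
    (mul_le_mul_of_nonneg_left (B.norm_negPow_le hγ0 _) (abs_nonneg _))

/-- The nonlinearity is locally Lipschitz from `V_γ` to `L²` under a growth condition. -/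
theorem exists_nonlinearity_of_growth [IsFiniteMeasure m] {q γ r : ℝ} (hq : 1 < q)
    (hs : E.SobolevEmbedding q) (hr : 1 < r) (hγ : r * (thetaA q - γ) ≤ thetaA q)
    {f : ℝ → ℝ} (hf : ContDiff ℝ 1 f) (hgr : Hf1 f r) :
    ∃ N : Lp ℝ 2 m → Lp ℝ 2 m, (∀ z, (N z : X → ℝ) =ᵐ[m] fun x => f (B.negPow γ z x)) ∧
      ∀ R : ℝ, ∃ L : ℝ, 0 ≤ L ∧ ∀ z w : Lp ℝ 2 m, ‖z‖ ≤ R → ‖w‖ ≤ R →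
        ‖N z - N w‖ ≤ L * ‖z - w‖ := by
  obtain ⟨hf0, C₁, hC₁, hd⟩ := hgr
  refine exists_superposition _ hf.continuous hf0 fun R => ?_
  obtain ⟨C, hC, hb⟩ := B.eLpNorm_negPow_le hq hs hr hγ
  have hr0 : 0 < r := by linarith
  -- The absolute value only keeps the constant non-negative when `R < 0`, where the ball is empty.
  refine ⟨C₁ * (2 * (C * |R|)) ^ (r - 1) * C, by positivity, fun z w hz hw => ?_⟩
  have hR : |R| = R := abs_of_nonneg ((norm_nonneg z).trans hz)
  rw [hR]
  have hR0 : 0 ≤ R := (norm_nonneg z).trans hz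
  set a := B.negPow γ z
  set b := B.negPow γ w
  set d := B.negPow γ (z - w) with hdd
  set S : X → ℝ := fun x => |a x| + |b x| with hS
  have hSm : AEStronglyMeasurable S m :=
    (Lp.aestronglyMeasurable a).norm.add (Lp.aestronglyMeasurable b).norm
  have hdm : AEStronglyMeasurable d m := Lp.aestronglyMeasurable d
  have h2r : (1 : ℝ≥0∞) ≤ ENNReal.ofReal (2 * r) := by
    rw [← ENNReal.ofReal_one]; exact ENNReal.ofReal_le_ofReal (by linarith)
  have hne0 : ENNReal.ofReal (2 * r) ≠ 0 := by simp; linarith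
  have htr : (ENNReal.ofReal (2 * r)).toReal = 2 * r := ENNReal.toReal_ofReal (by linarith)
  have hlint : ∀ (g : X → ℝ) (K : ℝ), 0 ≤ K →
      eLpNorm g (ENNReal.ofReal (2 * r)) m ≤ ENNReal.ofReal K →
      ∫⁻ x, ‖g x‖ₑ ^ (2 * r) ∂m ≤ ENNReal.ofReal (K ^ (2 * r)) := by
    intro g K hK hg
    rw [eLpNorm_eq_lintegral_rpow_enorm_toReal hne0 ENNReal.ofReal_ne_top, htr] at hg
    have h1 := ENNReal.rpow_le_rpow hg (show 0 ≤ 2 * r by linarith)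
    rwa [← ENNReal.rpow_mul, one_div_mul_cancel (by linarith), ENNReal.rpow_one,
      ENNReal.ofReal_rpow_of_nonneg hK (by linarith)] at h1
  have hSn : eLpNorm S (ENNReal.ofReal (2 * r)) m ≤ ENNReal.ofReal (2 * (C * R)) := by
    refine (eLpNorm_add_le (Lp.aestronglyMeasurable a).norm (Lp.aestronglyMeasurable b).norm
      h2r).trans ?_
    rw [eLpNorm_norm, eLpNorm_norm, two_mul (C * R), ENNReal.ofReal_add (by positivity) (by positivity)]
    exact add_le_add
      ((hb z).trans (ENNReal.ofReal_le_ofReal (mul_le_mul_of_nonneg_left hz hC)))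
      ((hb w).trans (ENNReal.ofReal_le_ofReal (mul_le_mul_of_nonneg_left hw hC)))
  -- Mean value theorem with `|f'| ≤ C₁ S^{r-1}` between the two values. Everything is written in
  -- `2r`-th powers, ready for Hölder with exponents `r / (r - 1)` and `r`.
  have hpt : ∀ᵐ x ∂m, ‖f (a x) - f (b x)‖ₑ ^ (2 : ℝ) ≤ ENNReal.ofReal (C₁ ^ 2) *
      ((‖S x‖ₑ ^ (2 * r)) ^ ((r - 1) / r) * (‖d x‖ₑ ^ (2 * r)) ^ (1 / r)) := by
    rw [hdd, map_sub]
    filter_upwards [Lp.coeFn_sub a b] with x hx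
    rw [hx, Pi.sub_apply]
    have hS0 : 0 ≤ S x := by rw [hS]; positivity
    have h1 : |f (a x) - f (b x)| ≤ C₁ * S x ^ (r - 1) * |a x - b x| := by
      refine abs_sub_le_of_abs_deriv_le hf (M := S x) (fun s hs => (hd s).trans ?_) ?_ ?_
      · exact mul_le_mul_of_nonneg_left
          (Real.rpow_le_rpow (abs_nonneg _) hs (by linarith)) hC₁.le
      · exact le_add_of_nonneg_right (abs_nonneg _)
      · exact le_add_of_nonneg_left (abs_nonneg _)
    rw [← ENNReal.rpow_mul, ← ENNReal.rpow_mul, ← ofReal_norm, ← ofReal_norm, ← ofReal_norm,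
      ENNReal.ofReal_rpow_of_nonneg (norm_nonneg _) (by norm_num),
      ENNReal.ofReal_rpow_of_nonneg (norm_nonneg _) (mul_nonneg (by linarith)
        (div_nonneg (by linarith) hr0.le)),
      ENNReal.ofReal_rpow_of_nonneg (norm_nonneg _) (by positivity),
      ← ENNReal.ofReal_mul (by positivity), ← ENNReal.ofReal_mul (by positivity)]
    refine ENNReal.ofReal_le_ofReal ?_
    rw [Real.norm_eq_abs, Real.norm_eq_abs, Real.norm_eq_abs, abs_of_nonneg hS0]
    refine (Real.rpow_le_rpow (abs_nonneg _) h1 (by norm_num)).trans (le_of_eq ?_)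
    rw [Real.mul_rpow (by positivity) (abs_nonneg _), Real.mul_rpow hC₁.le (by positivity),
      ← Real.rpow_mul hS0, Real.rpow_two C₁, mul_assoc]
    congr 3
    · field_simp
    · field_simp
  have hmain : ∫⁻ x, ‖f (a x) - f (b x)‖ₑ ^ (2 : ℝ) ∂m ≤
      ENNReal.ofReal ((C₁ * (2 * (C * R)) ^ (r - 1) * C * ‖z - w‖) ^ (2 : ℝ)) := by
    refine (lintegral_mono_ae hpt).trans ?_
    rw [lintegral_const_mul' _ _ ENNReal.ofReal_ne_top]
    have h1 := ENNReal.lintegral_mul_norm_pow_le (μ := m) (hSm.enorm.pow_const (2 * r))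
      (hdm.enorm.pow_const (2 * r)) (p := (r - 1) / r) (q := 1 / r)
      (div_nonneg (by linarith) hr0.le) (by positivity) (by field_simp; ring)
    have h2 : (∫⁻ x, ‖S x‖ₑ ^ (2 * r) ∂m) ^ ((r - 1) / r) ≤
        ENNReal.ofReal (((2 * (C * R)) ^ (2 * r)) ^ ((r - 1) / r)) := by
      rw [← ENNReal.ofReal_rpow_of_nonneg (by positivity) (div_nonneg (by linarith) hr0.le)]
      exact ENNReal.rpow_le_rpow (hlint _ _ (by positivity) hSn)
        (div_nonneg (by linarith) hr0.le)
    have h3 : (∫⁻ x, ‖d x‖ₑ ^ (2 * r) ∂m) ^ (1 / r) ≤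
        ENNReal.ofReal (((C * ‖z - w‖) ^ (2 * r)) ^ (1 / r)) := by
      rw [← ENNReal.ofReal_rpow_of_nonneg (by positivity) (by positivity)]
      exact ENNReal.rpow_le_rpow (hlint _ _ (by positivity) (hb (z - w))) (by positivity)
    refine (mul_le_mul_right (h1.trans (mul_le_mul' h2 h3)) _).trans (le_of_eq ?_)
    rw [← ENNReal.ofReal_mul (by positivity), ← ENNReal.ofReal_mul (by positivity)]
    congr 1
    rw [← Real.rpow_mul (by positivity), ← Real.rpow_mul (by positivity),
      show 2 * r * ((r - 1) / r) = (r - 1) * 2 by field_simp,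
      show 2 * r * (1 / r) = 2 by field_simp, Real.rpow_mul (by positivity)]
    simp only [Real.rpow_two]
    ring
  rw [eLpNorm_eq_lintegral_rpow_enorm_toReal two_ne_zero ENNReal.ofNat_ne_top]
  simp only [ENNReal.toReal_ofNat]
  refine (ENNReal.rpow_le_rpow hmain (by positivity)).trans (le_of_eq ?_)
  rw [ENNReal.ofReal_rpow_of_nonneg (by positivity) (by positivity),
    ← Real.rpow_mul (by positivity)]
  norm_num

end EigenBasis
end DirichletForm

/-! ### Convolutions on the half-line and fractional integrals. -/

/-- The convolution `∫₀ᵗ a (t - s) b s ds` on the half-line. -/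
def halfConv (a b : ℝ → ℝ) (t : ℝ) : ℝ := ∫ s in (0 : ℝ)..t, a (t - s) * b s

/-- The kernel `t ^ (b - 1) / Γ(b)` of the fractional integral of order `b`. -/
def fracKernel (b t : ℝ) : ℝ := t ^ (b - 1) / Real.Gamma b

theorem halfConv_comm (a b : ℝ → ℝ) (t : ℝ) : halfConv a b t = halfConv b a t := by
  unfold halfConv
  have := intervalIntegral.integral_comp_sub_left (fun s => a s * b (t - s)) t (a := 0) (b := t)
  simp only [sub_sub_cancel, sub_self, sub_zero] at this
  rw [this]
  exact intervalIntegral.integral_congr fun s _ => mul_comm _ _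

theorem halfConv_zero_right (a b : ℝ → ℝ) : halfConv a b 0 = 0 := by simp [halfConv]

/-- Agreement on the open interval suffices, which matters because the kernel identities below hold
only for positive times. -/
theorem halfConv_congr {a a' b b' : ℝ → ℝ} {t : ℝ} (ht : 0 ≤ t) (ha : ∀ s ∈ Ioo 0 t, a s = a' s)
    (hb : ∀ s ∈ Ioo 0 t, b s = b' s) : halfConv a b t = halfConv a' b' t := by
  unfold halfConv
  rw [intervalIntegral.integral_of_le ht, intervalIntegral.integral_of_le ht,
    ← restrict_Ioo_eq_restrict_Ioc]
  refine setIntegral_congr_fun measurableSet_Ioo fun s hs => ?_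
  have hs' : t - s ∈ Ioo 0 t := ⟨by linarith [hs.2], by linarith [hs.1]⟩
  rw [ha _ hs', hb _ hs]

theorem intervalIntegrable_halfConv {a b : ℝ → ℝ} {t : ℝ} (ht : 0 ≤ t)
    (ha : IntervalIntegrable a volume 0 t) (hb : ContinuousOn b (Icc 0 t)) :
    IntervalIntegrable (fun s => a (t - s) * b s) volume 0 t := by
  have h1 : IntervalIntegrable (fun s => a (t - s)) volume 0 t := by
    have := (ha.comp_sub_left t).symm
    simpa using this
  refine h1.mul_continuousOn ?_
  rwa [uIcc_of_le ht]

theorem halfConv_add_right {a b c : ℝ → ℝ} {t : ℝ} (ht : 0 ≤ t)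
    (ha : IntervalIntegrable a volume 0 t) (hb : ContinuousOn b (Icc 0 t))
    (hc : ContinuousOn c (Icc 0 t)) :
    halfConv a (fun s => b s + c s) t = halfConv a b t + halfConv a c t := by
  unfold halfConv
  rw [← intervalIntegral.integral_add (intervalIntegrable_halfConv ht ha hb)
    (intervalIntegrable_halfConv ht ha hc)]
  exact intervalIntegral.integral_congr fun s _ => mul_add _ _ _

theorem halfConv_const_mul_right (a b : ℝ → ℝ) (c t : ℝ) :
    halfConv a (fun s => c * b s) t = c * halfConv a b t := by
  unfold halfConv
  rw [← intervalIntegral.integral_const_mul]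
  exact intervalIntegral.integral_congr fun s _ => mul_left_comm _ _ _

/-- Fubini, after extending the three functions by zero outside `(0, t]`. -/
theorem halfConv_assoc {a b c : ℝ → ℝ} {t : ℝ} (ht : 0 ≤ t)
    (ha : IntervalIntegrable a volume 0 t) (hb : IntervalIntegrable b volume 0 t)
    (hc : ContinuousOn c (Icc 0 t)) :
    halfConv a (halfConv b c) t = halfConv (halfConv a b) c t := by
  rw [intervalIntegrable_iff_integrableOn_Ioc_of_le ht] at ha hb
  have hA : Integrable ((Ioc 0 t).indicator a) := (integrable_indicator_iff measurableSet_Ioc).2 ha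
  have hB : Integrable ((Ioc 0 t).indicator b) := (integrable_indicator_iff measurableSet_Ioc).2 hb
  set A := (Ioc 0 t).indicator a with hAd
  set Bf := (Ioc 0 t).indicator b with hBd
  set Cf := (Ioc 0 t).indicator c with hCd
  have hCm : AEStronglyMeasurable Cf volume :=
    (aestronglyMeasurable_indicator_iff measurableSet_Ioc).2
      ((hc.mono Ioc_subset_Icc_self).aestronglyMeasurable measurableSet_Ioc)
  obtain ⟨M, hM⟩ := isCompact_Icc.exists_bound_of_continuousOn hc
  have hCb : ∀ r, ‖Cf r‖ ≤ |M| := by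
    intro r
    by_cases hr : r ∈ Ioc 0 t
    · rw [hCd, indicator_of_mem hr]
      exact (hM r (Ioc_subset_Icc_self hr)).trans (le_abs_self M)
    · rw [hCd, indicator_of_notMem hr]; simp
  -- The first two factors form the integrand of a convolution of two `L¹` functions, and the third
  -- is bounded.
  have hint : Integrable (Function.uncurry fun s r => A (t - s) * Bf (s - r) * Cf r)
      (volume.prod volume) := by
    have h1 : Integrable (fun p : ℝ × ℝ => A (t - p.2) * Bf (-(p.1 - p.2)))
        (volume.prod volume) :=
      Integrable.convolution_integrand (ContinuousLinearMap.mul ℝ ℝ)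
        (hA.comp_sub_left t) hB.comp_neg
    have h2 : Integrable (fun p : ℝ × ℝ => A (t - p.1) * Bf (p.1 - p.2))
        (volume.prod volume) := by
      have := h1.swap
      refine this.congr (Eventually.of_forall fun p => ?_)
      simp
    exact h2.mul_bdd hCm.comp_snd (Eventually.of_forall fun p => hCb p.2)
  have hswap := integral_integral_swap hint
  have hL : halfConv a (halfConv b c) t = ∫ s, ∫ r, A (t - s) * Bf (s - r) * Cf r := by
    -- The half-open interval is turned round because `t - s ∈ (0, t]` means `s ∈ [0, t)`.
    rw [halfConv, intervalIntegral.integral_of_le ht, ← restrict_Ico_eq_restrict_Ioc,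
      ← integral_indicator measurableSet_Ico]
    refine integral_congr_ae (Eventually.of_forall fun s => ?_)
    simp only
    by_cases hs : s ∈ Ico 0 t
    · rw [indicator_of_mem hs]
      have h1 : A (t - s) = a (t - s) := indicator_of_mem
        (show t - s ∈ Ioc 0 t from ⟨by linarith [hs.2], by linarith [hs.1]⟩) _
      simp only [mul_assoc]
      rw [integral_const_mul, h1, halfConv, intervalIntegral.integral_of_le hs.1,
        ← restrict_Ioo_eq_restrict_Ioc, ← integral_indicator measurableSet_Ioo]
      congr 1
      refine integral_congr_ae (Eventually.of_forall fun r => ?_)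
      simp only
      by_cases hr : r ∈ Ioo 0 s
      · rw [indicator_of_mem hr, hBd, hCd,
          indicator_of_mem (show s - r ∈ Ioc 0 t from
            ⟨by linarith [hr.2], by linarith [hr.1, hs.2]⟩),
          indicator_of_mem (show r ∈ Ioc 0 t from ⟨hr.1, by linarith [hr.2, hs.2]⟩)]
      · rw [indicator_of_notMem hr]
        by_cases hr0 : 0 < r
        · have : s - r ∉ Ioc 0 t := fun h => hr ⟨hr0, by linarith [h.1]⟩
          rw [hBd, indicator_of_notMem this, zero_mul]
        · have : r ∉ Ioc 0 t := fun h => hr0 h.1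
          rw [hCd, indicator_of_notMem this, mul_zero]
    · rw [indicator_of_notMem hs]
      have : t - s ∉ Ioc 0 t := fun h => hs ⟨by linarith [h.2], by linarith [h.1]⟩
      rw [hAd, indicator_of_notMem this]
      simp
  have hR : halfConv (halfConv a b) c t = ∫ r, ∫ s, A (t - s) * Bf (s - r) * Cf r := by
    rw [halfConv, intervalIntegral.integral_of_le ht, ← integral_indicator measurableSet_Ioc]
    refine integral_congr_ae (Eventually.of_forall fun r => ?_)
    simp only
    by_cases hr : r ∈ Ioc 0 t
    · have h1 : Cf r = c r := indicator_of_mem hr _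
      rw [indicator_of_mem hr, integral_mul_const, h1]
      congr 1
      have h2 : halfConv a b (t - r) = ∫ s in r..t, a (t - s) * b (s - r) := by
        have := intervalIntegral.integral_comp_sub_right (fun s => a (t - r - s) * b s) r
          (a := r) (b := t)
        simp only [sub_self] at this
        rw [halfConv, ← this]
        refine intervalIntegral.integral_congr fun s _ => ?_
        congr 2; ring
      rw [h2, intervalIntegral.integral_of_le hr.2, ← restrict_Ioo_eq_restrict_Ioc,
        ← integral_indicator measurableSet_Ioo]
      refine integral_congr_ae (Eventually.of_forall fun s => ?_)
      simp only
      by_cases hs : s ∈ Ioo r t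
      · rw [indicator_of_mem hs, hAd, hBd,
          indicator_of_mem (show t - s ∈ Ioc 0 t from
            ⟨by linarith [hs.2], by linarith [hs.1, hr.1]⟩),
          indicator_of_mem (show s - r ∈ Ioc 0 t from
            ⟨by linarith [hs.1], by linarith [hs.2, hr.1]⟩)]
      · rw [indicator_of_notMem hs]
        by_cases hs0 : r < s
        · have : t - s ∉ Ioc 0 t := fun h => hs ⟨hs0, by linarith [h.1]⟩
          rw [hAd, indicator_of_notMem this, zero_mul]
        · have : s - r ∉ Ioc 0 t := fun h => hs0 (by linarith [h.1])
          rw [hBd, indicator_of_notMem this, mul_zero]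
    · rw [indicator_of_notMem hr, hCd, indicator_of_notMem hr]
      simp
  rw [hL, hR, hswap]

theorem intervalIntegrable_fracKernel {b : ℝ} (hb : 0 < b) (s t : ℝ) :
    IntervalIntegrable (fracKernel b) volume s t :=
  (intervalIntegral.intervalIntegrable_rpow' (by linarith)).div_const _

/-- Euler's Beta integral; this is the semigroup law of fractional integrals. -/
theorem halfConv_fracKernel {a b t : ℝ} (ha : 0 < a) (hb : 0 < b) (ht : 0 < t) :
    halfConv (fracKernel a) (fracKernel b) t = fracKernel (a + b) t := by
  have hga := Real.Gamma_pos_of_pos ha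
  have hgb := Real.Gamma_pos_of_pos hb
  have h1 := Complex.betaIntegral_scaled (b : ℂ) (a : ℂ) ht
  rw [Complex.betaIntegral_eq_Gamma_mul_div _ _ (by simpa using hb) (by simpa using ha)] at h1
  have h2 : ∫ x in (0 : ℝ)..t, x ^ (b - 1) * (t - x) ^ (a - 1) =
      t ^ (b + a - 1) * (Real.Gamma b * Real.Gamma a / Real.Gamma (b + a)) := by
    have h3 : ((∫ x in (0 : ℝ)..t, x ^ (b - 1) * (t - x) ^ (a - 1) : ℝ) : ℂ) =
        ∫ x in (0 : ℝ)..t, (x : ℂ) ^ ((b : ℂ) - 1) * ((t : ℂ) - x) ^ ((a : ℂ) - 1) := by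
      rw [← intervalIntegral.integral_ofReal]
      refine intervalIntegral.integral_congr fun x hx => ?_
      rw [uIcc_of_le ht.le] at hx
      push_cast [Complex.ofReal_cpow hx.1, Complex.ofReal_cpow (sub_nonneg.2 hx.2)]
      rfl
    rw [h1] at h3
    have h4 : (t : ℂ) ^ ((b : ℂ) + a - 1) = ((t ^ (b + a - 1) : ℝ) : ℂ) := by
      rw [Complex.ofReal_cpow ht.le]; push_cast; rfl
    rw [h4, Complex.Gamma_ofReal, Complex.Gamma_ofReal, ← Complex.ofReal_add,
      Complex.Gamma_ofReal] at h3
    exact_mod_cast h3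
  unfold halfConv fracKernel
  have h3 : ∀ s, (t - s) ^ (a - 1) / Real.Gamma a * (s ^ (b - 1) / Real.Gamma b) =
      (s ^ (b - 1) * (t - s) ^ (a - 1)) * (1 / (Real.Gamma a * Real.Gamma b)) := fun s => by
    field_simp
  simp only [h3]
  rw [intervalIntegral.integral_mul_const, h2, add_comm b a]
  field_simp

theorem fracKernel_one (t : ℝ) : fracKernel 1 t = 1 := by simp [fracKernel]

theorem fracKernel_two (t : ℝ) : fracKernel 2 t = t := by
  unfold fracKernel
  norm_num [Real.Gamma_two]

theorem eq_zero_of_integral_eq_zero {w : ℝ → ℝ} {T : ℝ} (hT : 0 < T)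
    (hw : ContinuousOn w (Icc 0 T)) (h : ∀ t ∈ Icc 0 T, ∫ s in (0 : ℝ)..t, w s = 0) :
    ∀ t ∈ Icc 0 T, w t = 0 := by
  have hint : ∀ t ∈ Ioo 0 T, w t = 0 := by
    intro t ht
    have hsub : uIcc 0 t ⊆ Icc 0 T := by
      rw [uIcc_of_le ht.1.le]; exact Icc_subset_Icc_right ht.2.le
    have h1 := intervalIntegral.integral_hasDerivAt_right (f := w) (a := 0) (b := t)
      ((hw.mono hsub).intervalIntegrable)
      (hw.mono Ioo_subset_Icc_self |>.stronglyMeasurableAtFilter isOpen_Ioo t ht)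
      (hw.continuousAt (Icc_mem_nhds ht.1 ht.2))
    have h2 : (fun u => ∫ x in (0 : ℝ)..u, w x) =ᶠ[𝓝 t] fun _ => 0 := by
      filter_upwards [Icc_mem_nhds ht.1 ht.2] with u hu using h u hu
    exact (h1.congr_of_eventuallyEq h2.symm).unique (hasDerivAt_const t 0)
  have hcl : Icc 0 T ⊆ closure (Ioo 0 T) := by rw [closure_Ioo hT.ne]
  have h3 : EqOn w (fun _ => 0) (Icc 0 T) :=
    Set.EqOn.of_subset_closure (s := Ioo 0 T) hint hw continuousOn_const
      Ioo_subset_Icc_self hcl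
  exact h3

theorem halfConv_one_left (w : ℝ → ℝ) (t : ℝ) :
    halfConv (fracKernel 1) w t = ∫ s in (0 : ℝ)..t, w s := by
  unfold halfConv
  simp only [fracKernel_one, one_mul]

theorem halfConv_two_left {w : ℝ → ℝ} {t : ℝ} (ht : 0 ≤ t) (hw : ContinuousOn w (Icc 0 t)) :
    halfConv (fracKernel 2) w t = ∫ s in (0 : ℝ)..t, ∫ r in (0 : ℝ)..s, w r := by
  have h1 : halfConv (fracKernel 2) w t =
      halfConv (halfConv (fracKernel 1) (fracKernel 1)) w t := by
    refine halfConv_congr ht (fun s hs => ?_) fun s _ => rfl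
    rw [halfConv_fracKernel one_pos one_pos hs.1]; norm_num
  rw [h1, ← halfConv_assoc ht (intervalIntegrable_fracKernel one_pos _ _)
    (intervalIntegrable_fracKernel one_pos _ _) hw, halfConv_one_left]
  exact intervalIntegral.integral_congr fun s _ => halfConv_one_left w s

theorem eq_zero_of_halfConv_two_eq_zero {w : ℝ → ℝ} {T : ℝ} (hT : 0 < T)
    (hw : ContinuousOn w (Icc 0 T)) (h : ∀ t ∈ Icc 0 T, halfConv (fracKernel 2) w t = 0) :
    ∀ t ∈ Icc 0 T, w t = 0 := by
  refine eq_zero_of_integral_eq_zero hT hw ?_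
  have hcont : ContinuousOn (fun t => ∫ s in (0 : ℝ)..t, w s) (Icc 0 T) := by
    have h2 : IntegrableOn w (uIcc 0 T) := by
      rw [uIcc_of_le hT.le]; exact hw.integrableOn_Icc
    have := intervalIntegral.continuousOn_primitive_interval (a := 0) (b := T) h2
    rwa [uIcc_of_le hT.le] at this
  refine eq_zero_of_integral_eq_zero hT hcont fun t ht => ?_
  rw [← halfConv_two_left ht.1 (hw.mono (Icc_subset_Icc_right ht.2))]
  exact h t ht

/-- Inversion of the fractional integral. -/
theorem eq_halfConv_of_caputo {a T : ℝ} (ha0 : 0 < a) (ha2 : a < 2) (hT : 0 < T) {y z : ℝ → ℝ}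
    (hy : ContinuousOn y (Icc 0 T)) (hz : ContinuousOn z (Icc 0 T))
    (hconv : ContinuousOn (halfConv (fracKernel a) z) (Icc 0 T))
    (h : ∀ t ∈ Icc 0 T, halfConv (fracKernel (2 - a)) y t = halfConv (fracKernel 2) z t) :
    ∀ t ∈ Icc 0 T, y t = halfConv (fracKernel a) z t := by
  have ha : 0 < 2 - a := by linarith
  have key := eq_zero_of_halfConv_two_eq_zero hT (hy.sub hconv) fun t ht => ?_
  · intro t ht
    have := key t ht
    simp only [Pi.sub_apply] at this
    linarith
  · have hyt := hy.mono (Icc_subset_Icc_right ht.2)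
    have hzt := hz.mono (Icc_subset_Icc_right ht.2)
    have hct := hconv.mono (Icc_subset_Icc_right ht.2)
    have hK : ∀ {b : ℝ}, 0 < b → IntervalIntegrable (fracKernel b) volume 0 t :=
      fun hb => intervalIntegrable_fracKernel hb _ _
    -- Convolving the hypothesis with the kernel of order `a` completes `2 - a` to `2`. What is left
    -- to invert is a double integration, which is injective on continuous functions.
    have h1 : halfConv (fracKernel 2) y t = halfConv (fracKernel 2) (halfConv (fracKernel a) z) t := by
      calc halfConv (fracKernel 2) y t
          = halfConv (halfConv (fracKernel a) (fracKernel (2 - a))) y t := by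
            refine halfConv_congr ht.1 (fun s hs => ?_) fun s _ => rfl
            rw [halfConv_fracKernel ha0 ha hs.1]; congr 1; ring
        _ = halfConv (fracKernel a) (halfConv (fracKernel (2 - a)) y) t :=
            (halfConv_assoc ht.1 (hK ha0) (hK ha) hyt).symm
        _ = halfConv (fracKernel a) (halfConv (fracKernel 2) z) t :=
            halfConv_congr ht.1 (fun s _ => rfl) fun s hs => h s ⟨hs.1.le, hs.2.le.trans ht.2⟩
        _ = halfConv (halfConv (fracKernel a) (fracKernel 2)) z t :=
            halfConv_assoc ht.1 (hK ha0) (hK two_pos) hzt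
        _ = halfConv (halfConv (fracKernel 2) (fracKernel a)) z t :=
            halfConv_congr ht.1 (fun s _ => halfConv_comm _ _ _) fun s _ => rfl
        _ = _ := (halfConv_assoc ht.1 (hK two_pos) (hK ha0) hzt).symm
    have h2 : halfConv (fracKernel 2) (y - halfConv (fracKernel a) z) t =
        halfConv (fracKernel 2) y t + halfConv (fracKernel 2)
          (fun s => (-1) * halfConv (fracKernel a) z s) t := by
      rw [← halfConv_add_right ht.1 (hK two_pos) hyt
        (c := fun s => (-1) * halfConv (fracKernel a) z s) (continuousOn_const.mul hct)]
      exact halfConv_congr ht.1 (fun _ _ => rfl) fun s _ => by simp only [Pi.sub_apply]; ring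
    rw [h2, halfConv_const_mul_right, h1]; ring

/-- The converse of `eq_halfConv_of_caputo`, from the semigroup law. -/
theorem caputo_of_eq_halfConv {a t : ℝ} (ha0 : 0 < a) (ha2 : a < 2) (ht : 0 ≤ t) {y z : ℝ → ℝ}
    (hz : ContinuousOn z (Icc 0 t)) (h : ∀ s ∈ Icc 0 t, y s = halfConv (fracKernel a) z s) :
    halfConv (fracKernel (2 - a)) y t = halfConv (fracKernel 2) z t := by
  have ha : 0 < 2 - a := by linarith
  calc halfConv (fracKernel (2 - a)) y t
      = halfConv (fracKernel (2 - a)) (halfConv (fracKernel a) z) t :=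
        halfConv_congr ht (fun _ _ => rfl) fun s hs => h s ⟨hs.1.le, hs.2.le⟩
    _ = halfConv (halfConv (fracKernel (2 - a)) (fracKernel a)) z t :=
        halfConv_assoc ht (intervalIntegrable_fracKernel ha _ _)
          (intervalIntegrable_fracKernel ha0 _ _) hz
    _ = _ := by
        refine halfConv_congr ht (fun s hs => ?_) fun _ _ => rfl
        rw [halfConv_fracKernel ha ha0 hs.1]; congr 1; ring

/-! ### Mittag-Leffler kernels and the scalar equation. -/

/-- The Mittag-Leffler function `E_{α,β}`. -/
def mittagLeffler (α β x : ℝ) : ℝ := ∑' n : ℕ, x ^ n / Real.Gamma (α * n + β)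

/-- The function `t ^ (β - 1) E_{α,β}(-μ t ^ α)`. -/
def mlKernel (α β μ t : ℝ) : ℝ := t ^ (β - 1) * mittagLeffler α β (-(μ * t ^ α))

section MittagLeffler

variable {α β : ℝ}

/-- Compares the series with that of the exponential. The shift by two puts both arguments in `[2,
∞)`, where `Γ` is monotone. -/
theorem factorial_le_Gamma (hα : 1 ≤ α) (hβ : 0 < β) (n : ℕ) :
    (n.factorial : ℝ) ≤ Real.Gamma (α * (n + 2 : ℕ) + β) := by
  have h1 : ((n + 1 : ℕ) : ℝ) + 1 ≤ α * (n + 2 : ℕ) + β := by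
    push_cast
    nlinarith
  have h2 : (2 : ℝ) ≤ ((n + 1 : ℕ) : ℝ) + 1 := by push_cast; linarith [Nat.cast_nonneg (α := ℝ) n]
  have h3 := Real.Gamma_strictMonoOn_Ici.monotoneOn (show (2 : ℝ) ≤ _ from h2)
    (show (2 : ℝ) ≤ _ from h2.trans h1) h1
  rw [Real.Gamma_nat_eq_factorial] at h3
  refine le_trans ?_ h3
  exact_mod_cast Nat.factorial_le (Nat.le_succ n)

theorem Gamma_pos_aux (hα : 1 ≤ α) (hβ : 0 < β) (n : ℕ) : 0 < Real.Gamma (α * n + β) :=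
  Real.Gamma_pos_of_pos (by positivity)

theorem summable_pow_div_Gamma (hα : 1 ≤ α) (hβ : 0 < β) (x : ℝ) :
    Summable fun n : ℕ => x ^ n / Real.Gamma (α * n + β) := by
  rw [← summable_nat_add_iff 2]
  refine Summable.of_norm_bounded (g := fun n : ℕ => |x| ^ 2 * (|x| ^ n / n.factorial))
    ((Real.summable_pow_div_factorial |x|).mul_left _) fun n => ?_
  have h1 := factorial_le_Gamma hα hβ n
  have h2 : (0 : ℝ) < n.factorial := by exact_mod_cast n.factorial_pos
  rw [norm_div, norm_pow, Real.norm_eq_abs, Real.norm_of_nonneg (h2.le.trans h1), pow_add,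
    mul_comm (|x| ^ n), mul_div_assoc]
  gcongr

theorem continuous_mittagLeffler (hα : 1 ≤ α) (hβ : 0 < β) : Continuous (mittagLeffler α β) := by
  rw [continuous_iff_continuousAt]
  intro x₀
  have h : ContinuousOn (mittagLeffler α β) (Metric.ball 0 (|x₀| + 1)) := by
    refine continuousOn_tsum (fun n => (by fun_prop)) (summable_pow_div_Gamma hα hβ (|x₀| + 1))
      fun n x hx => ?_
    have hx : |x| ≤ |x₀| + 1 := by
      have := (mem_ball_zero_iff.1 hx).le
      rwa [Real.norm_eq_abs] at this
    have := Gamma_pos_aux hα hβ n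
    rw [norm_div, norm_pow, Real.norm_eq_abs, Real.norm_of_nonneg this.le]
    gcongr
  exact h.continuousAt (Metric.isOpen_ball.mem_nhds (by simp))

/-- Every identity for these kernels is reduced, through this series, to one for power kernels. -/
theorem hasSum_mlKernel (hα : 1 ≤ α) (hβ : 0 < β) (μ : ℝ) {t : ℝ} (ht : 0 < t) :
    HasSum (fun n : ℕ => (-μ) ^ n * fracKernel (α * n + β) t) (mlKernel α β μ t) := by
  have h := ((summable_pow_div_Gamma hα hβ (-(μ * t ^ α))).hasSum).mul_left (t ^ (β - 1))
  refine h.congr_fun fun n => ?_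
  have h1 : t ^ (α * n + β - 1) = t ^ (β - 1) * (t ^ α) ^ n := by
    rw [← Real.rpow_natCast (t ^ α), ← Real.rpow_mul ht.le, ← Real.rpow_add ht]
    congr 1; ring
  rw [fracKernel, h1, ← neg_mul, mul_pow]
  ring

theorem intervalIntegrable_mlKernel (hα : 1 ≤ α) (hβ : 0 < β) (μ s t : ℝ) :
    IntervalIntegrable (mlKernel α β μ) volume s t := by
  refine (intervalIntegral.intervalIntegrable_rpow' (by linarith)).mul_continuousOn ?_
  exact ((continuous_mittagLeffler hα hβ).comp
    (continuous_const.mul (Real.continuous_rpow_const (by linarith))).neg).continuousOn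

theorem continuousOn_mlKernel (hα : 1 ≤ α) (hβ : 0 < β) (μ : ℝ) :
    ContinuousOn (mlKernel α β μ) (Ioi 0) := by
  refine ContinuousOn.mul ?_ ?_
  · exact fun t ht => (Real.continuousAt_rpow_const _ _ (Or.inl (ne_of_gt ht))).continuousWithinAt
  · exact ((continuous_mittagLeffler hα hβ).comp
      (continuous_const.mul (Real.continuous_rpow_const (by linarith))).neg).continuousOn

theorem continuous_mlKernel (hα : 1 ≤ α) (hβ : 1 ≤ β) (μ : ℝ) : Continuous (mlKernel α β μ) :=
  (Real.continuous_rpow_const (by linarith)).mul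
    ((continuous_mittagLeffler hα (by linarith)).comp
      (continuous_const.mul (Real.continuous_rpow_const (by linarith))).neg)

theorem fracKernel_nonneg {b t : ℝ} (hb : 0 < b) (ht : 0 ≤ t) : 0 ≤ fracKernel b t :=
  div_nonneg (Real.rpow_nonneg ht _) (Real.Gamma_pos_of_pos hb).le

/-- The semigroup law applied term by term: convolution with the kernel of order `a` shifts each
exponent by `a`. -/
theorem halfConv_fracKernel_mlKernel (hα : 1 ≤ α) (hβ : 0 < β) (μ : ℝ) {a t : ℝ} (ha : 0 < a)
    (ht : 0 < t) :
    halfConv (fracKernel a) (mlKernel α β μ) t = mlKernel α (β + a) μ t := by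
  have hb : ∀ n : ℕ, 0 < α * n + β := fun n => by positivity
  set F : ℕ → ℝ → ℝ := fun n s => fracKernel a (t - s) * ((-μ) ^ n * fracKernel (α * n + β) s)
  have hconv : ∀ n : ℕ, ∫ s in Ioo 0 t, fracKernel a (t - s) * fracKernel (α * n + β) s =
      fracKernel (α * n + (β + a)) t := by
    intro n
    have h1 := halfConv_fracKernel ha (hb n) ht
    rw [halfConv, intervalIntegral.integral_of_le ht.le, ← restrict_Ioo_eq_restrict_Ioc] at h1
    rw [h1]; congr 1; ring
  have hint : ∀ n : ℕ, IntegrableOn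
      (fun s => fracKernel a (t - s) * fracKernel (α * n + β) s) (Ioo 0 t) := by
    intro n
    -- An integral that fails to converge has the value `0` by convention, while this one is known
    -- to be positive.
    by_contra h
    have h1 := integral_undef h
    rw [hconv n] at h1
    have h2 : 0 < fracKernel (α * n + (β + a)) t :=
      div_pos (Real.rpow_pos_of_pos ht _) (Real.Gamma_pos_of_pos (by linarith [hb n]))
    exact h2.ne' h1
  have hF : ∀ n, F n = fun s => (-μ) ^ n *
      (fracKernel a (t - s) * fracKernel (α * n + β) s) := fun n => by
    funext s; simp only [F]; ring
  have hFint : ∀ n, Integrable (F n) (volume.restrict (Ioo 0 t)) := by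
    intro n
    rw [hF n]
    exact (hint n).const_mul _
  have hnorm : ∀ n, ∫ s in Ioo 0 t, ‖F n s‖ = |μ| ^ n * fracKernel (α * n + (β + a)) t := by
    intro n
    rw [← hconv n, ← integral_const_mul]
    refine setIntegral_congr_fun measurableSet_Ioo fun s hs => ?_
    have h1 := fracKernel_nonneg ha (sub_nonneg.2 hs.2.le)
    have h2 := fracKernel_nonneg (hb n) hs.1.le
    rw [hF n]
    simp only [norm_mul, norm_pow, norm_neg, Real.norm_eq_abs, abs_of_nonneg h1, abs_of_nonneg h2]
  -- The norms add up to the series of the kernel with parameter `-|μ|`, whose terms are all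
  -- non-negative.
  have hs : Summable fun n : ℕ => |μ| ^ n * fracKernel (α * n + (β + a)) t := by
    have := (hasSum_mlKernel (β := β + a) hα (by linarith) (-|μ|) ht).summable
    simpa only [neg_neg] using this
  have hmain := hasSum_integral_of_summable_integral_norm hFint (by simpa only [hnorm] using hs)
  have h1 : ∫ s in Ioo 0 t, ∑' n, F n s = halfConv (fracKernel a) (mlKernel α β μ) t := by
    rw [halfConv, intervalIntegral.integral_of_le ht.le, ← restrict_Ioo_eq_restrict_Ioc]
    refine setIntegral_congr_fun measurableSet_Ioo fun s hs => ?_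
    exact ((hasSum_mlKernel hα hβ μ hs.1).mul_left _).tsum_eq
  rw [h1] at hmain
  refine hmain.unique ?_
  refine (hasSum_mlKernel hα (by linarith : 0 < β + a) μ ht).congr_fun fun n => ?_
  rw [hF n, integral_const_mul, hconv n]

/-- Splitting off the term `n = 0` leaves `-μ` times the series with `β` raised by `α`. -/
theorem mlKernel_add (hα : 1 ≤ α) (hβ : 0 < β) (μ : ℝ) {t : ℝ} (ht : 0 < t) :
    mlKernel α β μ t + μ * mlKernel α (β + α) μ t = fracKernel β t := by
  have h1 := (hasSum_mlKernel hα hβ μ ht)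
  rw [← hasSum_nat_add_iff' 1] at h1
  simp only [Finset.range_one, Finset.sum_singleton, pow_zero, Nat.cast_zero, mul_zero, zero_add,
    one_mul] at h1
  have h2 := (hasSum_mlKernel (β := β + α) hα (by linarith) μ ht).mul_left (-μ)
  have h3 : mlKernel α β μ t - fracKernel β t = -μ * mlKernel α (β + α) μ t := by
    refine h1.unique (h2.congr_fun fun n => ?_)
    rw [pow_succ, show α * ((n + 1 : ℕ) : ℝ) + β = α * n + (β + α) by push_cast; ring]
    ring
  linarith

theorem mlKernel_scale (hα : 1 ≤ α) {μ t : ℝ} (hμ : 0 < μ) (ht : 0 ≤ t) :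
    mlKernel α β μ t = μ ^ (-(β - 1) / α) * mlKernel α β 1 (μ ^ (1 / α) * t) := by
  have hα0 : 0 < α := by linarith
  have h1 : (μ ^ (1 / α) * t) ^ α = μ * t ^ α := by
    rw [Real.mul_rpow (by positivity) ht, ← Real.rpow_mul hμ.le, one_div_mul_cancel hα0.ne',
      Real.rpow_one]
  unfold mlKernel
  rw [h1, one_mul, Real.mul_rpow (by positivity) ht, ← mul_assoc, ← mul_assoc,
    ← Real.rpow_mul hμ.le, ← Real.rpow_add hμ]
  rw [show -(β - 1) / α + 1 / α * (β - 1) = 0 by ring, Real.rpow_zero, one_mul]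

/-- The solution of the scalar equation `𝔻_t^α x + μ x = F`, `x(0) = a`, `x'(0) = b`. -/
def modeSol (α μ a b : ℝ) (F : ℝ → ℝ) (t : ℝ) : ℝ :=
  mlKernel α 1 μ t * a + mlKernel α 2 μ t * b + halfConv (mlKernel α α μ) F t

theorem mlKernel_one_zero (hα : 1 ≤ α) (μ : ℝ) : mlKernel α 1 μ 0 = 1 := by
  unfold mlKernel mittagLeffler
  rw [Real.zero_rpow (show α ≠ 0 by linarith), mul_zero, neg_zero, sub_self, Real.rpow_zero, one_mul,
    tsum_eq_single 0 (fun n hn => by rw [zero_pow hn, zero_div])]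
  simp

theorem mlKernel_zero_of_one_lt (hβ : 1 < β) (μ : ℝ) : mlKernel α β μ 0 = 0 := by
  unfold mlKernel
  rw [Real.zero_rpow (by linarith), zero_mul]

/-- Convolution with the kernel of order `α` raises the second index of each Mittag-Leffler kernel
by `α`, and `mlKernel_add` then collapses every pair to a power kernel. -/
theorem modeSol_volterra (hα : 1 < α) (μ a b : ℝ) {F : ℝ → ℝ} {t : ℝ} (ht : 0 ≤ t)
    (hF : ContinuousOn F (Icc 0 t))
    (hconv : ContinuousOn (halfConv (mlKernel α α μ) F) (Icc 0 t)) :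
    modeSol α μ a b F t + μ * halfConv (fracKernel α) (modeSol α μ a b F) t =
      a + t * b + halfConv (fracKernel α) F t := by
  have hα0 : 0 < α := by linarith
  rcases ht.eq_or_lt with rfl | ht0
  · simp only [modeSol, halfConv_zero_right, mlKernel_one_zero hα.le,
      mlKernel_zero_of_one_lt one_lt_two]
    ring
  have hk := intervalIntegrable_fracKernel hα0 0 t
  have hc1 : ContinuousOn (fun s => a * mlKernel α 1 μ s) (Icc 0 t) :=
    (continuous_const.mul (continuous_mlKernel hα.le le_rfl μ)).continuousOn
  have hc2 : ContinuousOn (fun s => b * mlKernel α 2 μ s) (Icc 0 t) :=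
    (continuous_const.mul (continuous_mlKernel hα.le one_le_two μ)).continuousOn
  have h1 : halfConv (fracKernel α) (modeSol α μ a b F) t = a * mlKernel α (1 + α) μ t +
      b * mlKernel α (2 + α) μ t + halfConv (fracKernel α) (halfConv (mlKernel α α μ) F) t := by
    rw [← halfConv_fracKernel_mlKernel hα.le one_pos μ hα0 ht0,
      ← halfConv_fracKernel_mlKernel hα.le two_pos μ hα0 ht0,
      ← halfConv_const_mul_right, ← halfConv_const_mul_right,
      ← halfConv_add_right ht hk hc1 hc2, ← halfConv_add_right
        (b := fun s => a * mlKernel α 1 μ s + b * mlKernel α 2 μ s) ht hk (hc1.add hc2) hconv]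
    exact halfConv_congr ht (fun _ _ => rfl) fun s _ => by unfold modeSol; ring
  have h2 : halfConv (fracKernel α) (halfConv (mlKernel α α μ) F) t =
      halfConv (mlKernel α (α + α) μ) F t := by
    rw [halfConv_assoc ht hk (intervalIntegrable_mlKernel hα.le hα0 μ _ _) hF]
    exact halfConv_congr ht (fun s hs => halfConv_fracKernel_mlKernel hα.le hα0 μ hα0 hs.1)
      fun _ _ => rfl
  have h3 : halfConv (mlKernel α α μ) F t + μ * halfConv (mlKernel α (α + α) μ) F t =
      halfConv (fracKernel α) F t := by
    rw [halfConv_comm (mlKernel α α μ), halfConv_comm (mlKernel α (α + α) μ),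
      halfConv_comm (fracKernel α), ← halfConv_const_mul_right]
    unfold halfConv
    rw [← intervalIntegral.integral_add]
    · rw [intervalIntegral.integral_of_le ht, intervalIntegral.integral_of_le ht]
      refine setIntegral_congr_fun measurableSet_Ioc fun s hs => ?_
      have := mlKernel_add hα.le hα0 μ hs.1
      simp only
      rw [← this]; ring
    · have := intervalIntegrable_halfConv ht (intervalIntegrable_mlKernel hα.le hα0 μ 0 t) hF
      have := (this.comp_sub_left t).symm
      simpa [mul_comm] using this
    · have := intervalIntegrable_halfConv ht
        (intervalIntegrable_mlKernel hα.le (by linarith : 0 < α + α) μ 0 t) hF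
      have := ((this.comp_sub_left t).symm).const_mul μ
      simpa [mul_comm, mul_left_comm, mul_assoc] using this
  have h4 := mlKernel_add hα.le one_pos μ ht0
  have h5 := mlKernel_add hα.le two_pos μ ht0
  rw [fracKernel_one] at h4
  rw [fracKernel_two] at h5
  rw [h1, h2, modeSol]
  linear_combination a * h4 + b * h5 + h3

/-- The difference `d` of two solutions satisfies `d = -μ k_α * d`. Convolution with the resolvent
kernel `mlKernel α α μ` and `mlKernel_add` give `k_α * d = 0`, hence `d = 0`. -/
theorem eq_modeSol_of_volterra (hα : 1 < α) (μ a b : ℝ) {F x : ℝ → ℝ} {T : ℝ}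
    (hF : ContinuousOn F (Icc 0 T)) (hx : ContinuousOn x (Icc 0 T))
    (hconv : ContinuousOn (halfConv (mlKernel α α μ) F) (Icc 0 T))
    (h : ∀ t ∈ Icc 0 T, x t + μ * halfConv (fracKernel α) x t =
      a + t * b + halfConv (fracKernel α) F t) :
    ∀ t ∈ Icc 0 T, x t = modeSol α μ a b F t := by
  have hα0 : 0 < α := by linarith
  have hms : ContinuousOn (modeSol α μ a b F) (Icc 0 T) :=
    (((continuous_mlKernel hα.le le_rfl μ).continuousOn.mul continuousOn_const).add
      ((continuous_mlKernel hα.le one_le_two μ).continuousOn.mul continuousOn_const)).add hconv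
  set d : ℝ → ℝ := fun t => x t + (-1) * modeSol α μ a b F t with hd
  have hdc : ContinuousOn d (Icc 0 T) := hx.add (continuousOn_const.mul hms)
  have hdk : ∀ t ∈ Icc 0 T, d t = -μ * halfConv (fracKernel α) d t := by
    intro t ht
    have hsub : Icc 0 t ⊆ Icc 0 T := Icc_subset_Icc_right ht.2
    have h1 := h t ht
    have h2 := modeSol_volterra hα μ a b ht.1 (hF.mono hsub) (hconv.mono hsub)
    have h3 : halfConv (fracKernel α) d t = halfConv (fracKernel α) x t +
        (-1) * halfConv (fracKernel α) (modeSol α μ a b F) t := by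
      rw [← halfConv_const_mul_right, ← halfConv_add_right ht.1
        (c := fun s => (-1) * modeSol α μ a b F s)
        (intervalIntegrable_fracKernel hα0 _ _) (hx.mono hsub)
        (continuousOn_const.mul (hms.mono hsub))]
    rw [h3]
    simp only [hd]
    linear_combination h1 - h2
  have hzero : ∀ t ∈ Icc 0 T, halfConv (fracKernel α) d t = 0 := by
    intro t ht
    have hsub : Icc 0 t ⊆ Icc 0 T := Icc_subset_Icc_right ht.2
    have hdt := hdc.mono hsub
    have hM := intervalIntegrable_mlKernel hα.le hα0 μ 0 t
    have h1 : halfConv (mlKernel α α μ) d t =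
        -μ * halfConv (mlKernel α α μ) (halfConv (fracKernel α) d) t := by
      rw [← halfConv_const_mul_right]
      exact halfConv_congr ht.1 (fun _ _ => rfl) fun s hs => hdk s ⟨hs.1.le, hs.2.le.trans ht.2⟩
    have h2 : halfConv (mlKernel α α μ) (halfConv (fracKernel α) d) t =
        halfConv (mlKernel α (α + α) μ) d t := by
      rw [halfConv_assoc ht.1 hM (intervalIntegrable_fracKernel hα0 _ _) hdt]
      refine halfConv_congr ht.1 (fun s hs => ?_) fun _ _ => rfl
      rw [halfConv_comm, halfConv_fracKernel_mlKernel hα.le hα0 μ hα0 hs.1]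
    have h3 : halfConv (fracKernel α) d t = halfConv (mlKernel α α μ) d t +
        μ * halfConv (mlKernel α (α + α) μ) d t := by
      unfold halfConv
      rw [← intervalIntegral.integral_const_mul, ← intervalIntegral.integral_add
        (intervalIntegrable_halfConv ht.1 hM hdt)
        ((intervalIntegrable_halfConv ht.1
          (intervalIntegrable_mlKernel hα.le (by linarith) μ 0 t) hdt).const_mul _),
        intervalIntegral.integral_of_le ht.1, intervalIntegral.integral_of_le ht.1,
        ← restrict_Ioo_eq_restrict_Ioc]
      refine setIntegral_congr_fun measurableSet_Ioo fun s hs => ?_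
      have := mlKernel_add hα.le hα0 μ (sub_pos.2 hs.2)
      rw [← this]; ring
    rw [h3, h1, h2]; ring
  intro t ht
  have h1 := hdk t ht
  rw [hzero t ht] at h1
  simp only [hd] at h1
  linarith

end MittagLeffler

/-! ### Inversion of the Laplace transform and sup bounds. -/

section Laplace

open Complex in
/-- The integral over vertical lines does not depend on the line. -/
theorem integral_vertical_eq {H : ℂ → ℂ} {a b : ℝ} {M : ℝ → ℝ} (hab : a ≤ b)
    (hd : DifferentiableOn ℂ H {p | a ≤ p.re}) (hM : ∀ p : ℂ, p.re ∈ Icc a b → ‖H p‖ ≤ M p.im)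
    (hMi : Integrable M) (hM0 : Tendsto M (cocompact ℝ) (𝓝 0)) :
    ∫ y : ℝ, H (a + y * I) = ∫ y : ℝ, H (b + y * I) := by
  have hcont : ∀ c ∈ Icc a b, Continuous fun y : ℝ => H (c + y * I) := by
    intro c hc
    refine hd.continuousOn.comp_continuous (by fun_prop) fun y => ?_
    simpa using hc.1
  have hint : ∀ c ∈ Icc a b, Integrable fun y : ℝ => H (c + y * I) := by
    intro c hc
    refine hMi.mono' (hcont c hc).aestronglyMeasurable (Eventually.of_forall fun y => ?_)
    simpa using hM (c + y * I) (by simpa using hc)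
  have hlim : ∀ c ∈ Icc a b, Tendsto (fun R : ℝ => ∫ y in (-R)..R, H (c + y * I)) atTop
      (𝓝 (∫ y : ℝ, H (c + y * I))) := fun c hc =>
    intervalIntegral_tendsto_integral (hint c hc) tendsto_neg_atTop_atBot tendsto_id
  -- Cauchy's theorem on a rectangle. The bound `M` makes the horizontal sides vanish as `R → ∞`.
  have hrect : ∀ R : ℝ, (∫ y in (-R)..R, H (b + y * I)) - ∫ y in (-R)..R, H (a + y * I) =
      I * ((∫ x in a..b, H (x + (-R : ℝ) * I)) - ∫ x in a..b, H (x + (R : ℝ) * I)) := by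
    intro R
    have h := integral_boundary_rect_eq_zero_of_differentiableOn H ⟨a, -R⟩ ⟨b, R⟩
      (hd.mono fun p hp => by
        have := (mem_reProdIm.1 hp).1
        rw [uIcc_of_le hab] at this
        exact this.1)
    simp only [smul_eq_mul] at h
    linear_combination (-I) * h + ((∫ y in (-R)..R, H (b + y * I)) -
      ∫ y in (-R)..R, H (a + y * I)) * I_mul_I
  have hside : ∀ s : ℝ → ℝ, Tendsto s atTop (cocompact ℝ) →
      Tendsto (fun R : ℝ => ∫ x in a..b, H (x + (s R : ℝ) * I)) atTop (𝓝 0) := by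
    intro s hs
    refine squeeze_zero_norm (a := fun R => M (s R) * |b - a|) (fun R => ?_) ?_
    · refine intervalIntegral.norm_integral_le_of_norm_le_const fun x hx => ?_
      rw [uIoc_of_le hab] at hx
      simpa using hM (x + (s R : ℝ) * I) (by simpa using ⟨hx.1.le, hx.2⟩)
    · simpa using (hM0.comp hs).mul_const |b - a|
  have h1 := ((hside (fun R => -R) (tendsto_neg_atTop_atBot.mono_right atBot_le_cocompact)).sub
    (hside (fun R => R) (tendsto_id.mono_right atTop_le_cocompact))).const_mul I
  have h2 := (hlim b (right_mem_Icc.2 hab)).sub (hlim a (left_mem_Icc.2 hab))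
  simp only [hrect] at h2
  have h3 := tendsto_nhds_unique h2 h1
  rw [sub_zero, mul_zero, sub_eq_zero] at h3
  exact h3.symm

theorem rpow_one_add_abs_le {α : ℝ} (hα : 0 ≤ α) (y : ℝ) :
    (1 + |y| ^ α)⁻¹ ≤ 2 ^ α * (1 + ‖y‖) ^ (-α) := by
  rw [Real.norm_eq_abs, Real.rpow_neg (by positivity), ← div_eq_mul_inv, ← one_div,
    div_le_div_iff₀ (by positivity) (by positivity), one_mul]
  have h0 := abs_nonneg y
  rcases le_total |y| 1 with h | h
  · have : (1 + |y|) ^ α ≤ 2 ^ α := Real.rpow_le_rpow (by positivity) (by linarith) hα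
    nlinarith [Real.rpow_nonneg h0 α, Real.rpow_nonneg (zero_le_two (α := ℝ)) α]
  · have : (1 + |y|) ^ α ≤ (2 * |y|) ^ α := Real.rpow_le_rpow (by positivity) (by linarith) hα
    rw [Real.mul_rpow zero_le_two h0] at this
    nlinarith [Real.rpow_nonneg h0 α, Real.rpow_nonneg (zero_le_two (α := ℝ)) α]

theorem integrable_inv_one_add_abs_rpow {α : ℝ} (hα : 1 < α) :
    Integrable fun y : ℝ => (1 + |y| ^ α)⁻¹ := by
  refine Integrable.mono' ((integrable_one_add_norm (E := ℝ) (μ := volume) (r := α)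
    (by simpa using hα)).const_mul (2 ^ α)) ?_ (Eventually.of_forall fun y => ?_)
  · have h : Continuous fun y : ℝ => (1 + |y| ^ α)⁻¹ := by
      refine Continuous.inv₀ (continuous_const.add
        ((Real.continuous_rpow_const (by linarith)).comp continuous_abs)) fun y => ?_
      positivity
    exact h.aestronglyMeasurable
  · rw [Real.norm_of_nonneg (by positivity)]
    exact rpow_one_add_abs_le (by linarith) y

theorem tendsto_inv_one_add_abs_rpow {α : ℝ} (hα : 1 < α) :
    Tendsto (fun y : ℝ => (1 + |y| ^ α)⁻¹) (cocompact ℝ) (𝓝 0) := by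
  refine tendsto_inv_atTop_zero.comp (tendsto_atTop_add_const_left _ _ ?_)
  have := (tendsto_rpow_atTop (show 0 < α by linarith)).comp (tendsto_norm_cocompact_atTop (E := ℝ))
  simpa [Function.comp_def] using this

open Complex FourierTransform in
/-- Inversion of the Laplace transform. -/
theorem laplace_inversion {g : ℝ → ℝ} {G : ℂ → ℂ} {σ : ℝ} (hg : ContinuousOn g (Ioi 0))
    (hgi : IntegrableOn (fun t => Real.exp (-(σ * t)) * g t) (Ioi 0))
    (hG : ∀ y : ℝ, ∫ t in Ioi (0 : ℝ), Complex.exp (-((σ + y * I) * t)) * g t = G (σ + y * I))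
    (hGi : Integrable fun y : ℝ => G (σ + y * I)) {t : ℝ} (ht : 0 < t) :
    2 * Real.pi * (g t : ℂ) = ∫ y : ℝ, Complex.exp ((σ + y * I) * t) * G (σ + y * I) := by
  -- The Fourier transform of this function at `w` is `G(σ + 2π i w)`, so Fourier inversion applies
  -- at the continuity point `t`.
  set h : ℝ → ℂ := (Ioi (0 : ℝ)).indicator fun t => ((Real.exp (-(σ * t)) * g t : ℝ) : ℂ) with hh
  have hi : Integrable h := by
    rw [hh, integrable_indicator_iff measurableSet_Ioi]
    exact hgi.ofReal
  have hF : ∀ w : ℝ, 𝓕 h w = G (σ + (2 * Real.pi * w : ℝ) * I) := by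
    intro w
    rw [Real.fourier_real_eq_integral_exp_smul, ← hG, ← integral_indicator measurableSet_Ioi]
    congr 1
    funext v
    by_cases hv : v ∈ Ioi (0 : ℝ)
    · simp only [hh, indicator_of_mem hv, smul_eq_mul]
      rw [ofReal_mul (Real.exp _), ofReal_exp, ← mul_assoc, ← Complex.exp_add]
      congr 2
      push_cast
      ring
    · simp only [hh, indicator_of_notMem hv, smul_zero]
  have h2π : (0 : ℝ) < 2 * Real.pi := by positivity
  have hFi : Integrable (𝓕 h) := by
    have := hGi.comp_mul_left' h2π.ne'
    exact this.congr (Eventually.of_forall fun w => (hF w).symm)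
  have hc : ContinuousAt h t := by
    have h1 : ContinuousAt (fun t => ((Real.exp (-(σ * t)) * g t : ℝ) : ℂ)) t := by
      have h2 := hg.continuousAt (Ioi_mem_nhds ht)
      exact continuous_ofReal.continuousAt.comp (ContinuousAt.mul (by fun_prop) h2)
    refine h1.congr ?_
    filter_upwards [Ioi_mem_nhds ht] with s hs
    rw [hh, indicator_of_mem hs]
  have hinv := hi.fourierInv_fourier_eq hFi hc
  rw [Real.fourierInv_eq'] at hinv
  have h3 : h t = ((Real.exp (-(σ * t)) * g t : ℝ) : ℂ) := by rw [hh, indicator_of_mem (by exact ht)]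
  have h4 := Measure.integral_comp_mul_left
    (fun y : ℝ => Complex.exp ((σ + y * I) * t) * G (σ + y * I)) (2 * Real.pi)
  rw [abs_of_pos (inv_pos.2 h2π)] at h4
  have h5 : (g t : ℂ) = ∫ w : ℝ, Complex.exp ((σ + (2 * Real.pi * w : ℝ) * I) * t) *
      G (σ + (2 * Real.pi * w : ℝ) * I) := by
    have h6 : (g t : ℂ) = Complex.exp (σ * t) * h t := by
      rw [h3]; push_cast
      rw [← mul_assoc, ← Complex.exp_add]; simp
    rw [h6, ← hinv, ← integral_const_mul]
    congr 1
    funext w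
    rw [hF, smul_eq_mul, ← mul_assoc, ← Complex.exp_add]
    congr 2
    simp
    ring
  rw [h5, h4, Complex.real_smul]
  push_cast
  rw [← mul_assoc, mul_inv_cancel₀ (by exact_mod_cast h2π.ne'), one_mul]

open Complex in
/-- A function whose Laplace transform extends to the right half plane with an integrable bound is
bounded. -/
theorem abs_le_of_laplace {g : ℝ → ℝ} {G : ℂ → ℂ} {σ α C : ℝ} (hα : 1 < α) (hσ : 0 < σ)
    (hg : ContinuousOn g (Ioi 0))
    (hgi : IntegrableOn (fun t => Real.exp (-(σ * t)) * g t) (Ioi 0))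
    (hG : ∀ y : ℝ, ∫ t in Ioi (0 : ℝ), Complex.exp (-((σ + y * I) * t)) * g t = G (σ + y * I))
    (hGd : ∀ p : ℂ, 0 < p.re → DifferentiableAt ℂ G p)
    (hGb : ∀ p : ℂ, 0 < p.re → ‖G p‖ ≤ C * (1 + |p.im| ^ α)⁻¹) {t : ℝ} (ht : 0 < t) :
    |g t| ≤ C * ∫ y : ℝ, (1 + |y| ^ α)⁻¹ := by
  have hMi := (integrable_inv_one_add_abs_rpow hα).const_mul C
  have hcont : ∀ c : ℝ, 0 < c → Continuous fun y : ℝ => G (c + y * I) := by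
    intro c hc
    rw [continuous_iff_continuousAt]
    intro y
    exact ContinuousAt.comp (f := fun y : ℝ => (c + y * I : ℂ)) (hGd _ (by simpa using hc)).continuousAt
      (by fun_prop)
  have hGi : Integrable fun y : ℝ => G (σ + y * I) := by
    refine hMi.mono' (hcont σ hσ).aestronglyMeasurable (Eventually.of_forall fun y => ?_)
    simpa using hGb (σ + y * I) (by simpa using hσ)
  have hinv := laplace_inversion hg hgi hG hGi ht
  have hI0 : 0 ≤ C * ∫ y : ℝ, (1 + |y| ^ α)⁻¹ := by
    rw [← integral_const_mul]
    exact integral_nonneg fun y => (norm_nonneg _).trans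
      (by simpa using hGb (1 + y * I) (by simp))
  -- The line of integration is moved to abscissa `ε`, where `|e^{pt}| = e^{εt}`. The bound on `G`
  -- does not depend on `ε`, so `ε → 0` is harmless. The factor `2π ≥ 1` is dropped.
  have hε : ∀ ε : ℝ, 0 < ε → ε ≤ σ →
      |g t| ≤ Real.exp (ε * t) * (C * ∫ y : ℝ, (1 + |y| ^ α)⁻¹) := by
    intro ε hε hεσ
    have hnorm : ∀ p : ℂ, 0 < p.re → ‖Complex.exp (p * t) * G p‖ ≤
        Real.exp (p.re * t) * (C * (1 + |p.im| ^ α)⁻¹) := by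
      intro p hp
      rw [norm_mul, Complex.norm_exp]
      have : (p * t).re = p.re * t := by simp
      rw [this]
      exact mul_le_mul_of_nonneg_left (hGb p hp) (Real.exp_pos _).le
    have hshift := integral_vertical_eq (H := fun p => Complex.exp (p * t) * G p)
      (M := fun y => Real.exp (σ * t) * (C * (1 + |y| ^ α)⁻¹)) hεσ
      (fun p hp => by
        have hp0 : 0 < p.re := hε.trans_le hp
        have h1 : DifferentiableAt ℂ (fun p : ℂ => Complex.exp (p * t)) p := by fun_prop
        exact (h1.mul (hGd p hp0)).differentiableWithinAt)
      (fun p hp => by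
        have hp0 : 0 < p.re := hε.trans_le hp.1
        refine (hnorm p hp0).trans (mul_le_mul_of_nonneg_right ?_
          ((norm_nonneg _).trans (hGb p hp0)))
        exact Real.exp_le_exp.2 (mul_le_mul_of_nonneg_right hp.2 ht.le))
      (hMi.const_mul _)
      (by simpa using ((tendsto_inv_one_add_abs_rpow hα).const_mul C).const_mul (Real.exp (σ * t)))
    rw [← hshift] at hinv
    have h1 : ‖∫ y : ℝ, Complex.exp ((ε + y * I) * t) * G (ε + y * I)‖ ≤
        ∫ y : ℝ, Real.exp (ε * t) * (C * (1 + |y| ^ α)⁻¹) := by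
      refine norm_integral_le_of_norm_le (hMi.const_mul _) (Eventually.of_forall fun y => ?_)
      simpa using hnorm (ε + y * I) (by simpa using hε)
    rw [integral_const_mul, integral_const_mul, ← hinv, norm_mul, norm_mul] at h1
    simp only [norm_real, RCLike.norm_ofNat, Real.norm_eq_abs, abs_of_pos Real.pi_pos] at h1
    nlinarith [Real.pi_gt_three, abs_nonneg (g t)]
  have hlim : Tendsto (fun ε : ℝ => Real.exp (ε * t) * (C * ∫ y : ℝ, (1 + |y| ^ α)⁻¹)) (𝓝[>] 0)
      (𝓝 (Real.exp (0 * t) * (C * ∫ y : ℝ, (1 + |y| ^ α)⁻¹))) :=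
    (Continuous.tendsto (by fun_prop) 0).mono_left nhdsWithin_le_nhds
  rw [zero_mul, Real.exp_zero, one_mul] at hlim
  refine ge_of_tendsto hlim ?_
  filter_upwards [Ioc_mem_nhdsGT hσ] with ε h
  exact hε ε h.1 h.2

end Laplace

/-! ### Decay of the Mittag-Leffler kernels. -/

section LaplaceMittagLeffler

variable {α β : ℝ}

theorem laplace_fracKernel_real {b σ : ℝ} (hb : 0 < b) (hσ : 0 < σ) :
    ∫ t in Ioi (0 : ℝ), Real.exp (-(σ * t)) * fracKernel b t = (1 / σ) ^ b := by
  have h := Real.integral_rpow_mul_exp_neg_mul_Ioi hb hσ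
  have hG : Real.Gamma b ≠ 0 := (Real.Gamma_pos_of_pos hb).ne'
  rw [← mul_div_cancel_right₀ ((1 / σ) ^ b) hG, ← h, ← integral_div]
  refine setIntegral_congr_fun measurableSet_Ioi fun t ht => ?_
  simp only [fracKernel]
  ring

theorem integrableOn_laplace_fracKernel_real {b σ : ℝ} (hb : 0 < b) (hσ : 0 < σ) :
    IntegrableOn (fun t => Real.exp (-(σ * t)) * fracKernel b t) (Ioi 0) := by
  by_contra h
  have h1 := integral_undef h
  rw [laplace_fracKernel_real hb hσ] at h1
  have : 0 < (1 / σ) ^ b := by positivity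
  exact this.ne' h1

theorem continuousOn_fracKernel (b : ℝ) : ContinuousOn (fracKernel b) (Ioi 0) := fun _ ht =>
  ((Real.continuousAt_rpow_const _ _ (Or.inl (ne_of_gt ht))).div_const _).continuousWithinAt

open Complex in
theorem norm_laplace_fracKernel {b : ℝ} (hb : 0 < b) (p : ℂ) {t : ℝ} (ht : 0 ≤ t) :
    ‖Complex.exp (-(p * t)) * (fracKernel b t : ℂ)‖ =
      Real.exp (-(p.re * t)) * fracKernel b t := by
  rw [norm_mul, Complex.norm_exp, norm_real, Real.norm_of_nonneg (fracKernel_nonneg hb ht)]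
  simp

theorem aestronglyMeasurable_laplace_fracKernel (b : ℝ) (p : ℂ) :
    AEStronglyMeasurable (fun t : ℝ => Complex.exp (-(p * t)) * (fracKernel b t : ℂ))
      (volume.restrict (Ioi 0)) := by
  refine ContinuousOn.aestronglyMeasurable ?_ measurableSet_Ioi
  exact (by fun_prop : Continuous fun t : ℝ => Complex.exp (-(p * t))).continuousOn.mul
    (Complex.continuous_ofReal.comp_continuousOn (continuousOn_fracKernel b))

open Complex in
theorem integrableOn_laplace_fracKernel {b : ℝ} (hb : 0 < b) {p : ℂ} (hp : 0 < p.re) :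
    IntegrableOn (fun t : ℝ => Complex.exp (-(p * t)) * (fracKernel b t : ℂ)) (Ioi 0) := by
  refine (integrableOn_laplace_fracKernel_real hb hp).mono'
    (aestronglyMeasurable_laplace_fracKernel b p)
    ((ae_restrict_iff' measurableSet_Ioi).2 (Eventually.of_forall fun t ht => ?_))
  rw [norm_laplace_fracKernel hb p (le_of_lt ht)]

open Complex in
theorem differentiableAt_laplace_fracKernel {b : ℝ} (hb : 0 < b) {p : ℂ} (hp : 0 < p.re) :
    DifferentiableAt ℂ
      (fun p : ℂ => ∫ t in Ioi (0 : ℝ), Complex.exp (-(p * t)) * (fracKernel b t : ℂ)) p := by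
  have hb1 : 0 < b + 1 := by linarith
  -- Differentiation in `p` brings down a factor `t`, and `t k_b = b k_{b+1}`; halving the real part
  -- gives a majorant uniform near `p`.
  refine (hasDerivAt_integral_of_dominated_loc_of_deriv_le (s := {z : ℂ | p.re / 2 < z.re})
    (F := fun z t => Complex.exp (-(z * t)) * (fracKernel b t : ℂ))
    (F' := fun z t => Complex.exp (-(z * t)) * (-t) * (fracKernel b t : ℂ))
    (bound := fun t => b * (Real.exp (-(p.re / 2 * t)) * fracKernel (b + 1) t))
    ?_ ?_ (integrableOn_laplace_fracKernel hb hp) ?_ ?_ ?_ ?_).2.differentiableAt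
  · exact (isOpen_lt continuous_const continuous_re).mem_nhds (by simpa using hp)
  · exact Eventually.of_forall fun z => aestronglyMeasurable_laplace_fracKernel b z
  · refine ContinuousOn.aestronglyMeasurable ?_ measurableSet_Ioi
    exact (by fun_prop : Continuous fun t : ℝ =>
      Complex.exp (-(p * t)) * (-(t : ℂ))).continuousOn.mul
      (Complex.continuous_ofReal.comp_continuousOn (continuousOn_fracKernel b))
  · refine (ae_restrict_iff' measurableSet_Ioi).2 (Eventually.of_forall fun t ht z hz => ?_)
    have ht : 0 < t := ht
    have hz : p.re / 2 < z.re := hz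
    have h1 : b * fracKernel (b + 1) t = t * fracKernel b t := by
      have hG := (Real.Gamma_pos_of_pos hb).ne'
      unfold fracKernel
      rw [Real.Gamma_add_one hb.ne', show b + 1 - 1 = (b - 1) + 1 by ring, Real.rpow_add_one ht.ne']
      field_simp
    rw [mul_right_comm, norm_mul, norm_laplace_fracKernel hb z ht.le, norm_neg, norm_real,
      Real.norm_of_nonneg ht.le, mul_left_comm, h1, mul_assoc, mul_comm (fracKernel b t)]
    refine mul_le_mul_of_nonneg_right (Real.exp_le_exp.2 ?_)
      (mul_nonneg ht.le (fracKernel_nonneg hb ht.le))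
    nlinarith
  · exact (integrableOn_laplace_fracKernel_real hb1 (by positivity)).const_mul b
  · refine Eventually.of_forall fun t z _ => ?_
    have h1 : HasDerivAt (fun z : ℂ => Complex.exp (-(z * t))) (Complex.exp (-(z * t)) * (-t)) z := by
      have := ((hasDerivAt_id z).mul_const (t : ℂ)).neg.cexp
      simpa using this
    exact h1.mul_const _

-- For real `p` this is the Gamma integral. Both sides are holomorphic in the right half plane, so
-- the identity theorem extends it.
open Complex in
theorem laplace_fracKernel {b : ℝ} (hb : 0 < b) {p : ℂ} (hp : 0 < p.re) :
    ∫ t in Ioi (0 : ℝ), Complex.exp (-(p * t)) * (fracKernel b t : ℂ) = p ^ (-(b : ℂ)) := by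
  have hopen : IsOpen {z : ℂ | 0 < z.re} := isOpen_lt continuous_const continuous_re
  have h1 : AnalyticOnNhd ℂ
      (fun p : ℂ => ∫ t in Ioi (0 : ℝ), Complex.exp (-(p * t)) * (fracKernel b t : ℂ))
      {z : ℂ | 0 < z.re} :=
    DifferentiableOn.analyticOnNhd
      (fun z hz => (differentiableAt_laplace_fracKernel hb hz).differentiableWithinAt) hopen
  have h2 : AnalyticOnNhd ℂ (fun p : ℂ => p ^ (-(b : ℂ))) {z : ℂ | 0 < z.re} :=
    DifferentiableOn.analyticOnNhd (fun z hz =>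
      (differentiableAt_id.cpow_const (Or.inl hz)).differentiableWithinAt) hopen
  refine h1.eqOn_of_preconnected_of_frequently_eq h2 (convex_halfSpace_re_gt 0).isPreconnected
    (z₀ := 1) (by simp) ?_ hp
  have hT : Tendsto (fun x : ℝ => (x : ℂ)) (𝓝[≠] 1) (𝓝[≠] 1) := by
    refine tendsto_nhdsWithin_iff.2 ⟨?_, ?_⟩
    · exact (continuous_ofReal.tendsto' 1 1 (by simp)).mono_left nhdsWithin_le_nhds
    · filter_upwards [self_mem_nhdsWithin] with x hx
      simpa using hx
  refine hT.frequently (Eventually.frequently ?_)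
  filter_upwards [nhdsWithin_le_nhds (Ioi_mem_nhds one_pos)] with σ hσ
  have hσ : 0 < σ := hσ
  have h3 := laplace_fracKernel_real hb hσ
  rw [one_div, Real.inv_rpow hσ.le, ← Real.rpow_neg hσ.le] at h3
  rw [← ofReal_neg, ← ofReal_cpow hσ.le, ← h3, ← integral_complex_ofReal]
  simp

open Complex in
theorem integral_norm_laplace_fracKernel {b : ℝ} (hb : 0 < b) {p : ℂ} (hp : 0 < p.re) :
    ∫ t in Ioi (0 : ℝ), ‖Complex.exp (-(p * t)) * (fracKernel b t : ℂ)‖ = (1 / p.re) ^ b := by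
  rw [← laplace_fracKernel_real hb hp]
  exact setIntegral_congr_fun measurableSet_Ioi fun _ ht => norm_laplace_fracKernel hb p (le_of_lt ht)

/-- The factor `t` is there to gain decay: the transform of the kernel itself is of order
`|p|^{-β}`, which for `β = α - 1` is not integrable on vertical lines, while that of `t` times the
kernel is of order `|p|^{-β-1}`. -/
theorem hasSum_id_mul_mlKernel (hα : 1 ≤ α) (hβ : 0 < β) (μ : ℝ) {t : ℝ} (ht : 0 < t) :
    HasSum (fun n : ℕ => (-μ) ^ n * (α * n + β) * fracKernel (α * n + β + 1) t)
      (t * mlKernel α β μ t) := by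
  refine ((hasSum_mlKernel hα hβ μ ht).mul_left t).congr_fun fun n => ?_
  have hb : 0 < α * n + β := by positivity
  have hG := (Real.Gamma_pos_of_pos hb).ne'
  unfold fracKernel
  rw [Real.Gamma_add_one hb.ne', show α * n + β + 1 - 1 = (α * n + β - 1) + 1 by ring,
    Real.rpow_add_one ht.ne']
  field_simp

/-- `∑ (α n + β) x ^ n`. -/
theorem hasSum_affine_mul_geometric {𝕜 : Type*} [RCLike 𝕜] (a b : 𝕜) {x : 𝕜} (hx : ‖x‖ < 1) :
    HasSum (fun n : ℕ => (a * n + b) * x ^ n) (a * (x / (1 - x) ^ 2) + b * (1 - x)⁻¹) := by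
  refine (((hasSum_coe_mul_geometric_of_norm_lt_one hx).mul_left a).add
    ((hasSum_geometric_of_norm_lt_one hx).mul_left b)).congr_fun fun n => ?_
  ring

-- Term by term transform, absolutely convergent for `Re p > 1`. Both signs of `μ` are kept: `μ = 1`
-- is the kernel of interest, `μ = -1` its majorant.
open Complex in
theorem hasSum_laplace_mlKernel (hα : 1 ≤ α) (hβ : 0 < β) {μ : ℝ} (hμ : |μ| = 1) {p : ℂ}
    (hp : 1 < p.re) :
    HasSum (fun n : ℕ => (((-μ) ^ n * (α * n + β) : ℝ) : ℂ) * p ^ (-((α * n + β + 1 : ℝ) : ℂ)))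
      (∫ t in Ioi (0 : ℝ), Complex.exp (-(p * t)) * ((t * mlKernel α β μ t : ℝ) : ℂ)) := by
  have hp0 : 0 < p.re := by linarith
  have hb : ∀ n : ℕ, 0 < α * n + β + 1 := fun n => by positivity
  set F : ℕ → ℝ → ℂ := fun n t => (((-μ) ^ n * (α * n + β) : ℝ) : ℂ) *
    (Complex.exp (-(p * t)) * (fracKernel (α * n + β + 1) t : ℂ)) with hF
  have hnorm : ∀ n, ∫ t in Ioi (0 : ℝ), ‖F n t‖ =
      (1 / p.re) ^ (β + 1) * ((α * n + β) * ((1 / p.re) ^ α) ^ n) := by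
    intro n
    have h0 : (0 : ℝ) ≤ α * n + β := by positivity
    simp only [hF]
    have h1 : ∀ (c z : ℂ), ‖c * z‖ = ‖c‖ * ‖z‖ := norm_mul
    simp_rw [h1 (((-μ) ^ n * (α * n + β) : ℝ) : ℂ)]
    rw [integral_const_mul, integral_norm_laplace_fracKernel (hb n) hp0, norm_real, norm_mul,
      norm_pow, norm_neg, Real.norm_eq_abs, hμ, one_pow, one_mul, Real.norm_of_nonneg h0,
      ← Real.rpow_mul_natCast (by positivity), mul_left_comm, ← Real.rpow_add (by positivity)]
    congr 2; ring
  have hs : Summable fun n => ∫ t in Ioi (0 : ℝ), ‖F n t‖ := by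
    simp_rw [hnorm]
    refine ((hasSum_affine_mul_geometric (𝕜 := ℝ) α β ?_).summable).mul_left _
    rw [Real.norm_of_nonneg (by positivity)]
    exact Real.rpow_lt_one (by positivity) (by rw [div_lt_one hp0]; exact hp) (by linarith)
  have hmain := hasSum_integral_of_summable_integral_norm
    (fun n => (integrableOn_laplace_fracKernel (hb n) hp0).const_mul _) hs
  have h1 : ∫ t in Ioi (0 : ℝ), ∑' n, F n t =
      ∫ t in Ioi (0 : ℝ), Complex.exp (-(p * t)) * ((t * mlKernel α β μ t : ℝ) : ℂ) := by
    refine setIntegral_congr_fun measurableSet_Ioi fun t ht => ?_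
    have h2 := (hasSum_ofReal.2 (hasSum_id_mul_mlKernel hα hβ μ ht)).mul_left
      (Complex.exp (-(p * t)))
    refine (h2.congr_fun fun n => ?_).tsum_eq
    simp only [hF]; push_cast; ring
  rw [h1] at hmain
  refine hmain.congr_fun fun n => ?_
  rw [integral_const_mul, laplace_fracKernel (hb n) hp0]

-- For `μ = -1` all terms are non-negative and the sum of their transforms is not `0`, which forces
-- integrability. The kernel with `μ = 1` is dominated by it.
open Complex in
theorem integrableOn_exp_mul_mlKernel (hα : 1 ≤ α) (hβ : 0 < β) {σ : ℝ} (hσ : 1 < σ) :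
    IntegrableOn (fun t => Real.exp (-(σ * t)) * (t * mlKernel α β 1 t)) (Ioi 0) := by
  have hA : IntegrableOn (fun t : ℝ => Complex.exp (-((σ : ℂ) * t)) *
      ((t * mlKernel α β (-1) t : ℝ) : ℂ)) (Ioi 0) := by
    by_contra h
    have h1 := hasSum_laplace_mlKernel hα hβ (μ := -1) (by simp) (p := (σ : ℂ)) (by simpa using hσ)
    rw [integral_undef h] at h1
    have h2 : HasSum (fun n : ℕ => (α * n + β) * (1 / σ) ^ (α * n + β + 1)) 0 := by
      rw [← Complex.hasSum_ofReal]
      refine (h1.congr_fun fun n => ?_)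
      rw [one_div, Real.inv_rpow (by linarith), ← Real.rpow_neg (by linarith), ofReal_mul,
        ofReal_cpow (by linarith)]
      push_cast; simp
    have h3 := (hasSum_zero_iff_of_nonneg fun n => by positivity).1 h2
    have h4 := congrFun h3 0
    have h5 : 0 < (α * (0 : ℕ) + β) * (1 / σ) ^ (α * (0 : ℕ) + β + 1) := by
      have : 0 < σ := by linarith
      simp only [Nat.cast_zero, mul_zero, zero_add]
      positivity
    exact h5.ne' h4
  refine hA.norm.mono' ?_ ((ae_restrict_iff' measurableSet_Ioi).2
    (Eventually.of_forall fun t ht => ?_))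
  · refine ContinuousOn.aestronglyMeasurable ?_ measurableSet_Ioi
    exact (by fun_prop : Continuous fun t => Real.exp (-(σ * t))).continuousOn.mul
      (continuousOn_id.mul (continuousOn_mlKernel hα hβ 1))
  · have h1 := hasSum_id_mul_mlKernel hα hβ 1 ht
    have h2 := hasSum_id_mul_mlKernel hα hβ (-1) ht
    have h3 : |t * mlKernel α β 1 t| ≤ t * mlKernel α β (-1) t := by
      rw [← Real.norm_eq_abs, ← h1.tsum_eq, ← h2.tsum_eq]
      refine tsum_of_norm_bounded h2.summable.hasSum fun n => ?_
      have h4 := fracKernel_nonneg (show 0 < α * n + β + 1 by positivity) (le_of_lt ht)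
      rw [norm_mul, norm_mul, Real.norm_of_nonneg h4, norm_pow, norm_neg, norm_one, one_pow,
        neg_neg, one_pow, Real.norm_of_nonneg (by positivity)]
    have h5 : ‖Complex.exp (-((σ : ℂ) * t))‖ = Real.exp (-(σ * t)) := by
      rw [Complex.norm_exp]; simp
    rw [norm_mul (Real.exp _), norm_mul (Complex.exp _), h5, norm_real,
      Real.norm_of_nonneg (Real.exp_pos _).le]
    refine mul_le_mul_of_nonneg_left ?_ (Real.exp_pos _).le
    exact h3.trans (le_abs_self _)

/-- The Laplace transform of `t ^ β E_{α,β}(-t ^ α)`. -/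
def mlLaplace (α β : ℝ) (p : ℂ) : ℂ :=
  p ^ ((α - β - 1 : ℝ) : ℂ) * (β * p ^ (α : ℂ) + (β - α)) / (p ^ (α : ℂ) + 1) ^ 2

-- In the right half plane the argument of `p^α` is at most `απ/2` in absolute value, so `Re p^α ≥ r
-- k`. The rest is `r² + 2rk + 1 - (1 + k)(1 + r)²/2 = (1 - k)(r - 1)²/2 ≥ 0`.
open Complex in
theorem norm_cpow_add_one_ge (hα0 : 0 ≤ α) (hα : α ≤ 2) {p : ℂ} (hp : 0 ≤ p.re) :
    √((1 + Real.cos (α * (Real.pi / 2))) / 2) * (1 + ‖p‖ ^ α) ≤ ‖p ^ (α : ℂ) + 1‖ := by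
  set k := Real.cos (α * (Real.pi / 2)) with hk
  have hk1 : -1 ≤ k := Real.neg_one_le_cos _
  have hk2 : k ≤ 1 := Real.cos_le_one _
  set r := ‖p‖ ^ α with hr
  have hr0 : 0 ≤ r := by positivity
  have hre : r * k ≤ (p ^ (α : ℂ)).re := by
    rw [cpow_ofReal_re]
    refine mul_le_mul_of_nonneg_left ?_ hr0
    rw [← Real.cos_abs (arg p * α), hk]
    have hπ := Real.pi_pos
    refine Real.cos_le_cos_of_nonneg_of_le_pi (abs_nonneg _) (by nlinarith) ?_
    rw [abs_mul, abs_of_nonneg hα0, mul_comm]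
    exact mul_le_mul_of_nonneg_left (abs_arg_le_pi_div_two_iff.2 hp) hα0
  have hsq : ‖p ^ (α : ℂ) + 1‖ ^ 2 = r ^ 2 + 2 * (p ^ (α : ℂ)).re + 1 := by
    have h1 : ‖p ^ (α : ℂ)‖ = r := norm_cpow_real p α
    rw [← h1, Complex.sq_norm, Complex.sq_norm, normSq_apply, normSq_apply]
    simp
    ring
  refine (abs_le_of_sq_le_sq' ?_ (norm_nonneg _)).2
  rw [mul_pow, Real.sq_sqrt (by linarith), hsq]
  nlinarith [mul_nonneg (sub_nonneg.2 hk2) (sq_nonneg (r - 1))]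

open Complex in
theorem one_add_cos_pos (hα1 : 0 ≤ α) (hα2 : α < 2) :
    0 < (1 + Real.cos (α * (Real.pi / 2))) / 2 := by
  have hπ := Real.pi_pos
  have := Real.cos_lt_cos_of_nonneg_of_le_pi (x := α * (Real.pi / 2)) (y := Real.pi)
    (by positivity) le_rfl (by nlinarith)
  rw [Real.cos_pi] at this
  linarith

open Complex in
theorem mlLaplace_eq (hα1 : 1 < α) (hα2 : α < 2) (hβ : 0 < β) {p : ℂ} (hp : 1 < p.re) :
    ∫ t in Ioi (0 : ℝ), Complex.exp (-(p * t)) * ((t * mlKernel α β 1 t : ℝ) : ℂ) =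
      mlLaplace α β p := by
  have hp0 : p ≠ 0 := fun h0 => by simp [h0] at hp; linarith
  have hZ0 : p ^ (α : ℂ) ≠ 0 := by rw [Ne, cpow_eq_zero_iff]; tauto
  have harg : p.arg ≠ Real.pi := by
    intro h
    have := abs_arg_lt_pi_div_two_iff.2 (Or.inl (by linarith : 0 < p.re))
    rw [h, abs_of_pos Real.pi_pos] at this
    linarith [Real.pi_pos]
  have hnorm : 1 < ‖p ^ (α : ℂ)‖ := by
    rw [norm_cpow_real]
    exact Real.one_lt_rpow (hp.trans_le (re_le_norm p)) (by linarith)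
  have hZ1 : p ^ (α : ℂ) + 1 ≠ 0 := by
    intro h
    rw [add_eq_zero_iff_eq_neg] at h
    simp [h] at hnorm
  refine (hasSum_laplace_mlKernel hα1.le hβ (by simp) hp).unique ?_
  have hx : ‖-(p ^ (α : ℂ))⁻¹‖ < 1 := by
    rw [norm_neg, norm_inv]; exact inv_lt_one_of_one_lt₀ hnorm
  have h := (hasSum_affine_mul_geometric (𝕜 := ℂ) α β hx).mul_left ((p ^ ((β + 1 : ℝ) : ℂ))⁻¹)
  have hval : (p ^ ((β + 1 : ℝ) : ℂ))⁻¹ * (α * (-(p ^ (α : ℂ))⁻¹ / (1 - -(p ^ (α : ℂ))⁻¹) ^ 2) +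
      β * (1 - -(p ^ (α : ℂ))⁻¹)⁻¹) = mlLaplace α β p := by
    have h1 : p ^ ((α - β - 1 : ℝ) : ℂ) = p ^ (α : ℂ) * (p ^ ((β + 1 : ℝ) : ℂ))⁻¹ := by
      rw [← cpow_neg, ← cpow_add _ _ hp0]
      congr 1; push_cast; ring
    have h2 : (1 - -(p ^ (α : ℂ))⁻¹) = (p ^ (α : ℂ) + 1) / p ^ (α : ℂ) := by
      field_simp
      ring
    rw [mlLaplace, h1, h2]
    field_simp
    ring
  rw [hval] at h
  refine h.congr_fun fun n => ?_
  have h3 : p ^ (-((α * n + β + 1 : ℝ) : ℂ)) =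
      (p ^ ((β + 1 : ℝ) : ℂ))⁻¹ * ((p ^ (α : ℂ))⁻¹) ^ n := by
    rw [cpow_neg, inv_pow, ← mul_inv, ← cpow_nat_mul, ← cpow_add _ _ hp0, inv_inj]
    congr 1; push_cast; ring
  rw [h3, neg_pow]
  push_cast
  ring

open Complex in
theorem differentiableAt_mlLaplace (hα0 : 0 ≤ α) (hα2 : α < 2) {p : ℂ} (hp : 0 < p.re) :
    DifferentiableAt ℂ (mlLaplace α β) p := by
  have h1 : ∀ c : ℂ, DifferentiableAt ℂ (fun p : ℂ => p ^ c) p := fun c =>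
    differentiableAt_id.cpow_const (Or.inl hp)
  have h2 : p ^ (α : ℂ) + 1 ≠ 0 := by
    intro h
    have := norm_cpow_add_one_ge hα0 hα2.le hp.le
    rw [h, norm_zero] at this
    have h3 : 0 < √((1 + Real.cos (α * (Real.pi / 2))) / 2) * (1 + ‖p‖ ^ α) :=
      mul_pos (Real.sqrt_pos.2 (one_add_cos_pos hα0 hα2)) (by positivity)
    linarith
  unfold mlLaplace
  exact ((h1 _).mul (((h1 _).const_mul _).add_const _)).div (((h1 _).add_const 1).pow 2)
    (pow_ne_zero 2 h2)

-- For these two values of `β` the numerator is at most `α (1 + r)`, against a denominator of order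
-- `(1 + r)²`.
open Complex in
theorem norm_mlLaplace_le (hα1 : 1 < α) (hα2 : α < 2) (hβ : β = α ∨ β = α - 1) {p : ℂ}
    (hp : 0 < p.re) :
    ‖mlLaplace α β p‖ ≤
      α / ((1 + Real.cos (α * (Real.pi / 2))) / 2) * (1 + |p.im| ^ α)⁻¹ := by
  have hα0 : 0 < α := by linarith
  have hk := one_add_cos_pos hα0.le hα2
  set k := (1 + Real.cos (α * (Real.pi / 2))) / 2 with hkdef
  set r := ‖p‖ ^ α with hr
  have hp0 : 0 < ‖p‖ := norm_pos_iff.2 fun h0 => by simp [h0] at hp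
  have hr0 : 0 ≤ r := by positivity
  have hZ : ‖p ^ (α : ℂ)‖ = r := norm_cpow_real p α
  have hden : k * (1 + r) ^ 2 ≤ ‖p ^ (α : ℂ) + 1‖ ^ 2 := by
    have h := norm_cpow_add_one_ge hα0.le hα2.le hp.le
    have h2 := pow_le_pow_left₀ (by positivity) h 2
    rwa [mul_pow, Real.sq_sqrt hk.le] at h2
  have hnum : ‖p ^ ((α - β - 1 : ℝ) : ℂ) * (β * p ^ (α : ℂ) + (β - α))‖ ≤ α * (1 + r) := by
    rw [norm_mul, norm_cpow_real]
    rcases hβ with rfl | rfl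
    · rw [sub_self, sub_self, add_zero, norm_mul, hZ, norm_real, Real.norm_of_nonneg hα0.le,
        zero_sub, mul_left_comm]
      refine mul_le_mul_of_nonneg_left ?_ hα0.le
      rw [hr, ← Real.rpow_add hp0]
      rcases le_total ‖p‖ 1 with h | h
      · have := Real.rpow_le_one hp0.le h (show 0 ≤ -1 + β by linarith)
        linarith
      · have := Real.rpow_le_rpow_of_exponent_le h (show -1 + β ≤ β by linarith)
        linarith
    · rw [show α - (α - 1) - 1 = 0 by ring, Real.rpow_zero, one_mul]
      refine (norm_add_le _ _).trans ?_
      rw [norm_mul, hZ, norm_real, Real.norm_of_nonneg (by linarith),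
        show (((α - 1 : ℝ) : ℂ) - α) = -1 by push_cast; ring, norm_neg, norm_one]
      nlinarith
  have him : |p.im| ^ α ≤ r := Real.rpow_le_rpow (abs_nonneg _) (abs_im_le_norm p) hα0.le
  have him0 : 0 ≤ |p.im| ^ α := by positivity
  rw [mlLaplace, norm_div, norm_pow]
  calc _ ≤ α * (1 + r) / (k * (1 + r) ^ 2) := by gcongr
    _ = α / k * (1 + r)⁻¹ := by field_simp
    _ ≤ α / k * (1 + |p.im| ^ α)⁻¹ := by gcongr

theorem exists_abs_mul_mlKernel_le (hα1 : 1 < α) (hα2 : α < 2) (hβ : β = α ∨ β = α - 1) :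
    ∃ C : ℝ, 0 ≤ C ∧ ∀ t, 0 < t → |t * mlKernel α β 1 t| ≤ C := by
  have hβ0 : 0 < β := by rcases hβ with rfl | rfl <;> linarith
  have h : ∀ t : ℝ, 0 < t → |t * mlKernel α β 1 t| ≤ α / ((1 + Real.cos (α * (Real.pi / 2))) / 2) *
      ∫ y : ℝ, (1 + |y| ^ α)⁻¹ := fun t ht =>
    abs_le_of_laplace (g := fun t => t * mlKernel α β 1 t) (G := mlLaplace α β) (σ := 2) hα1
      two_pos (continuousOn_id.mul (continuousOn_mlKernel hα1.le hβ0 1))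
      (integrableOn_exp_mul_mlKernel hα1.le hβ0 one_lt_two)
      (fun y => mlLaplace_eq hα1 hα2 hβ0 (by simp))
      (fun p hp => differentiableAt_mlLaplace (by linarith) hα2 hp)
      (fun p hp => norm_mlLaplace_le hα1 hα2 hβ hp) ht
  exact ⟨_, (abs_nonneg _).trans (h 1 one_pos), h⟩

/-- Decay of the Mittag-Leffler kernels. -/
theorem exists_abs_mlKernel_le (hα1 : 1 < α) (hα2 : α < 2) (hβ : β = α ∨ β = α - 1) :
    ∃ C : ℝ, 0 ≤ C ∧ ∀ t, 0 < t → |mlKernel α β 1 t| ≤ C * t ^ (α - 2) ∧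
      |mlKernel α β 1 t| ≤ C * t ^ (β - 1) := by
  have hβ0 : 0 < β := by rcases hβ with rfl | rfl <;> linarith
  have hβ1 : -1 ≤ β - 1 ∧ α - 2 ≤ β - 1 := by rcases hβ with rfl | rfl <;> constructor <;> linarith
  obtain ⟨C₁, hC₁, h₁⟩ := exists_abs_mul_mlKernel_le hα1 hα2 hβ
  obtain ⟨C₂, hC₂⟩ := (isCompact_Icc (a := (-1 : ℝ)) (b := 0)).exists_bound_of_continuousOn
    (continuous_mittagLeffler (β := β) hα1.le hβ0).continuousOn
  have hC₂0 : 0 ≤ C₂ := (norm_nonneg _).trans (hC₂ 0 (by simp))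
  refine ⟨C₁ + C₂, by positivity, fun t ht => ?_⟩
  -- For `t ≤ 1` the Mittag-Leffler function is evaluated in `[-1, 0]`, where it is bounded. For `t
  -- ≥ 1` the bound `C₁ / t` is better than both powers, whose exponents are at least `-1`.
  rcases le_total t 1 with h | h
  · have h2 : |mlKernel α β 1 t| ≤ C₂ * t ^ (β - 1) := by
      rw [mlKernel, abs_mul, abs_of_nonneg (Real.rpow_nonneg ht.le _), mul_comm]
      refine mul_le_mul_of_nonneg_right (hC₂ _ ⟨?_, ?_⟩) (Real.rpow_nonneg ht.le _)
      · have := Real.rpow_le_one ht.le h (show 0 ≤ α by linarith)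
        linarith
      · have := Real.rpow_nonneg ht.le α
        linarith
    have h3 : t ^ (β - 1) ≤ t ^ (α - 2) := Real.rpow_le_rpow_of_exponent_ge ht h hβ1.2
    have h4 := Real.rpow_nonneg ht.le (β - 1)
    constructor <;> nlinarith
  · have h2 : |mlKernel α β 1 t| ≤ C₁ * t ^ (-1 : ℝ) := by
      have := h₁ t ht
      rw [abs_mul, abs_of_pos ht] at this
      rw [Real.rpow_neg_one, ← div_eq_mul_inv, le_div_iff₀ ht]
      linarith
    have h3 : t ^ (-1 : ℝ) ≤ t ^ (α - 2) := Real.rpow_le_rpow_of_exponent_le h (by linarith)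
    have h4 : t ^ (-1 : ℝ) ≤ t ^ (β - 1) := Real.rpow_le_rpow_of_exponent_le h hβ1.1
    have h5 := Real.rpow_nonneg ht.le (-1 : ℝ)
    constructor <;> nlinarith

/-- This kernel is `k_{2-α}` convolved with `mlKernel α β 1`, which is at most a multiple of
`k_{α-1}`; and `k_{2-α} * k_{α-1} = 1`. It covers the second indices `2` and `1`. -/
theorem exists_abs_mlKernel_add_le (hα1 : 1 < α) (hα2 : α < 2) (hβ : β = α ∨ β = α - 1) :
    ∃ C : ℝ, 0 ≤ C ∧ ∀ t, 0 < t → |mlKernel α (β + (2 - α)) 1 t| ≤ C := by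
  have hβ0 : 0 < β := by rcases hβ with rfl | rfl <;> linarith
  obtain ⟨C, hC, h⟩ := exists_abs_mlKernel_le hα1 hα2 hβ
  have ha : 0 < 2 - α := by linarith
  have hb : 0 < α - 1 := by linarith
  have hG := Real.Gamma_pos_of_pos hb
  refine ⟨C * Real.Gamma (α - 1), by positivity, fun t ht => ?_⟩
  rw [← halfConv_fracKernel_mlKernel hα1.le hβ0 1 ha ht, halfConv, ← Real.norm_eq_abs]
  have hint : ∫ s in (0 : ℝ)..t, C * Real.Gamma (α - 1) *
      (fracKernel (2 - α) (t - s) * fracKernel (α - 1) s) = C * Real.Gamma (α - 1) := by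
    have h1 := halfConv_fracKernel ha hb ht
    rw [halfConv, show 2 - α + (α - 1) = 1 by ring, fracKernel_one] at h1
    rw [intervalIntegral.integral_const_mul, h1, mul_one]
  have hii : IntervalIntegrable (fun s => C * Real.Gamma (α - 1) *
      (fracKernel (2 - α) (t - s) * fracKernel (α - 1) s)) volume 0 t := by
    refine IntervalIntegrable.const_mul ?_ _
    by_contra hn
    have h1 := halfConv_fracKernel ha hb ht
    rw [halfConv, intervalIntegral.integral_undef hn, show 2 - α + (α - 1) = 1 by ring,
      fracKernel_one] at h1
    exact zero_ne_one h1
  refine (intervalIntegral.norm_integral_le_of_norm_le ht.le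
    (Eventually.of_forall fun s hs => ?_) hii).trans_eq hint
  have h1 := fracKernel_nonneg ha (sub_nonneg.2 hs.2)
  have h2 := (h s hs.1).1
  rw [norm_mul, Real.norm_of_nonneg h1, Real.norm_eq_abs]
  have h3 : C * Real.Gamma (α - 1) * (fracKernel (2 - α) (t - s) * fracKernel (α - 1) s) =
      fracKernel (2 - α) (t - s) * (C * s ^ (α - 2)) := by
    rw [fracKernel, fracKernel, show α - 1 - 1 = α - 2 by ring]
    field_simp
  rw [h3]
  exact mul_le_mul_of_nonneg_left h2 h1

/-- Bounds for the Mittag-Leffler kernels that are uniform in the spectral parameter. -/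
theorem exists_mlKernel_bounds (hα1 : 1 < α) (hα2 : α < 2) :
    ∃ C : ℝ, 0 ≤ C ∧ ∀ μ t : ℝ, 0 < μ → 0 < t →
      |mlKernel α 1 μ t| ≤ C ∧
      |μ ^ (1 / α) * mlKernel α 2 μ t| ≤ C ∧
      |μ ^ (1 / α) * mlKernel α α μ t| ≤ C * t ^ (α - 2) ∧
      |μ ^ (1 - 1 / α) * mlKernel α α μ t| ≤ C ∧
      |mlKernel α (α - 1) μ t| ≤ C * t ^ (α - 2) := by
  have hα0 : 0 < α := by linarith
  obtain ⟨C₁, hC₁, h₁⟩ := exists_abs_mlKernel_le hα1 hα2 (Or.inl rfl)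
  obtain ⟨C₂, hC₂, h₂⟩ := exists_abs_mlKernel_le hα1 hα2 (Or.inr rfl)
  obtain ⟨C₃, hC₃, h₃⟩ := exists_abs_mlKernel_add_le hα1 hα2 (Or.inl rfl)
  obtain ⟨C₄, hC₄, h₄⟩ := exists_abs_mlKernel_add_le hα1 hα2 (Or.inr rfl)
  rw [show α + (2 - α) = 2 by ring] at h₃
  rw [show α - 1 + (2 - α) = 1 by ring] at h₄
  refine ⟨C₁ + C₂ + C₃ + C₄, by positivity, fun μ t hμ ht => ?_⟩
  -- All five bounds follow from the case `μ = 1` at the rescaled time `μ^{1/α} t`; the prefactors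
  -- are those for which the powers of `μ` cancel.
  have hτ : 0 < μ ^ (1 / α) * t := by positivity
  have hτα : (μ ^ (1 / α) * t) ^ (α - 2) = μ ^ ((α - 2) / α) * t ^ (α - 2) := by
    rw [Real.mul_rpow (by positivity) ht.le, ← Real.rpow_mul hμ.le]
    congr 2; ring
  have hq : ∀ (a b c : ℝ), |μ ^ a * (μ ^ b * mlKernel α c 1 (μ ^ (1 / α) * t))| =
      μ ^ (a + b) * |mlKernel α c 1 (μ ^ (1 / α) * t)| := by
    intro a b c
    rw [← mul_assoc, ← Real.rpow_add hμ, abs_mul, abs_of_pos (by positivity)]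
  have ht2 : 0 ≤ t ^ (α - 2) := by positivity
  obtain ⟨ha1, ha2⟩ := h₁ _ hτ
  have hb1 := (h₂ _ hτ).1
  rw [hτα] at ha1 hb1
  refine ⟨?_, ?_, ?_, ?_, ?_⟩
  · rw [mlKernel_scale hα1.le hμ ht.le, sub_self, neg_zero, zero_div, Real.rpow_zero, one_mul]
    linarith [h₄ _ hτ]
  · rw [mlKernel_scale hα1.le hμ ht.le, hq, show 1 / α + -(2 - 1) / α = 0 by field_simp; ring,
      Real.rpow_zero, one_mul]
    linarith [h₃ _ hτ]
  · rw [mlKernel_scale hα1.le hμ ht.le, hq,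
      show 1 / α + -(α - 1) / α = -((α - 2) / α) by field_simp; ring]
    have h5 : μ ^ (-((α - 2) / α)) * |mlKernel α α 1 (μ ^ (1 / α) * t)| ≤
        μ ^ (-((α - 2) / α)) * (C₁ * (μ ^ ((α - 2) / α) * t ^ (α - 2))) := by gcongr
    have h6 : μ ^ (-((α - 2) / α)) * (C₁ * (μ ^ ((α - 2) / α) * t ^ (α - 2))) =
        C₁ * t ^ (α - 2) := by
      have : μ ^ (-((α - 2) / α)) * μ ^ ((α - 2) / α) = 1 := by
        rw [← Real.rpow_add hμ, neg_add_cancel, Real.rpow_zero]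
      linear_combination C₁ * t ^ (α - 2) * this
    nlinarith
  · rw [mlKernel_scale hα1.le hμ ht.le, hq, show 1 - 1 / α + -(α - 1) / α = 0 by field_simp; ring,
      Real.rpow_zero, one_mul]
    -- Small rescaled times use the exponent `α - 1 ≥ 0`, large ones the exponent `α - 2 ≤ 0`.
    have h7 : |mlKernel α α 1 (μ ^ (1 / α) * t)| ≤ C₁ := by
      rcases le_total (μ ^ (1 / α) * t) 1 with h | h
      · have := Real.rpow_le_one hτ.le h (show 0 ≤ α - 1 by linarith)
        nlinarith
      · have := Real.rpow_le_one_of_one_le_of_nonpos h (show α - 2 ≤ 0 by linarith)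
        rw [hτα] at this
        nlinarith
    linarith
  · rw [mlKernel_scale hα1.le hμ ht.le, abs_mul, abs_of_pos (by positivity),
      show -(α - 1 - 1) / α = -((α - 2) / α) by ring]
    have h5 : μ ^ (-((α - 2) / α)) * |mlKernel α (α - 1) 1 (μ ^ (1 / α) * t)| ≤
        μ ^ (-((α - 2) / α)) * (C₂ * (μ ^ ((α - 2) / α) * t ^ (α - 2))) := by gcongr
    have h6 : μ ^ (-((α - 2) / α)) * (C₂ * (μ ^ ((α - 2) / α) * t ^ (α - 2))) =
        C₂ * t ^ (α - 2) := by
      have : μ ^ (-((α - 2) / α)) * μ ^ ((α - 2) / α) = 1 := by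
        rw [← Real.rpow_add hμ, neg_add_cancel, Real.rpow_zero]
      linear_combination C₂ * t ^ (α - 2) * this
    nlinarith

end LaplaceMittagLeffler

/-! ### Convolution with weakly singular operator families. -/

/-- The convolution `∫₀ᵗ K(s) F(t - s) ds` of an operator family with a function. -/
def opConv {H : Type*} [NormedAddCommGroup H] [NormedSpace ℝ H] (K : ℝ → H →L[ℝ] H) (F : ℝ → H)
    (t : ℝ) : H :=
  ∫ s in (0 : ℝ)..t, K s (F (t - s))

/-- A strongly continuous family of operators on `(0, ∞)` with norm at most `C s ^ (κ - 1)`. -/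
structure IsWeaklySingular {H : Type*} [NormedAddCommGroup H] [NormedSpace ℝ H]
    (K : ℝ → H →L[ℝ] H) (C κ : ℝ) : Prop where
  nonneg : 0 ≤ C
  pos : 0 < κ
  cont : ∀ x, ContinuousOn (fun s => K s x) (Ioi 0)
  bound : ∀ s, 0 < s → ∀ x, ‖K s x‖ ≤ C * s ^ (κ - 1) * ‖x‖

namespace IsWeaklySingular

variable {H : Type*} [NormedAddCommGroup H] [NormedSpace ℝ H] {K : ℝ → H →L[ℝ] H} {C κ : ℝ}

/-- Strong continuity and local boundedness of the norms give joint continuity: the change in `G` is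
handled by the bound, the change in time by strong continuity. -/
theorem continuousAt_apply (hK : IsWeaklySingular K C κ) {Y : Type*} [TopologicalSpace Y]
    {g : Y → ℝ} {G : Y → H} {y₀ : Y} (hg : ContinuousAt g y₀) (hG : ContinuousAt G y₀)
    (h0 : 0 < g y₀) : ContinuousAt (fun y => K (g y) (G y)) y₀ := by
  have h1 : Tendsto (fun y => K (g y) (G y₀)) (𝓝 y₀) (𝓝 (K (g y₀) (G y₀))) :=
    ((hK.cont (G y₀)).continuousAt (Ioi_mem_nhds h0)).tendsto.comp hg
  have h2 : Tendsto (fun y => K (g y) (G y - G y₀)) (𝓝 y₀) (𝓝 0) := by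
    have h3 : Tendsto (fun y => C * g y ^ (κ - 1) * ‖G y - G y₀‖) (𝓝 y₀)
        (𝓝 (C * g y₀ ^ (κ - 1) * ‖G y₀ - G y₀‖)) :=
      (tendsto_const_nhds.mul (hg.tendsto.rpow_const (Or.inl h0.ne'))).mul
        (hG.tendsto.sub_const _).norm
    rw [sub_self, norm_zero, mul_zero] at h3
    refine squeeze_zero_norm' ?_ h3
    filter_upwards [hg.tendsto.eventually (Ioi_mem_nhds h0)] with y hy
    exact hK.bound _ hy _
  have h4 := h1.add h2
  rw [add_zero] at h4
  refine h4.congr fun y => ?_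
  rw [← map_add, add_sub_cancel]

theorem integrable_bound (hκ : 0 < κ) (c t : ℝ) :
    IntervalIntegrable (fun s : ℝ => c * s ^ (κ - 1)) volume 0 t :=
  (intervalIntegral.intervalIntegrable_rpow' (by linarith)).const_mul c

theorem continuousOn_integrand (hK : IsWeaklySingular K C κ) {F : ℝ → H} {t : ℝ}
    (hF : ContinuousOn F (Icc 0 t)) : ContinuousOn (fun s => K s (F (t - s))) (Ioo 0 t) := by
  intro s hs
  refine ContinuousAt.continuousWithinAt (hK.continuousAt_apply (g := id) continuousAt_id ?_ hs.1)
  have h1 : ContinuousAt F (t - s) :=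
    hF.continuousAt (Icc_mem_nhds (by linarith [hs.2]) (by linarith [hs.1]))
  exact ContinuousAt.comp (f := fun s => t - s) h1 (by fun_prop)

theorem intervalIntegrable (hK : IsWeaklySingular K C κ) {F : ℝ → H} {t : ℝ} (ht : 0 ≤ t)
    (hF : ContinuousOn F (Icc 0 t)) :
    IntervalIntegrable (fun s => K s (F (t - s))) volume 0 t := by
  obtain ⟨M, hM⟩ := isCompact_Icc.exists_bound_of_continuousOn hF
  rw [intervalIntegrable_iff_integrableOn_Ioo_of_le ht]
  have hb := (intervalIntegrable_iff_integrableOn_Ioo_of_le ht).1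
    (integrable_bound hK.pos (C * M) t)
  refine hb.mono' ((hK.continuousOn_integrand hF).aestronglyMeasurable measurableSet_Ioo)
    ((ae_restrict_iff' measurableSet_Ioo).2 (Eventually.of_forall fun s hs => ?_))
  refine (hK.bound s hs.1 _).trans ?_
  have h1 := hM (t - s) ⟨by linarith [hs.2], by linarith [hs.1]⟩
  have h2 : 0 ≤ C * s ^ (κ - 1) := mul_nonneg hK.nonneg (Real.rpow_nonneg hs.1.le _)
  nlinarith

theorem opConv_congr {F G : ℝ → H} {t : ℝ} (ht : 0 ≤ t) (h : EqOn F G (Icc 0 t)) :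
    opConv K F t = opConv K G t := by
  unfold opConv
  refine intervalIntegral.integral_congr fun s hs => ?_
  rw [uIcc_of_le ht] at hs
  rw [h ⟨by linarith [hs.2], by linarith [hs.1]⟩]

theorem norm_opConv_sub_le (hK : IsWeaklySingular K C κ) {F G : ℝ → H} {d : ℝ → ℝ} {t : ℝ}
    (ht : 0 ≤ t) (hF : ContinuousOn F (Icc 0 t)) (hG : ContinuousOn G (Icc 0 t))
    (hd : ContinuousOn d (Icc 0 t)) (h : ∀ s ∈ Icc 0 t, ‖F s - G s‖ ≤ d s) :
    ‖opConv K F t - opConv K G t‖ ≤ ∫ s in (0 : ℝ)..t, C * s ^ (κ - 1) * d (t - s) := by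
  unfold opConv
  rw [← intervalIntegral.integral_sub (hK.intervalIntegrable ht hF) (hK.intervalIntegrable ht hG)]
  refine intervalIntegral.norm_integral_le_of_norm_le ht (Eventually.of_forall fun s hs => ?_) ?_
  · rw [← map_sub]
    refine (hK.bound s hs.1 _).trans (mul_le_mul_of_nonneg_left (h _ ⟨?_, ?_⟩)
      (mul_nonneg hK.nonneg (Real.rpow_nonneg hs.1.le _)))
    · linarith [hs.2]
    · linarith [hs.1]
  · refine (integrable_bound hK.pos C t).mul_continuousOn ?_
    rw [uIcc_of_le ht]
    exact hd.comp (by fun_prop) fun s hs => ⟨by linarith [hs.2], by linarith [hs.1]⟩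

/-- The integrand is cut off at `s = t`, so that the interval of integration is fixed and dominated
convergence applies. At `t = t₀` the integrand is discontinuous in `t` at most for the single value
`s = t₀`. -/
theorem continuousOn_opConv_of_continuous (hK : IsWeaklySingular K C κ) {F : ℝ → H} {M : ℝ}
    (hF : Continuous F) (hM : ∀ t, ‖F t‖ ≤ M) (T : ℝ) : ContinuousOn (opConv K F) (Icc 0 T) := by
  set Φ : ℝ → ℝ → H := fun t => (Iio t).indicator fun s => K s (F (t - s)) with hΦ
  have hev : ∀ t ∈ Icc 0 T, opConv K F t = ∫ s in Ioo 0 (T + 1), Φ t s := by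
    intro t ht
    rw [opConv, intervalIntegral.integral_of_le ht.1, ← restrict_Ioo_eq_restrict_Ioc,
      setIntegral_indicator measurableSet_Iio]
    congr 2
    ext s
    simp only [mem_Ioo, mem_inter_iff, mem_Iio]
    constructor
    · exact fun h => ⟨⟨h.1, by linarith [ht.2]⟩, h.2⟩
    · exact fun h => ⟨h.1.1, h.2⟩
  have hcont : Continuous fun t => ∫ s in Ioo 0 (T + 1), Φ t s := by
    rw [continuous_iff_continuousAt]
    intro t₀
    have hM0 : 0 ≤ M := (norm_nonneg _).trans (hM 0)
    refine continuousAt_of_dominated (bound := fun s => C * M * s ^ (κ - 1)) ?_ ?_ ?_ ?_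
    · refine Eventually.of_forall fun t => ?_
      refine AEStronglyMeasurable.indicator ?_ measurableSet_Iio
      refine ContinuousOn.aestronglyMeasurable (fun s hs => ?_) measurableSet_Ioo
      exact (hK.continuousAt_apply (g := id) continuousAt_id
        (by fun_prop : ContinuousAt (fun s => F (t - s)) s) hs.1).continuousWithinAt
    · refine Eventually.of_forall fun t => (ae_restrict_iff' measurableSet_Ioo).2
        (Eventually.of_forall fun s hs => ?_)
      have h1 : 0 ≤ C * s ^ (κ - 1) := mul_nonneg hK.nonneg (Real.rpow_nonneg hs.1.le _)
      refine (norm_indicator_le_norm_self _ _).trans ((hK.bound s hs.1 _).trans ?_)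
      nlinarith [hM (t - s)]
    · rcases le_or_gt 0 (T + 1) with h | h
      · exact (intervalIntegrable_iff_integrableOn_Ioo_of_le h).1 (integrable_bound hK.pos (C * M) _)
      · rw [Ioo_eq_empty (by linarith)]; simp
    · have h1 : ∀ᵐ s ∂(volume : Measure ℝ), s ≠ t₀ := Measure.ae_ne volume t₀
      filter_upwards [ae_restrict_of_ae h1, ae_restrict_mem measurableSet_Ioo] with s hs hs0
      rcases lt_or_gt_of_ne hs with h | h
      · have h2 : ContinuousAt (fun t => K s (F (t - s))) t₀ := by fun_prop
        refine h2.congr ?_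
        filter_upwards [Ioi_mem_nhds h] with t ht
        exact (indicator_of_mem (show s ∈ Iio t from ht) (fun s => K s (F (t - s)))).symm
      · refine (continuousAt_const (y := (0 : H))).congr ?_
        filter_upwards [Iio_mem_nhds h] with t ht
        exact (indicator_of_notMem (show s ∉ Iio t from fun h' => lt_asymm (show s < t from h')
          (show t < s from ht))
          (fun s => K s (F (t - s)))).symm
  exact hcont.continuousOn.congr hev

theorem continuousOn_opConv (hK : IsWeaklySingular K C κ) {F : ℝ → H} {T : ℝ}
    (hF : ContinuousOn F (Icc 0 T)) : ContinuousOn (opConv K F) (Icc 0 T) := by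
  rcases lt_or_ge T 0 with h | h
  · rw [Icc_eq_empty (by linarith)]; exact continuousOn_empty _
  obtain ⟨M, hM⟩ := isCompact_Icc.exists_bound_of_continuousOn hF
  have hE : Continuous (IccExtend h ((Icc 0 T).domRestrict F)) :=
    (continuousOn_iff_continuous_domRestrict.1 hF).Icc_extend'
  refine (hK.continuousOn_opConv_of_continuous (F := IccExtend h ((Icc 0 T).domRestrict F)) (M := M) hE
    (fun t => hM _ (projIcc 0 T h t).2) T).congr fun t ht => ?_
  refine opConv_congr ht.1 fun s hs => ?_
  rw [IccExtend_of_mem h _ ⟨hs.1, hs.2.trans ht.2⟩, domRestrict_apply]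

end IsWeaklySingular

/-! ### Nonlinear Volterra equations. -/

section Volterra

variable {H : Type*} [NormedAddCommGroup H] [NormedSpace ℝ H] {K : ℝ → H →L[ℝ] H} {C κ : ℝ}

/-- `z` is a continuous solution of `z = z₀ + K * N(z)` on `[0, T]`. -/
def IsVolterraSol (K : ℝ → H →L[ℝ] H) (N : H → H) (z₀ : ℝ → H) (T : ℝ) (z : ℝ → H) : Prop :=
  ContinuousOn z (Icc 0 T) ∧ ∀ t ∈ Icc 0 T, z t = z₀ t + opConv K (fun s => N (z s)) t

/-- Up to constants, the weighted integral is a truncated Laplace transform of `s^{κ-1}`, and the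
whole transform tends to `0` like `k^{-κ}`. So a large `k` gives a contraction on intervals of any
length. -/
theorem exists_exp_weight (hκ : 0 < κ) (hC : 0 ≤ C) {L : ℝ} (hL : 0 ≤ L) :
    ∃ k : ℝ, ∀ t, 0 ≤ t → ∫ s in (0 : ℝ)..t, C * s ^ (κ - 1) * (L * Real.exp (k * (t - s))) ≤
      1 / 2 * Real.exp (k * t) := by
  have hG := Real.Gamma_pos_of_pos hκ
  have hlim : Tendsto (fun k : ℝ => C * L * Real.Gamma κ * k ^ (-κ)) atTop (𝓝 0) := by
    simpa using (tendsto_rpow_neg_atTop hκ).const_mul (C * L * Real.Gamma κ)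
  obtain ⟨k, hk0, hk⟩ := ((eventually_gt_atTop 0).and
    (hlim.eventually (Iio_mem_nhds (show (0 : ℝ) < 1 / 2 by norm_num)))).exists
  refine ⟨k, fun t ht => ?_⟩
  have h1 : ∀ s, C * s ^ (κ - 1) * (L * Real.exp (k * (t - s))) =
      Real.exp (k * t) * (C * L * Real.Gamma κ) * (Real.exp (-(k * s)) * fracKernel κ s) := by
    intro s
    rw [fracKernel, show k * (t - s) = k * t + -(k * s) by ring, Real.exp_add]
    field_simp
  have h2 : ∫ s in (0 : ℝ)..t, Real.exp (-(k * s)) * fracKernel κ s ≤ k ^ (-κ) := by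
    have h3 := laplace_fracKernel_real hκ hk0
    rw [one_div, Real.inv_rpow hk0.le, ← Real.rpow_neg hk0.le] at h3
    rw [intervalIntegral.integral_of_le ht, ← h3]
    refine setIntegral_mono_set (integrableOn_laplace_fracKernel_real hκ hk0) ?_
      Ioc_subset_Ioi_self.eventuallyLE
    exact (ae_restrict_iff' measurableSet_Ioi).2 (Eventually.of_forall fun s hs =>
      mul_nonneg (Real.exp_pos _).le (fracKernel_nonneg hκ (le_of_lt hs)))
  simp_rw [h1]
  rw [intervalIntegral.integral_const_mul]
  have h4 : 0 ≤ C * L * Real.Gamma κ := by positivity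
  have h5 := Real.exp_pos (k * t)
  have h6 : C * L * Real.Gamma κ * (∫ s in (0 : ℝ)..t, Real.exp (-(k * s)) * fracKernel κ s) ≤
      1 / 2 := (mul_le_mul_of_nonneg_left h2 h4).trans hk.le
  nlinarith

/-- Volterra equations with a Lipschitz nonlinearity are uniquely solvable. -/
theorem IsWeaklySingular.existsUnique_of_lipschitz [CompleteSpace H] (hK : IsWeaklySingular K C κ) {N : H → H} {L : ℝ}
    (hL : 0 ≤ L) (hN : ∀ x y, ‖N x - N y‖ ≤ L * ‖x - y‖) {z₀ : ℝ → H} {T : ℝ} (hT : 0 ≤ T)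
    (hz₀ : ContinuousOn z₀ (Icc 0 T)) :
    (∃ z, IsVolterraSol K N z₀ T z) ∧
      ∀ z w, IsVolterraSol K N z₀ T z → IsVolterraSol K N z₀ T w → EqOn z w (Icc 0 T) := by
  obtain ⟨k, hk⟩ := exists_exp_weight hK.pos hK.nonneg hL
  have hNc : Continuous N := by
    refine (LipschitzWith.of_dist_le_mul (K := ⟨L, hL⟩) fun x y => ?_).continuous
    rw [dist_eq_norm, dist_eq_norm]; exact hN x y
  -- The unknown is `e^{-kt} z`, so that the sup norm on it is the exponentially weighted norm of
  -- `z`.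
  set ext : C(Icc 0 T, H) → ℝ → H := fun w t => Real.exp (k * t) • IccExtend hT w t with hext
  have hextc : ∀ w, Continuous (ext w) := fun w =>
    (by fun_prop : Continuous fun t => Real.exp (k * t)).smul w.continuous.Icc_extend'
  have hextN : ∀ w S, ContinuousOn (fun s => N (ext w s)) S := fun w S =>
    (hNc.comp (hextc w)).continuousOn
  set Φ : C(Icc 0 T, H) → C(Icc 0 T, H) := fun w =>
    ⟨(Icc 0 T).domRestrict fun t => Real.exp (-(k * t)) • (z₀ t + opConv K (fun s => N (ext w s)) t),
      continuousOn_iff_continuous_domRestrict.1 (ContinuousOn.smul (by fun_prop)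
        (hz₀.add (hK.continuousOn_opConv (hextN w _))))⟩ with hΦ
  have hΦa : ∀ w t (ht : t ∈ Icc 0 T), Φ w ⟨t, ht⟩ =
      Real.exp (-(k * t)) • (z₀ t + opConv K (fun s => N (ext w s)) t) := fun _ _ _ => rfl
  have hcontr : ContractingWith (1 / 2) Φ := by
    refine ⟨by norm_num [← NNReal.coe_lt_coe], LipschitzWith.of_dist_le_mul fun w v => ?_⟩
    rw [ContinuousMap.dist_le (by positivity)]
    rintro ⟨t, ht⟩
    have h1 : ‖opConv K (fun s => N (ext w s)) t - opConv K (fun s => N (ext v s)) t‖ ≤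
        ∫ s in (0 : ℝ)..t, C * s ^ (κ - 1) * (dist w v * (L * Real.exp (k * (t - s)))) := by
      refine hK.norm_opConv_sub_le (d := fun s => dist w v * (L * Real.exp (k * s))) ht.1
        (hextN w _) (hextN v _) (by fun_prop) fun s hs => (hN _ _).trans ?_
      have h2 : ‖ext w s - ext v s‖ ≤ Real.exp (k * s) * dist w v := by
        simp only [hext]
        rw [← smul_sub, norm_smul, Real.norm_of_nonneg (Real.exp_pos _).le, ← dist_eq_norm]
        exact mul_le_mul_of_nonneg_left (ContinuousMap.dist_apply_le_dist _) (Real.exp_pos _).le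
      calc _ ≤ L * (Real.exp (k * s) * dist w v) := mul_le_mul_of_nonneg_left h2 hL
        _ = _ := by ring
    have h3 : ∫ s in (0 : ℝ)..t, C * s ^ (κ - 1) * (dist w v * (L * Real.exp (k * (t - s)))) =
        dist w v * ∫ s in (0 : ℝ)..t, C * s ^ (κ - 1) * (L * Real.exp (k * (t - s))) := by
      rw [← intervalIntegral.integral_const_mul]
      congr 1; funext s; ring
    have h4 := mul_le_mul_of_nonneg_left (hk t ht.1) (dist_nonneg (x := w) (y := v))
    rw [dist_eq_norm]
    rw [hΦa, hΦa, ← smul_sub, add_sub_add_left_eq_sub, norm_smul, Real.norm_of_nonneg (Real.exp_pos _).le]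
    have h5 : Real.exp (-(k * t)) * Real.exp (k * t) = 1 := by
      rw [← Real.exp_add, neg_add_cancel, Real.exp_zero]
    calc _ ≤ Real.exp (-(k * t)) * (dist w v * (1 / 2 * Real.exp (k * t))) :=
          mul_le_mul_of_nonneg_left (h1.trans (h3.le.trans h4)) (Real.exp_pos _).le
      _ = (1 / 2 : ℝ) * dist w v := by linear_combination (dist w v / 2) * h5
      _ = _ := by simp
  have hfix : ∀ z (hz : IsVolterraSol K N z₀ T z), ∃ w : C(Icc 0 T, H),
      Function.IsFixedPt Φ w ∧ ∀ t (ht : t ∈ Icc 0 T), w ⟨t, ht⟩ = Real.exp (-(k * t)) • z t := by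
    intro z hz
    set w : C(Icc 0 T, H) := ⟨(Icc 0 T).domRestrict fun t => Real.exp (-(k * t)) • z t,
      continuousOn_iff_continuous_domRestrict.1 (ContinuousOn.smul (by fun_prop) hz.1)⟩
    have hw : ∀ t (ht : t ∈ Icc 0 T), w ⟨t, ht⟩ = Real.exp (-(k * t)) • z t := fun _ _ => rfl
    refine ⟨w, ?_, hw⟩
    ext ⟨t, ht⟩
    rw [hΦa, hw, hz.2 t ht]
    congr 2
    refine IsWeaklySingular.opConv_congr ht.1 fun s hs => ?_
    have hs' : s ∈ Icc 0 T := ⟨hs.1, hs.2.trans ht.2⟩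
    simp only [hext]
    rw [IccExtend_of_mem hT _ hs', hw, smul_smul, ← Real.exp_add, add_neg_cancel, Real.exp_zero, one_smul]
  refine ⟨?_, fun z w hz hw t ht => ?_⟩
  · set w := ContractingWith.fixedPoint Φ hcontr with hw
    refine ⟨ext w, (hextc w).continuousOn, fun t ht => ?_⟩
    have h1 : w ⟨t, ht⟩ = (Φ w) ⟨t, ht⟩ := by
      rw [hw, (hcontr.fixedPoint_isFixedPt).eq]
    rw [hΦa] at h1
    have h2 : ext w t = Real.exp (k * t) • w ⟨t, ht⟩ := by
      simp only [hext]
      rw [IccExtend_of_mem hT _ ht]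
    rw [h2, h1, smul_smul, ← Real.exp_add, add_neg_cancel, Real.exp_zero, one_smul]
  · obtain ⟨a, ha, ha'⟩ := hfix z hz
    obtain ⟨b, hb, hb'⟩ := hfix w hw
    have hab : a = b := hcontr.fixedPoint_unique' ha hb
    have h1 := ha' t ht
    rw [hab, hb' t ht] at h1
    exact (smul_right_injective H (Real.exp_pos _).ne' h1).symm

/-- The radial retraction onto the ball of radius `R`. -/
def radialRetraction (R : ℝ) (x : H) : H := (R / max R ‖x‖) • x

theorem radialRetraction_of_norm_le {R : ℝ} (hR : 0 < R) {x : H} (hx : ‖x‖ ≤ R) :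
    radialRetraction R x = x := by
  rw [radialRetraction, max_eq_left hx, div_self hR.ne', one_smul]

theorem norm_radialRetraction_le {R : ℝ} (hR : 0 < R) (x : H) : ‖radialRetraction R x‖ ≤ R := by
  have h1 : 0 < max R ‖x‖ := lt_max_of_lt_left hR
  rw [radialRetraction, norm_smul, Real.norm_of_nonneg (by positivity), div_mul_eq_mul_div,
    div_le_iff₀ h1]
  exact mul_le_mul_of_nonneg_left (le_max_right _ _) hR.le

theorem norm_radialRetraction_sub_le {R : ℝ} (hR : 0 < R) (x y : H) :
    ‖radialRetraction R x - radialRetraction R y‖ ≤ 2 * ‖x - y‖ := by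
  have hx : 0 < max R ‖x‖ := lt_max_of_lt_left hR
  have hy : 0 < max R ‖y‖ := lt_max_of_lt_left hR
  have h1 : radialRetraction R x - radialRetraction R y =
      (R / max R ‖x‖) • (x - y) + (R / max R ‖x‖ - R / max R ‖y‖) • y := by
    unfold radialRetraction
    rw [smul_sub, sub_smul]; abel
  have h2 : R / max R ‖x‖ ≤ 1 := (div_le_one hx).2 (le_max_left _ _)
  have h3 : |max R ‖y‖ - max R ‖x‖| ≤ ‖x - y‖ := by
    have := abs_max_sub_max_le_abs ‖y‖ ‖x‖ R
    rw [max_comm R, max_comm R]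
    exact this.trans ((abs_norm_sub_norm_le y x).trans_eq (norm_sub_rev _ _))
  have h4 : ‖(R / max R ‖x‖ - R / max R ‖y‖) • y‖ ≤ ‖x - y‖ := by
    have h5 : R / max R ‖x‖ - R / max R ‖y‖ =
        (R / max R ‖x‖) * ((max R ‖y‖ - max R ‖x‖) / max R ‖y‖) := by field_simp
    have h6 : ‖y‖ / max R ‖y‖ ≤ 1 := (div_le_one hy).2 (le_max_right _ _)
    rw [norm_smul, h5, norm_mul, norm_div (max R ‖y‖ - max R ‖x‖), Real.norm_of_nonneg hy.le,
      Real.norm_of_nonneg (by positivity), Real.norm_eq_abs]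
    calc _ = (R / max R ‖x‖) * (|max R ‖y‖ - max R ‖x‖| * (‖y‖ / max R ‖y‖)) := by ring
      _ ≤ 1 * (‖x - y‖ * 1) := by gcongr
      _ = ‖x - y‖ := by ring
  rw [h1]
  refine (norm_add_le _ _).trans ?_
  rw [norm_smul, Real.norm_of_nonneg (by positivity)]
  nlinarith [norm_nonneg (x - y)]

/-- Lipschitz continuity on bounded sets. -/
def IsLocallyLipschitz {G : Type*} [NormedAddCommGroup G] (N : G → G) : Prop :=
  ∀ R : ℝ, ∃ L : ℝ, 0 ≤ L ∧ ∀ z w, ‖z‖ ≤ R → ‖w‖ ≤ R → ‖N z - N w‖ ≤ L * ‖z - w‖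

theorem IsLocallyLipschitz.comp_radialRetraction {N : H → H} (hN : IsLocallyLipschitz N) {R : ℝ}
    (hR : 0 < R) : ∃ L : ℝ, 0 ≤ L ∧ ∀ z w,
      ‖N (radialRetraction R z) - N (radialRetraction R w)‖ ≤ L * ‖z - w‖ := by
  obtain ⟨L, hL, h⟩ := hN R
  refine ⟨L * 2, by positivity, fun z w => (h _ _ (norm_radialRetraction_le hR z)
    (norm_radialRetraction_le hR w)).trans ?_⟩
  rw [mul_assoc]
  exact mul_le_mul_of_nonneg_left (norm_radialRetraction_sub_le hR z w) hL

theorem IsLocallyLipschitz.continuous {G : Type*} [NormedAddCommGroup G] {N : G → G}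
    (hN : IsLocallyLipschitz N) : Continuous N := by
  rw [continuous_iff_continuousAt]
  intro x
  obtain ⟨L, hL, h⟩ := hN (‖x‖ + 1)
  have h1 : ContinuousOn N (Metric.ball 0 (‖x‖ + 1)) :=
    (LipschitzOnWith.of_dist_le_mul (K := ⟨L, hL⟩) fun z hz w hw => by
      rw [dist_eq_norm, dist_eq_norm]
      exact h z w (mem_ball_zero_iff.1 hz).le (mem_ball_zero_iff.1 hw).le).continuousOn
  exact h1.continuousAt (Metric.isOpen_ball.mem_nhds (by simp))

/-- A function that stays in the ball does not see the truncation of `N`. -/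
theorem IsVolterraSol.of_norm_le {N : H → H} {z₀ z : ℝ → H} {T R : ℝ} (hR : 0 < R)
    (hb : ∀ t ∈ Icc 0 T, ‖z t‖ ≤ R) :
    IsVolterraSol K (fun x => N (radialRetraction R x)) z₀ T z ↔ IsVolterraSol K N z₀ T z := by
  refine and_congr_right fun _ => forall₂_congr fun t ht => ?_
  have h : opConv K (fun s => N (radialRetraction R (z s))) t = opConv K (fun s => N (z s)) t :=
    IsWeaklySingular.opConv_congr ht.1 fun s hs => by
      rw [radialRetraction_of_norm_le hR (hb s ⟨hs.1, hs.2.trans ht.2⟩)]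
  rw [h]

theorem IsVolterraSol.exists_norm_lt {N : H → H} {z₀ z : ℝ → H} {T : ℝ}
    (hz : IsVolterraSol K N z₀ T z) : ∃ R, 0 < R ∧ ∀ t ∈ Icc 0 T, ‖z t‖ < R := by
  obtain ⟨M, hM⟩ := isCompact_Icc.exists_bound_of_continuousOn hz.1
  refine ⟨max M 0 + 1, by positivity, fun t ht => ?_⟩
  linarith [hM t ht, le_max_left M 0]

/-- Both solutions are bounded, hence solve one and the same truncated equation. -/
theorem IsWeaklySingular.volterra_unique [CompleteSpace H] (hK : IsWeaklySingular K C κ) {N : H → H}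
    (hN : IsLocallyLipschitz N) {z₀ z w : ℝ → H} {T : ℝ} (hT : 0 ≤ T)
    (hz₀ : ContinuousOn z₀ (Icc 0 T)) (hz : IsVolterraSol K N z₀ T z)
    (hw : IsVolterraSol K N z₀ T w) : EqOn z w (Icc 0 T) := by
  obtain ⟨R₁, hR₁, h₁⟩ := hz.exists_norm_lt
  obtain ⟨R₂, hR₂, h₂⟩ := hw.exists_norm_lt
  have hR : 0 < R₁ + R₂ := by linarith
  obtain ⟨L, hL, h⟩ := hN.comp_radialRetraction hR
  refine (hK.existsUnique_of_lipschitz hL h hT hz₀).2 z w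
    ((IsVolterraSol.of_norm_le hR fun t ht => ?_).2 hz)
    ((IsVolterraSol.of_norm_le hR fun t ht => ?_).2 hw)
  · linarith [h₁ t ht]
  · linarith [h₂ t ht]

/-- Because the equation has memory, it is solved again from time `0` rather than restarted at `T`.
The truncated equation has a solution on `[0, T + 1]`; it agrees with `z` up to `T` by uniqueness,
and by continuity it stays in the ball for a short time after `T`. -/
theorem IsWeaklySingular.volterra_extend [CompleteSpace H] (hK : IsWeaklySingular K C κ) {N : H → H}
    (hN : IsLocallyLipschitz N) {z₀ z : ℝ → H} {T : ℝ} (hT : 0 ≤ T)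
    (hz₀ : ContinuousOn z₀ (Icc 0 (T + 1))) (hz : IsVolterraSol K N z₀ T z) :
    ∃ τ > 0, ∃ Z, EqOn Z z (Icc 0 T) ∧ IsVolterraSol K N z₀ (T + τ) Z := by
  obtain ⟨R, hR, h₁⟩ := hz.exists_norm_lt
  obtain ⟨L, hL, h⟩ := hN.comp_radialRetraction hR
  have hsub : Icc 0 T ⊆ Icc 0 (T + 1) := Icc_subset_Icc_right (by linarith)
  obtain ⟨Z, hZ⟩ := (hK.existsUnique_of_lipschitz hL h (by linarith : 0 ≤ T + 1) hz₀).1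
  have hmono : ∀ S ≤ T + 1, IsVolterraSol K (fun x => N (radialRetraction R x)) z₀ S Z :=
    fun S hS => ⟨hZ.1.mono (Icc_subset_Icc_right hS), fun t ht => hZ.2 t ⟨ht.1, ht.2.trans hS⟩⟩
  have hEq : EqOn Z z (Icc 0 T) :=
    (hK.existsUnique_of_lipschitz hL h hT (hz₀.mono hsub)).2 Z z (hmono T (by linarith))
      ((IsVolterraSol.of_norm_le hR fun t ht => (h₁ t ht).le).2 hz)
  have hTm : T ∈ Icc 0 (T + 1) := ⟨hT, by linarith⟩
  have hnhds : {t | ‖Z t‖ < R} ∈ 𝓝[Icc 0 (T + 1)] T := by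
    refine (hZ.1 T hTm).norm (Iio_mem_nhds ?_)
    change ‖Z T‖ < R
    rw [hEq (right_mem_Icc.2 hT)]
    exact h₁ T (right_mem_Icc.2 hT)
  obtain ⟨ε, hε, hball⟩ := Metric.mem_nhdsWithin_iff.1 hnhds
  have hτ : 0 < min (ε / 2) 1 := by positivity
  refine ⟨min (ε / 2) 1, hτ, Z, hEq, (IsVolterraSol.of_norm_le hR fun t ht => ?_).1
    (hmono _ (by linarith [min_le_right (ε / 2) 1]))⟩
  rcases le_or_gt t T with htT | htT
  · rw [hEq ⟨ht.1, htT⟩]; exact (h₁ t ⟨ht.1, htT⟩).le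
  · refine le_of_lt (hball ⟨?_, ht.1, by linarith [ht.2, min_le_right (ε / 2) 1]⟩)
    rw [Metric.mem_ball, Real.dist_eq, abs_of_pos (by linarith)]
    linarith [ht.2, min_le_left (ε / 2) 1]

end Volterra

/-! ### The propagators of the linear equation. -/

namespace HilbertBasis

variable {ι H : Type*} [NormedAddCommGroup H] [InnerProductSpace ℝ H] {b : HilbertBasis ι ℝ H}
  {a : ℝ → ι → ℝ} {C κ : ℝ}

/-- As `κ ≤ 1`, the bound is non-increasing in `s`, hence uniform on `[s/2, ∞)`; strong continuity
then follows from `continuousOn_diag`. -/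
theorem isWeaklySingular_diag (hC : 0 ≤ C) (hκ : 0 < κ) (hκ1 : κ ≤ 1)
    (hb : ∀ s, 0 < s → ∀ i, |a s i| ≤ C * s ^ (κ - 1))
    (hc : ∀ i, ContinuousOn (fun s => a s i) (Ioi 0)) :
    IsWeaklySingular (fun s => b.diag (a s)) C κ where
  nonneg := hC
  pos := hκ
  bound s hs x := norm_diag_apply_le (mul_nonneg hC (Real.rpow_nonneg hs.le _)) (hb s hs) x
  cont x := by
    intro s hs
    have hs : 0 < s := hs
    have hs2 : 0 < s / 2 := by positivity
    have h1 : ContinuousOn (fun s => b.diag (a s) x) (Ici (s / 2)) := by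
      refine continuousOn_diag (K := C * (s / 2) ^ (κ - 1)) (fun t ht i => ?_)
        (fun i => (hc i).mono fun t ht => hs2.trans_le ht) x
      refine (hb t (hs2.trans_le ht) i).trans (mul_le_mul_of_nonneg_left ?_ hC)
      exact Real.rpow_le_rpow_of_nonpos hs2 ht (by linarith)
    exact (h1.continuousAt (Ici_mem_nhds (by linarith))).continuousWithinAt

theorem repr_opConv_diag [CompleteSpace H] (hK : IsWeaklySingular (fun s => b.diag (a s)) C κ)
    (hb : ∀ s, 0 < s → ∀ i, |a s i| ≤ C * s ^ (κ - 1)) {F : ℝ → H} {t : ℝ} (ht : 0 ≤ t)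
    (hF : ContinuousOn F (Icc 0 t)) (i : ι) :
    b.repr (opConv (fun s => b.diag (a s)) F t) i =
      halfConv (fun s => a s i) (fun s => b.repr (F s) i) t := by
  have h1 := (innerSL ℝ (b i)).intervalIntegral_comp_comm (hK.intervalIntegrable ht hF)
  simp only [innerSL_apply_apply] at h1
  rw [b.repr_apply_apply, opConv, ← h1, halfConv_comm, halfConv, intervalIntegral.integral_of_le ht, intervalIntegral.integral_of_le ht]
  refine setIntegral_congr_fun measurableSet_Ioc fun s hs => ?_
  simp only
  rw [← b.repr_apply_apply, repr_diag (hb s hs.1), mul_comm]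

end HilbertBasis

namespace DirichletForm

variable {X : Type u} [MeasurableSpace X] {m : Measure X} {E : DirichletForm m} {ι : Type*}

theorem incl_injective (s : ℝ) : Function.Injective (E.incl s) := Subtype.val_injective

namespace EigenBasis

variable (B : E.EigenBasis ι)

theorem continuousOn_coord {F : ℝ → Lp ℝ 2 m} {S : Set ℝ} (hF : ContinuousOn F S) (i : ι) :
    ContinuousOn (fun t => B.coord (F t) i) S := by
  simp_rw [coord_eq_inner]
  exact continuousOn_const.inner hF

theorem summable_negPow {s : ℝ} (hs : 0 ≤ s) (z : Lp ℝ 2 m) :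
    HasSum (fun i => (B.ev i ^ s * B.coord (B.negPow s z) i) ^ 2) (‖z‖ ^ 2) := by
  refine (B.hasSum_coord_sq z).congr_fun fun i => ?_
  rw [B.coord_negPow hs, ← mul_assoc, ← Real.rpow_add (B.ev_pos i), add_neg_cancel,
    Real.rpow_zero, one_mul]

theorem exists_incl_eq_negPow {s : ℝ} (hs : 0 ≤ s) (z : Lp ℝ 2 m) :
    ∃ v : E.V s, E.incl s v = B.negPow s z :=
  B.exists_V (B.summable_negPow hs z).summable

/-- The isometry `A^{-s}` of `L²` onto `V_s`. -/
def toV {s : ℝ} (hs : 0 ≤ s) : Lp ℝ 2 m →ₗᵢ[ℝ] E.V s where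
  toFun z := (B.exists_incl_eq_negPow hs z).choose
  map_add' x y := incl_injective s ((B.exists_incl_eq_negPow hs _).choose_spec.trans (by
    rw [map_add, map_add, (B.exists_incl_eq_negPow hs x).choose_spec,
      (B.exists_incl_eq_negPow hs y).choose_spec]))
  map_smul' c x := incl_injective s ((B.exists_incl_eq_negPow hs _).choose_spec.trans (by
    rw [map_smul, map_smul, (B.exists_incl_eq_negPow hs x).choose_spec, RingHom.id_apply]))
  norm_map' z := by
    have h1 := B.hasSum_norm_V_sq s (B.exists_incl_eq_negPow hs z).choose
    rw [(B.exists_incl_eq_negPow hs z).choose_spec] at h1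
    have h2 := h1.unique (B.summable_negPow hs z)
    exact (pow_left_inj₀ (norm_nonneg _) (norm_nonneg _) two_ne_zero).1 h2

theorem incl_toV {s : ℝ} (hs : 0 ≤ s) (z : Lp ℝ 2 m) :
    E.incl s (B.toV hs z) = B.negPow s z :=
  (B.exists_incl_eq_negPow hs z).choose_spec

theorem exists_coord_ofV {s : ℝ} (v : E.V s) :
    ∃ z : Lp ℝ 2 m, ∀ i, B.coord z i = B.ev i ^ s * B.coord (E.incl s v) i :=
  B.basis.exists_repr_eq (B.hasSum_norm_V_sq s v).summable

/-- The isometry `A^s` of `V_s` into `L²`. -/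
def ofV (s : ℝ) : E.V s →ₗᵢ[ℝ] Lp ℝ 2 m where
  toFun v := (B.exists_coord_ofV v).choose
  map_add' x y := B.coord_ext fun i => by
    rw [coord_add, (B.exists_coord_ofV _).choose_spec, (B.exists_coord_ofV _).choose_spec,
      (B.exists_coord_ofV _).choose_spec, map_add, coord_add, mul_add]
  map_smul' c x := B.coord_ext fun i => by
    rw [RingHom.id_apply, coord_smul, (B.exists_coord_ofV _).choose_spec,
      (B.exists_coord_ofV _).choose_spec, map_smul, coord_smul, mul_left_comm]
  norm_map' v := by
    have h1 := B.hasSum_norm_V_sq s v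
    have h2 := (B.hasSum_coord_sq (B.exists_coord_ofV v).choose)
    simp_rw [(B.exists_coord_ofV v).choose_spec] at h2
    exact (pow_left_inj₀ (norm_nonneg _) (norm_nonneg _) two_ne_zero).1 (h2.unique h1)

theorem coord_ofV {s : ℝ} (v : E.V s) (i : ι) :
    B.coord (B.ofV s v) i = B.ev i ^ s * B.coord (E.incl s v) i :=
  (B.exists_coord_ofV v).choose_spec i

theorem negPow_ofV {s : ℝ} (hs : 0 ≤ s) (v : E.V s) : B.negPow s (B.ofV s v) = E.incl s v := by
  refine B.coord_ext fun i => ?_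
  rw [B.coord_negPow hs, B.coord_ofV, ← mul_assoc, ← Real.rpow_add (B.ev_pos i), neg_add_cancel,
    Real.rpow_zero, one_mul]

theorem toV_ofV {s : ℝ} (hs : 0 ≤ s) (v : E.V s) : B.toV hs (B.ofV s v) = v :=
  incl_injective s (by rw [incl_toV, negPow_ofV B hs])

theorem ev_rpow_one_sub_two_mul (s : ℝ) (i : ι) :
    B.ev i ^ (-(2 * s - 1)) = B.ev i * (B.ev i ^ (-s) * B.ev i ^ (-s)) := by
  rw [← Real.rpow_add (B.ev_pos i), mul_comm (B.ev i), ← Real.rpow_add_one (B.ev_pos i).ne']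
  congr 1; ring

theorem negPow_mem_dom {s : ℝ} (hs : 1 / 2 ≤ s) (z : Lp ℝ 2 m) : B.negPow s z ∈ E.dom := by
  have hs0 : 0 ≤ s := by linarith
  have h2 : 0 ≤ 2 * s - 1 := by linarith
  refine B.mem_dom_of_summable ?_
  refine (B.hasSum_coord_mul z (B.negPow (2 * s - 1) z)).summable.congr fun i => ?_
  rw [B.coord_negPow hs0, B.coord_negPow h2]
  rw [B.ev_rpow_one_sub_two_mul]; ring

/-- Serves to express the form term of the variational identity through `z = A^{1/α} u`. -/
theorem form_negPow {s : ℝ} (hs : 1 / 2 ≤ s) (z w : Lp ℝ 2 m) :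
    E.form ⟨B.negPow s z, B.negPow_mem_dom hs z⟩ ⟨B.negPow s w, B.negPow_mem_dom hs w⟩ =
      inner ℝ (B.negPow (2 * s - 1) z) w := by
  have hs0 : 0 ≤ s := by linarith
  have h2 : 0 ≤ 2 * s - 1 := by linarith
  refine (B.hasSum_form _ _).unique ((B.hasSum_coord_mul _ w).congr_fun fun i => ?_)
  rw [B.coord_negPow h2, B.ev_rpow_one_sub_two_mul]
  simp only
  rw [B.coord_negPow hs0, B.coord_negPow hs0]
  ring

section Propagators

variable {α : ℝ}

/-- `A^{1/α} t^{α-1} E_{α,α}(-A t^α)`. -/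
def convKernel (α : ℝ) (s : ℝ) : Lp ℝ 2 m →L[ℝ] Lp ℝ 2 m :=
  B.basis.diag fun i => B.ev i ^ (1 / α) * mlKernel α α (B.ev i) s

/-- `t^{α-2} E_{α,α-1}(-A t^α)`. -/
def convKernelDeriv (α : ℝ) (s : ℝ) : Lp ℝ 2 m →L[ℝ] Lp ℝ 2 m :=
  B.basis.diag fun i => mlKernel α (α - 1) (B.ev i) s

/-- `A^{1/α}` applied to the solution of the homogeneous equation with data `A^{-1/α} z₀`, `u₁`. -/
def freeSol (α : ℝ) (z₀ u₁ : Lp ℝ 2 m) (t : ℝ) : Lp ℝ 2 m :=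
  B.basis.diag (fun i => mlKernel α 1 (B.ev i) t) z₀ +
    B.basis.diag (fun i => B.ev i ^ (1 / α) * mlKernel α 2 (B.ev i) t) u₁

/-- The derivative of the solution of the homogeneous equation with data `A^{-1/α} z₀`, `u₁`. -/
def freeDeriv (α : ℝ) (z₀ u₁ : Lp ℝ 2 m) (t : ℝ) : Lp ℝ 2 m :=
  B.basis.diag (fun i => -(B.ev i ^ (1 - 1 / α) * mlKernel α α (B.ev i) t)) z₀ +
    B.basis.diag (fun i => mlKernel α 1 (B.ev i) t) u₁

theorem exists_propagator_bounds (hα1 : 1 < α) (hα2 : α < 2) : ∃ C : ℝ, 0 ≤ C ∧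
    (∀ t, 0 ≤ t → ∀ i, |mlKernel α 1 (B.ev i) t| ≤ C) ∧
    (∀ t, 0 ≤ t → ∀ i, |B.ev i ^ (1 / α) * mlKernel α 2 (B.ev i) t| ≤ C) ∧
    (∀ t, 0 ≤ t → ∀ i, |-(B.ev i ^ (1 - 1 / α) * mlKernel α α (B.ev i) t)| ≤ C) ∧
    (∀ t, 0 < t → ∀ i, |B.ev i ^ (1 / α) * mlKernel α α (B.ev i) t| ≤ C * t ^ (α - 1 - 1)) ∧
    (∀ t, 0 < t → ∀ i, |mlKernel α (α - 1) (B.ev i) t| ≤ C * t ^ (α - 1 - 1)) := by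
  obtain ⟨C, hC, h⟩ := exists_mlKernel_bounds hα1 hα2
  -- The extra `1` covers `t = 0`, where the first kernel equals `1` and the next two vanish.
  refine ⟨C + 1, by linarith, fun t ht i => ?_, fun t ht i => ?_, fun t ht i => ?_,
    fun t ht i => ?_, fun t ht i => ?_⟩
  · rcases ht.eq_or_lt with rfl | ht
    · rw [mlKernel_one_zero hα1.le, abs_one]; linarith
    · linarith [(h _ t (B.ev_pos i) ht).1]
  · rcases ht.eq_or_lt with rfl | ht
    · rw [mlKernel_zero_of_one_lt one_lt_two, mul_zero, abs_zero]; linarith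
    · linarith [(h _ t (B.ev_pos i) ht).2.1]
  · rcases ht.eq_or_lt with rfl | ht
    · rw [mlKernel_zero_of_one_lt hα1, mul_zero, neg_zero, abs_zero]; linarith
    · rw [abs_neg]; linarith [(h _ t (B.ev_pos i) ht).2.2.2.1]
  · have h1 := (h _ t (B.ev_pos i) ht).2.2.1
    have h2 := Real.rpow_nonneg ht.le (α - 2)
    rw [show α - 1 - 1 = α - 2 by ring]
    nlinarith
  · have h1 := (h _ t (B.ev_pos i) ht).2.2.2.2
    have h2 := Real.rpow_nonneg ht.le (α - 2)
    rw [show α - 1 - 1 = α - 2 by ring]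
    nlinarith

theorem isWeaklySingular_convKernel (hα1 : 1 < α) (hα2 : α < 2) :
    ∃ C, IsWeaklySingular (B.convKernel α) C (α - 1) := by
  obtain ⟨C, hC, -, -, -, h, -⟩ := B.exists_propagator_bounds hα1 hα2
  exact ⟨C, HilbertBasis.isWeaklySingular_diag hC (by linarith) (by linarith) h fun i =>
    continuousOn_const.mul (continuousOn_mlKernel hα1.le (by linarith) _)⟩

theorem isWeaklySingular_convKernelDeriv (hα1 : 1 < α) (hα2 : α < 2) :
    ∃ C, IsWeaklySingular (B.convKernelDeriv α) C (α - 1) := by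
  obtain ⟨C, hC, -, -, -, -, h⟩ := B.exists_propagator_bounds hα1 hα2
  exact ⟨C, HilbertBasis.isWeaklySingular_diag hC (by linarith) (by linarith) h fun i =>
    continuousOn_mlKernel hα1.le (by linarith) _⟩

theorem coord_opConv_convKernel (hα1 : 1 < α) (hα2 : α < 2) {F : ℝ → Lp ℝ 2 m} {t : ℝ}
    (ht : 0 ≤ t) (hF : ContinuousOn F (Icc 0 t)) (i : ι) :
    B.coord (opConv (B.convKernel α) F t) i =
      B.ev i ^ (1 / α) * halfConv (mlKernel α α (B.ev i)) (fun s => B.coord (F s) i) t := by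
  obtain ⟨C, hC, -, -, -, h, -⟩ := B.exists_propagator_bounds hα1 hα2
  have hK := HilbertBasis.isWeaklySingular_diag (b := B.basis) hC (by linarith) (by linarith) h
    fun i => continuousOn_const.mul (continuousOn_mlKernel hα1.le (by linarith) _)
  refine (HilbertBasis.repr_opConv_diag hK h ht hF i).trans ?_
  rw [halfConv_comm, halfConv_const_mul_right, halfConv_comm]
  rfl

theorem coord_opConv_convKernelDeriv (hα1 : 1 < α) (hα2 : α < 2) {F : ℝ → Lp ℝ 2 m} {t : ℝ}
    (ht : 0 ≤ t) (hF : ContinuousOn F (Icc 0 t)) (i : ι) :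
    B.coord (opConv (B.convKernelDeriv α) F t) i =
      halfConv (mlKernel α (α - 1) (B.ev i)) (fun s => B.coord (F s) i) t := by
  obtain ⟨C, hC, -, -, -, -, h⟩ := B.exists_propagator_bounds hα1 hα2
  have hK := HilbertBasis.isWeaklySingular_diag (b := B.basis) hC (by linarith) (by linarith) h
    fun i => continuousOn_mlKernel hα1.le (by linarith) _
  exact HilbertBasis.repr_opConv_diag hK h ht hF i

theorem coord_freeSol (hα1 : 1 < α) (hα2 : α < 2) (z₀ u₁ : Lp ℝ 2 m) {t : ℝ} (ht : 0 ≤ t) (i : ι) :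
    B.coord (B.freeSol α z₀ u₁ t) i = mlKernel α 1 (B.ev i) t * B.coord z₀ i +
      B.ev i ^ (1 / α) * mlKernel α 2 (B.ev i) t * B.coord u₁ i := by
  obtain ⟨C, hC, h1, h2, -, -, -⟩ := B.exists_propagator_bounds hα1 hα2
  rw [freeSol, coord_add]
  congr 1
  · exact HilbertBasis.repr_diag (h1 t ht) z₀ i
  · exact HilbertBasis.repr_diag (h2 t ht) u₁ i

theorem coord_freeDeriv (hα1 : 1 < α) (hα2 : α < 2) (z₀ u₁ : Lp ℝ 2 m) {t : ℝ} (ht : 0 ≤ t)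
    (i : ι) :
    B.coord (B.freeDeriv α z₀ u₁ t) i =
      -(B.ev i ^ (1 - 1 / α) * mlKernel α α (B.ev i) t) * B.coord z₀ i +
      mlKernel α 1 (B.ev i) t * B.coord u₁ i := by
  obtain ⟨C, hC, h1, -, h2, -, -⟩ := B.exists_propagator_bounds hα1 hα2
  rw [freeDeriv, coord_add]
  congr 1
  · exact HilbertBasis.repr_diag (h2 t ht) z₀ i
  · exact HilbertBasis.repr_diag (h1 t ht) u₁ i

theorem continuousOn_freeSol (hα1 : 1 < α) (hα2 : α < 2) (z₀ u₁ : Lp ℝ 2 m) :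
    ContinuousOn (B.freeSol α z₀ u₁) (Ici 0) := by
  obtain ⟨C, hC, h1, h2, -, -, -⟩ := B.exists_propagator_bounds hα1 hα2
  refine (HilbertBasis.continuousOn_diag h1 (fun i => ?_) z₀).add
    (HilbertBasis.continuousOn_diag h2 (fun i => ?_) u₁)
  · exact (continuous_mlKernel hα1.le le_rfl _).continuousOn
  · exact (continuous_const.mul (continuous_mlKernel hα1.le one_le_two _)).continuousOn

theorem continuousOn_freeDeriv (hα1 : 1 < α) (hα2 : α < 2) (z₀ u₁ : Lp ℝ 2 m) :
    ContinuousOn (B.freeDeriv α z₀ u₁) (Ici 0) := by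
  obtain ⟨C, hC, h1, -, h2, -, -⟩ := B.exists_propagator_bounds hα1 hα2
  refine (HilbertBasis.continuousOn_diag h2 (fun i => ?_) z₀).add
    (HilbertBasis.continuousOn_diag h1 (fun i => ?_) u₁)
  · exact (continuous_const.mul (continuous_mlKernel hα1.le hα1.le _)).neg.continuousOn
  · exact (continuous_mlKernel hα1.le le_rfl _).continuousOn

theorem freeSol_zero (hα1 : 1 < α) (hα2 : α < 2) (z₀ u₁ : Lp ℝ 2 m) :
    B.freeSol α z₀ u₁ 0 = z₀ := by
  refine B.coord_ext fun i => ?_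
  rw [B.coord_freeSol hα1 hα2 z₀ u₁ le_rfl, mlKernel_one_zero hα1.le,
    mlKernel_zero_of_one_lt one_lt_two]
  ring

theorem freeDeriv_zero (hα1 : 1 < α) (hα2 : α < 2) (z₀ u₁ : Lp ℝ 2 m) :
    B.freeDeriv α z₀ u₁ 0 = u₁ := by
  refine B.coord_ext fun i => ?_
  rw [B.coord_freeDeriv hα1 hα2 z₀ u₁ le_rfl, mlKernel_one_zero hα1.le,
    mlKernel_zero_of_one_lt hα1]
  ring

/-- The Volterra equation, coordinate by coordinate. -/
theorem isVolterraSol_iff (hα1 : 1 < α) (hα2 : α < 2) {N : Lp ℝ 2 m → Lp ℝ 2 m}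
    (hN : Continuous N) (z₀ u₁ : Lp ℝ 2 m) {z : ℝ → Lp ℝ 2 m} {T : ℝ}
    (hz : ContinuousOn z (Icc 0 T)) :
    IsVolterraSol (B.convKernel α) N (B.freeSol α z₀ u₁) T z ↔ ∀ t ∈ Icc 0 T, ∀ i,
      B.coord (B.negPow (1 / α) (z t)) i = modeSol α (B.ev i) (B.coord (B.negPow (1 / α) z₀) i)
        (B.coord u₁ i) (fun s => B.coord (N (z s)) i) t := by
  have hγ : 0 ≤ 1 / α := by have : 0 < α := by linarith
                            positivity
  have hF : ContinuousOn (fun s => N (z s)) (Icc 0 T) := hN.comp_continuousOn hz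
  refine ⟨fun h t ht i => ?_, fun h => ⟨hz, fun t ht => B.coord_ext fun i => ?_⟩⟩ <;>
  · have hFt := hF.mono (Icc_subset_Icc_right ht.2)
    have h3 : B.ev i ^ (-(1 / α)) * B.ev i ^ (1 / α) = 1 := by
      rw [← Real.rpow_add (B.ev_pos i), neg_add_cancel, Real.rpow_zero]
    have h1 := B.coord_opConv_convKernel hα1 hα2 ht.1 hFt i
    have h2 := B.coord_freeSol hα1 hα2 z₀ u₁ ht.1 i
    -- One alternative for each direction. The two sides differ by the factor `ev^{1/α}`, which `h3`
    -- inverts.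
    first
    | rw [h.2 t ht, B.coord_negPow hγ, B.coord_negPow hγ, coord_add, h1, h2, modeSol]
      linear_combination (mlKernel α 2 (B.ev i) t * B.coord u₁ i +
        halfConv (mlKernel α α (B.ev i)) (fun s => B.coord (N (z s)) i) t) * h3
    | have h4 := h t ht i
      rw [B.coord_negPow hγ, B.coord_negPow hγ, modeSol] at h4
      rw [coord_add, h1, h2]
      linear_combination B.ev i ^ (1 / α) * h4 +
        (mlKernel α 1 (B.ev i) t * B.coord z₀ i - B.coord (z t) i) * h3

end Propagators

end EigenBasis

end DirichletForm

/-! ### From weak solutions to the Volterra equation. -/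

theorem continuousOn_halfConv {k b : ℝ → ℝ} {C κ T : ℝ} (hC : 0 ≤ C) (hκ : 0 < κ)
    (hk : ContinuousOn k (Ioi 0)) (hkb : ∀ s, 0 < s → |k s| ≤ C * s ^ (κ - 1))
    (hb : ContinuousOn b (Icc 0 T)) : ContinuousOn (halfConv k b) (Icc 0 T) := by
  have hK : IsWeaklySingular (fun s => k s • ContinuousLinearMap.id ℝ ℝ) C κ :=
    { nonneg := hC
      pos := hκ
      cont := fun x => by
        simp only [smul_apply, smul_eq_mul]
        exact hk.mul continuousOn_const
      bound := fun s hs x => by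
        rw [smul_apply, ContinuousLinearMap.id_apply, norm_smul]
        exact mul_le_mul_of_nonneg_right (hkb s hs) (norm_nonneg _) }
  refine (hK.continuousOn_opConv hb).congr fun t _ => ?_
  rw [halfConv_comm, halfConv, opConv]
  refine intervalIntegral.integral_congr fun s _ => ?_
  simp [mul_comm]

theorem continuousOn_halfConv_fracKernel {a T : ℝ} (ha : 0 < a) {b : ℝ → ℝ}
    (hb : ContinuousOn b (Icc 0 T)) : ContinuousOn (halfConv (fracKernel a) b) (Icc 0 T) := by
  have hG := Real.Gamma_pos_of_pos ha
  refine continuousOn_halfConv (C := (Real.Gamma a)⁻¹) (inv_nonneg.2 hG.le) ha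
    (continuousOn_fracKernel a) (fun s hs => ?_) hb
  rw [abs_of_nonneg (fracKernel_nonneg ha hs.le), fracKernel, div_eq_inv_mul]

theorem continuousOn_halfConv_mlKernel {α μ T : ℝ} (hα1 : 1 < α) (hα2 : α < 2) (hμ : 0 < μ)
    {b : ℝ → ℝ} (hb : ContinuousOn b (Icc 0 T)) :
    ContinuousOn (halfConv (mlKernel α α μ) b) (Icc 0 T) := by
  obtain ⟨C, hC, h⟩ := exists_mlKernel_bounds hα1 hα2
  refine continuousOn_halfConv (C := (μ ^ (1 / α))⁻¹ * C) (κ := α - 1) (by positivity) (by linarith)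
    (continuousOn_mlKernel hα1.le (by linarith) μ) (fun s hs => ?_) hb
  have h1 := (h μ s hμ hs).2.2.1
  have h2 : 0 < μ ^ (1 / α) := by positivity
  rw [abs_mul, abs_of_pos h2] at h1
  rw [mul_assoc, ← div_eq_inv_mul, le_div_iff₀ h2, mul_comm, show α - 1 - 1 = α - 2 by ring]
  exact h1

theorem abs_halfConv_fracKernel_le {a b c t : ℝ} (ha : 0 < a) (hb : 0 < b) (ht : 0 < t)
    {y : ℝ → ℝ} (hy : ∀ s ∈ Ioc 0 t, |y s| ≤ c * fracKernel b s) :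
    |halfConv (fracKernel a) y t| ≤ c * fracKernel (a + b) t := by
  have hii : IntervalIntegrable (fun s => c * (fracKernel a (t - s) * fracKernel b s))
      volume 0 t := by
    refine IntervalIntegrable.const_mul ?_ _
    by_contra hn
    have h1 := halfConv_fracKernel ha hb ht
    rw [halfConv, intervalIntegral.integral_undef hn] at h1
    have h2 : 0 < fracKernel (a + b) t :=
      div_pos (Real.rpow_pos_of_pos ht _) (Real.Gamma_pos_of_pos (by linarith))
    linarith
  have h1 := intervalIntegral.norm_integral_le_of_norm_le (f := fun s => fracKernel a (t - s) * y s)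
    ht.le (Eventually.of_forall fun s hs => ?_) hii
  · rw [intervalIntegral.integral_const_mul] at h1
    rw [← halfConv_fracKernel ha hb ht]
    exact h1
  · have h2 := fracKernel_nonneg ha (sub_nonneg.2 hs.2)
    rw [norm_mul, Real.norm_of_nonneg h2]
    calc _ ≤ fracKernel a (t - s) * (c * fracKernel b s) := mul_le_mul_of_nonneg_left (hy s hs) h2
      _ = _ := by ring

/-- If `k_{2-a} * y` has a second weak derivative `G` and `y` vanishes to first order at `0`, then
`k_{2-a} * y = k_2 * G`. -/
theorem halfConv_eq_of_hasWeakDerivOn {a T : ℝ} (ha2 : a < 2) (hT : 0 < T)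
    {y g d G : ℝ → ℝ} (hG : ContinuousOn G (Icc 0 T))
    (hy : ∀ᶠ s in 𝓝[>] 0, |y s| ≤ s)
    (hw : HasWeakDerivOn T (halfConv (fracKernel (2 - a)) y) g) (hg : HasWeakDerivOn T g d)
    (hd : ∀ᵐ t ∂(volume.restrict (Ioo (0 : ℝ) T)), d t = G t) :
    ∀ t ∈ Icc 0 T, halfConv (fracKernel (2 - a)) y t = halfConv (fracKernel 2) G t := by
  have hg1 : ∀ t ∈ Icc 0 T, g t = g 0 + ∫ s in (0 : ℝ)..t, G s := by
    intro t ht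
    rw [hg.2 t ht]
    congr 1
    rw [intervalIntegral.integral_of_le ht.1, intervalIntegral.integral_of_le ht.1,
      ← restrict_Ioo_eq_restrict_Ioc]
    exact integral_congr_ae (ae_restrict_of_ae_restrict_of_subset (Ioo_subset_Ioo_right ht.2) hd)
  have hprim : ContinuousOn (fun t => ∫ s in (0 : ℝ)..t, G s) (Icc 0 T) := by
    have h2 : IntegrableOn G (uIcc 0 T) := by
      rw [uIcc_of_le hT.le]; exact hG.integrableOn_Icc
    have := intervalIntegral.continuousOn_primitive_interval (a := 0) (b := T) h2
    rwa [uIcc_of_le hT.le] at this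
  have hw1 : ∀ t ∈ Icc 0 T, halfConv (fracKernel (2 - a)) y t =
      t * g 0 + halfConv (fracKernel 2) G t := by
    intro t ht
    have hsub : Icc 0 t ⊆ Icc 0 T := Icc_subset_Icc_right ht.2
    rw [hw.2 t ht, halfConv_zero_right, zero_add, halfConv_two_left ht.1 (hG.mono hsub)]
    have h1 : ∫ s in (0 : ℝ)..t, g s = ∫ s in (0 : ℝ)..t, (g 0 + ∫ r in (0 : ℝ)..s, G r) := by
      refine intervalIntegral.integral_congr fun s hs => ?_
      rw [uIcc_of_le ht.1] at hs
      exact hg1 s (hsub hs)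
    rw [h1, intervalIntegral.integral_add intervalIntegrable_const, intervalIntegral.integral_const,
      sub_zero, smul_eq_mul]
    refine ContinuousOn.intervalIntegrable ?_
    rw [uIcc_of_le ht.1]
    exact hprim.mono hsub
  obtain ⟨M, hM⟩ := isCompact_Icc.exists_bound_of_continuousOn hG
  obtain ⟨δ, hδ, hδy⟩ := mem_nhdsGT_iff_exists_Ioc_subset.1 hy
  have hδ : 0 < δ := hδ
  -- The two convolutions are `O(t^{3-a})` and `O(t²)`, both `o(t)` since `a < 2`. So the linear
  -- term `t g(0)` vanishes.
  have hg0 : g 0 = 0 := by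
    have hlim : Tendsto (fun t : ℝ => t ^ (2 - a) * (Real.Gamma (4 - a))⁻¹ +
        M * (t * (Real.Gamma 3)⁻¹)) (𝓝[>] 0) (𝓝 0) := by
      have h1 : Tendsto (fun t : ℝ => t ^ (2 - a) * (Real.Gamma (4 - a))⁻¹ +
          M * (t * (Real.Gamma 3)⁻¹)) (𝓝 0) (𝓝 ((0 : ℝ) ^ (2 - a) * (Real.Gamma (4 - a))⁻¹ +
          M * (0 * (Real.Gamma 3)⁻¹))) := by
        refine Continuous.tendsto ?_ 0
        exact ((Real.continuous_rpow_const (by linarith)).mul continuous_const).add (by fun_prop)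
      rw [Real.zero_rpow (by linarith), zero_mul, zero_mul, mul_zero, add_zero] at h1
      exact h1.mono_left nhdsWithin_le_nhds
    refine abs_nonpos_iff.1 (ge_of_tendsto hlim ?_)
    filter_upwards [Ioc_mem_nhdsGT (lt_min hδ hT)] with t ht
    have htT : t ∈ Icc 0 T := ⟨ht.1.le, ht.2.trans (min_le_right _ _)⟩
    have h1 := abs_halfConv_fracKernel_le (a := 2 - a) (b := 2) (c := 1) (by linarith) two_pos ht.1
      (y := y) fun s hs => by
        rw [fracKernel_two, one_mul]
        exact hδy ⟨hs.1, hs.2.trans (ht.2.trans (min_le_left _ _))⟩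
    have h2 := abs_halfConv_fracKernel_le (a := 2) (b := 1) (c := M) two_pos one_pos ht.1
      (y := G) fun s hs => by
        rw [fracKernel_one, mul_one]
        exact hM s ⟨hs.1.le, hs.2.trans htT.2⟩
    have h3 : t * |g 0| ≤ 1 * fracKernel (2 - a + 2) t + M * fracKernel (2 + 1) t := by
      rw [← abs_of_pos ht.1, ← abs_mul, abs_of_pos ht.1, eq_sub_of_add_eq (hw1 t htT).symm]
      exact (abs_sub _ _).trans (add_le_add h1 h2)
    have h4 : 1 * fracKernel (2 - a + 2) t + M * fracKernel (2 + 1) t =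
        t * (t ^ (2 - a) * (Real.Gamma (4 - a))⁻¹ + M * (t * (Real.Gamma 3)⁻¹)) := by
      have ht0 : t ≠ 0 := ht.1.ne'
      unfold fracKernel
      rw [show 2 - a + 2 - 1 = (2 - a) + 1 by ring, Real.rpow_add_one ht0,
        show (2 : ℝ) + 1 - 1 = ((2 : ℕ) : ℝ) by norm_num, Real.rpow_natCast,
        show 2 - a + 2 = 4 - a by ring, show (2 : ℝ) + 1 = 3 by norm_num]
      ring
    rw [h4] at h3
    exact le_of_mul_le_mul_left h3 ht.1
  intro t ht
  rw [hw1 t ht, hg0, mul_zero, zero_add]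

namespace DirichletForm

variable {X : Type u} [MeasurableSpace X] {m : Measure X} {E : DirichletForm m} {ι : Type*}

namespace EigenBasis

variable (B : E.EigenBasis ι)

theorem exists_incl_eq_basis {s : ℝ} (hs : 0 ≤ s) (i : ι) : ∃ φ : E.V s, E.incl s φ = B.basis i := by
  refine ⟨B.toV hs (B.ev i ^ s • B.basis i), ?_⟩
  rw [incl_toV, map_smul]
  refine B.coord_ext fun j => ?_
  rw [coord_smul, B.coord_negPow hs]
  rcases eq_or_ne i j with rfl | h
  · rw [coord_basis_self, mul_one, ← Real.rpow_add (B.ev_pos i), add_neg_cancel, Real.rpow_zero]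
  · rw [B.coord_basis_of_ne h, mul_zero, mul_zero]

theorem coord_caputoIntegral {α : ℝ} (hα2 : α < 2) {u du : ℝ → Lp ℝ 2 m} {t : ℝ}
    (ht : 0 ≤ t) (hu : ContinuousOn u (Icc 0 t)) (i : ι) :
    B.coord (caputoIntegral α u du t) i = halfConv (fracKernel (2 - α))
      (fun s => B.coord (u s) i - B.coord (u 0) i - s * B.coord (du 0) i) t := by
  have hint : IntervalIntegrable (fun s => (t - s) ^ (1 - α) • (u s - u 0 - s • du 0))
      volume 0 t := by
    have h1 : IntervalIntegrable (fun s : ℝ => (t - s) ^ (1 - α)) volume 0 t := by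
      have := ((intervalIntegral.intervalIntegrable_rpow' (a := 0) (b := t)
        (show -1 < 1 - α by linarith)).comp_sub_left t).symm
      simpa using this
    refine h1.smul_continuousOn ?_
    rw [uIcc_of_le ht]
    exact (hu.sub continuousOn_const).sub (by fun_prop)
  have h1 := (innerSL ℝ (B.basis i)).intervalIntegral_comp_comm hint
  simp only [innerSL_apply_apply] at h1
  rw [caputoIntegral, coord_smul, coord_eq_inner, ← h1, halfConv,
    ← intervalIntegral.integral_const_mul]
  refine intervalIntegral.integral_congr fun s _ => ?_
  rw [inner_smul_right, ← coord_eq_inner, coord_sub, coord_sub, coord_smul, fracKernel,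
    show 2 - α - 1 = 1 - α by ring]
  ring

/-- A weak solution satisfies the Volterra equation. -/
theorem isVolterraSol_of_isWeakSolWith {α T : ℝ} (hα1 : 1 < α) (hα2 : α < 2) {f : ℝ → ℝ}
    {N : Lp ℝ 2 m → Lp ℝ 2 m} (hN : Continuous N)
    (hNf : ∀ z, (N z : X → ℝ) =ᵐ[m] fun x => f (B.negPow (1 / α) z x)) {u₀ : E.V (1 / α)}
    {u₁ : Lp ℝ 2 m} {u : ℝ → E.V (1 / α)} {du : ℝ → Lp ℝ 2 m}
    {D : ℝ → StrongDual ℝ (E.V (1 / α))} (h : IsWeakSolWith E α f u₀ u₁ T u du D) :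
    IsVolterraSol (B.convKernel α) N (B.freeSol α (B.ofV _ u₀) u₁) T (fun t => B.ofV _ (u t)) := by
  have hα0 : 0 < α := by linarith
  have hγ : 0 ≤ 1 / α := by positivity
  have hz : ContinuousOn (fun t => B.ofV (1 / α) (u t)) (Icc 0 T) :=
    (B.ofV _).continuous.comp_continuousOn h.continuousOn
  have hF : ContinuousOn (fun t => N (B.ofV (1 / α) (u t))) (Icc 0 T) := hN.comp_continuousOn hz
  have hu : ContinuousOn (fun t => E.incl _ (u t)) (Icc 0 T) :=
    ((B.negPow (1 / α)).continuous.comp_continuousOn hz).congr fun t _ => (B.negPow_ofV hγ _).symm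
  rw [B.isVolterraSol_iff hα1 hα2 hN _ _ hz]
  intro t ht i
  simp only [B.negPow_ofV hγ]
  set F : ℝ → ℝ := fun s => B.coord (N (B.ofV (1 / α) (u s))) i with hFd
  set x : ℝ → ℝ := fun s => B.coord (E.incl _ (u s)) i with hxd
  have hFc : ContinuousOn F (Icc 0 T) := B.continuousOn_coord hF i
  have hxc : ContinuousOn x (Icc 0 T) := B.continuousOn_coord hu i
  set G : ℝ → ℝ := fun s => F s + (-B.ev i) * x s with hGd
  have hGc : ContinuousOn G (Icc 0 T) := hFc.add (continuousOn_const.mul hxc)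
  set y : ℝ → ℝ := fun s => x s - x 0 - s * B.coord u₁ i with hyd
  have hyc : ContinuousOn y (Icc 0 T) := (hxc.sub continuousOn_const).sub (by fun_prop)
  -- Testing with an eigenvector isolates one coordinate, for which the second weak derivative is `G
  -- = F - λ x`.
  obtain ⟨φ, hφ⟩ := B.exists_incl_eq_basis hγ i
  obtain ⟨g, hw, hg⟩ := h.caputo φ
  have hcap : ∀ t ∈ Icc 0 T, inner ℝ (caputoIntegral α (fun s => E.incl _ (u s)) du t)
      (E.incl _ φ) = halfConv (fracKernel (2 - α)) y t := by
    intro t ht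
    rw [hφ, real_inner_comm, ← coord_eq_inner,
      B.coord_caputoIntegral hα2 ht.1 (hu.mono (Icc_subset_Icc_right ht.2)), h.init_deriv]
  have h0 : (0 : ℝ) ∈ Icc 0 T := left_mem_Icc.2 h.pos.le
  have hw' : HasWeakDerivOn T (halfConv (fracKernel (2 - α)) y) g :=
    ⟨hw.1, fun t ht => by rw [← hcap t ht, ← hcap 0 h0]; exact hw.2 t ht⟩
  have hd : ∀ᵐ s ∂(volume.restrict (Ioo (0 : ℝ) T)), D s φ = G s := by
    filter_upwards [h.variational φ] with s hs
    obtain ⟨a, b, W, ha, hb, hW, hv⟩ := hs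
    have hWN : W = N (B.ofV (1 / α) (u s)) := by
      refine Lp.ext (hW.trans ((hNf _).trans ?_).symm)
      rw [B.negPow_ofV hγ]
    have hb' : b = ⟨B.basis i, B.mem_dom i⟩ := Subtype.ext (hb.trans hφ)
    rw [E.symm, hb', B.form_basis, ha, hφ, real_inner_comm, ← coord_eq_inner, hWN] at hv
    simp only [hGd, hFd, hxd]
    linarith
  -- Differentiability of `u` at `0` with derivative `u₁` gives `y(s) = o(s)`.
  have hy0 : ∀ᶠ s in 𝓝[>] 0, |y s| ≤ s := by
    have h1 : HasDerivWithinAt y 0 (Icc 0 T) 0 := by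
      have h2 := h.hasDeriv 0 h0
      rw [h.init_deriv] at h2
      have h3 : HasDerivWithinAt x (B.coord u₁ i) (Icc 0 T) 0 := by
        have := (innerSL ℝ (B.basis i)).hasFDerivAt.comp_hasDerivWithinAt 0 h2
        simp only [innerSL_apply_apply, ← coord_eq_inner] at this
        exact this.congr (fun s _ => by simp [hxd, coord_eq_inner])
          (by simp [hxd, coord_eq_inner])
      have h4 := (h3.sub_const (x 0)).sub
        ((hasDerivWithinAt_id (0 : ℝ) (Icc 0 T)).mul_const (B.coord u₁ i))
      rw [one_mul, sub_self] at h4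
      exact h4
    have h5 := h1.isLittleO.def one_pos
    have h6 : 𝓝[>] (0 : ℝ) ≤ 𝓝[Icc 0 T] 0 := nhdsWithin_le_iff.2 (Icc_mem_nhdsGT h.pos)
    filter_upwards [h6 h5, self_mem_nhdsWithin] with s hs hs0
    have hs0 : 0 < s := hs0
    simpa [hyd, abs_of_pos hs0] using hs
  have hkey := halfConv_eq_of_hasWeakDerivOn hα2 h.pos hGc hy0 hw' hg hd
  -- Inversion of the fractional derivative: `x - x(0) - t x'(0) = k_α * (F - λ x)`, the scalar
  -- Volterra equation.
  have hyG := eq_halfConv_of_caputo hα0 hα2 h.pos hyc hGc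
    (continuousOn_halfConv_fracKernel hα0 hGc) hkey
  refine eq_modeSol_of_volterra hα1 (B.ev i) _ _ hFc hxc
    (continuousOn_halfConv_mlKernel hα1 hα2 (B.ev_pos i) hFc) (fun t ht => ?_) t ht
  have hsub : Icc 0 t ⊆ Icc 0 T := Icc_subset_Icc_right ht.2
  have h1 := hyG t ht
  rw [hGd, halfConv_add_right (c := fun s => (-B.ev i) * x s) ht.1
    (intervalIntegrable_fracKernel hα0 _ _) (hFc.mono hsub)
    (continuousOn_const.mul (hxc.mono hsub)), halfConv_const_mul_right] at h1
  have h2 : x 0 = B.coord (E.incl _ u₀) i := by simp only [hxd, h.init]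
  simp only [hyd] at h1
  rw [← h2]
  linear_combination h1

end EigenBasis

end DirichletForm

/-! ### From the Volterra equation to weak solutions. -/

theorem continuousOn_halfConv_mlKernel_sub_one {α μ T : ℝ} (hα1 : 1 < α) (hα2 : α < 2) (hμ : 0 < μ)
    {b : ℝ → ℝ} (hb : ContinuousOn b (Icc 0 T)) :
    ContinuousOn (halfConv (mlKernel α (α - 1) μ) b) (Icc 0 T) := by
  obtain ⟨C, hC, h⟩ := exists_mlKernel_bounds hα1 hα2
  refine continuousOn_halfConv (C := C) (κ := α - 1) hC (by linarith)
    (continuousOn_mlKernel hα1.le (by linarith) μ) (fun s hs => ?_) hb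
  rw [show α - 1 - 1 = α - 2 by ring]
  exact (h μ s hμ hs).2.2.2.2

/-- Integration raises the second index by one, and `mlKernel_add` gives the primitive of `-μ E_α`.
The integral form avoids differentiating a kernel that is singular at `0`. -/
theorem modeSol_eq_integral {α μ t : ℝ} (hα1 : 1 < α) (hα2 : α < 2) (hμ : 0 < μ) (a b : ℝ)
    {F : ℝ → ℝ} (ht : 0 ≤ t) (hF : ContinuousOn F (Icc 0 t)) :
    modeSol α μ a b F t = a + ∫ s in (0 : ℝ)..t, ((-μ * a) * mlKernel α α μ s +
      b * mlKernel α 1 μ s + halfConv (mlKernel α (α - 1) μ) F s) := by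
  have hα0 : 0 < α := by linarith
  have hα10 : 0 < α - 1 := by linarith
  rcases ht.eq_or_lt with rfl | ht0
  · rw [intervalIntegral.integral_same, modeSol, halfConv_zero_right, mlKernel_one_zero hα1.le,
      mlKernel_zero_of_one_lt one_lt_two]
    ring
  have hk := intervalIntegrable_fracKernel one_pos 0 t
  have hc1 : ContinuousOn (fun s => (-μ * a) * mlKernel α α μ s) (Icc 0 t) :=
    (continuous_const.mul (continuous_mlKernel hα1.le hα1.le μ)).continuousOn
  have hc2 : ContinuousOn (fun s => b * mlKernel α 1 μ s) (Icc 0 t) :=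
    (continuous_const.mul (continuous_mlKernel hα1.le le_rfl μ)).continuousOn
  have hc3 := continuousOn_halfConv_mlKernel_sub_one hα1 hα2 hμ hF
  rw [← halfConv_one_left, halfConv_add_right
    (b := fun s => (-μ * a) * mlKernel α α μ s + b * mlKernel α 1 μ s) ht hk (hc1.add hc2) hc3,
    halfConv_add_right ht hk hc1 hc2, halfConv_const_mul_right, halfConv_const_mul_right,
    halfConv_fracKernel_mlKernel hα1.le hα0 μ one_pos ht0,
    halfConv_fracKernel_mlKernel hα1.le one_pos μ one_pos ht0,
    halfConv_assoc ht hk (intervalIntegrable_mlKernel hα1.le hα10 μ 0 t) hF]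
  have h1 : halfConv (halfConv (fracKernel 1) (mlKernel α (α - 1) μ)) F t =
      halfConv (mlKernel α α μ) F t := by
    refine halfConv_congr ht (fun s hs => ?_) fun _ _ => rfl
    rw [halfConv_fracKernel_mlKernel hα1.le hα10 μ one_pos hs.1, sub_add_cancel]
  have h2 := mlKernel_add hα1.le one_pos μ ht0
  rw [fracKernel_one, add_comm 1 α] at h2
  rw [h1, modeSol, show (1 : ℝ) + 1 = 2 by norm_num]
  linear_combination a * h2

theorem hasDerivWithinAt_of_eq_integral {H : Type*} [NormedAddCommGroup H] [NormedSpace ℝ H]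
    [CompleteSpace H] {x d : ℝ → H} {c : H} {T : ℝ} (hT : 0 ≤ T) (hd : ContinuousOn d (Icc 0 T))
    (h : ∀ t ∈ Icc 0 T, x t = c + ∫ s in (0 : ℝ)..t, d s) {t : ℝ} (ht : t ∈ Icc 0 T) :
    HasDerivWithinAt x (d t) (Icc 0 T) t := by
  have hE : Continuous (IccExtend hT ((Icc 0 T).domRestrict d)) :=
    (continuousOn_iff_continuous_domRestrict.1 hd).Icc_extend'
  have hEq : EqOn (IccExtend hT ((Icc 0 T).domRestrict d)) d (Icc 0 T) := fun s hs => by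
    rw [IccExtend_of_mem hT _ hs, domRestrict_apply]
  have h1 := ((hE.integral_hasStrictDerivAt 0 t).hasDerivAt.const_add c).hasDerivWithinAt
    (s := Icc 0 T)
  rw [hEq ht] at h1
  have h2 : ∀ s ∈ Icc 0 T, x s = c + ∫ r in (0 : ℝ)..s, IccExtend hT ((Icc 0 T).domRestrict d) r := by
    intro s hs
    rw [h s hs]
    congr 1
    refine intervalIntegral.integral_congr fun r hr => ?_
    rw [uIcc_of_le hs.1] at hr
    exact (hEq ⟨hr.1, hr.2.trans hs.2⟩).symm
  exact h1.congr h2 (h2 t ht)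

namespace DirichletForm

variable {X : Type u} [MeasurableSpace X] {m : Measure X} {E : DirichletForm m} {ι : Type*}

namespace EigenBasis

variable (B : E.EigenBasis ι)

theorem negPow_zero (z : Lp ℝ 2 m) : B.negPow 0 z = z := by
  refine B.coord_ext fun i => ?_
  rw [B.coord_negPow le_rfl, neg_zero, Real.rpow_zero, one_mul]

theorem coord_intervalIntegral {F : ℝ → Lp ℝ 2 m} {t : ℝ} (hF : IntervalIntegrable F volume 0 t)
    (i : ι) : B.coord (∫ s in (0 : ℝ)..t, F s) i = ∫ s in (0 : ℝ)..t, B.coord (F s) i := by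
  have h1 := (innerSL ℝ (B.basis i)).intervalIntegral_comp_comm hF
  simp only [innerSL_apply_apply, ← coord_eq_inner] at h1
  exact h1.symm

section Mild

variable {α T : ℝ} {N : Lp ℝ 2 m → Lp ℝ 2 m} {z₀ u₁ : Lp ℝ 2 m} {z : ℝ → Lp ℝ 2 m}

/-- The time derivative of `A^{-1/α} z`, for a solution `z` of the Volterra equation. -/
def mildDeriv (α : ℝ) (N : Lp ℝ 2 m → Lp ℝ 2 m) (z₀ u₁ : Lp ℝ 2 m) (z : ℝ → Lp ℝ 2 m) (t : ℝ) :
    Lp ℝ 2 m :=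
  B.freeDeriv α z₀ u₁ t + opConv (B.convKernelDeriv α) (fun s => N (z s)) t

theorem mildDeriv_zero (hα1 : 1 < α) (hα2 : α < 2) : B.mildDeriv α N z₀ u₁ z 0 = u₁ := by
  rw [mildDeriv, B.freeDeriv_zero hα1 hα2, opConv, intervalIntegral.integral_same, add_zero]

theorem continuousOn_mildDeriv (hα1 : 1 < α) (hα2 : α < 2)
    (hF : ContinuousOn (fun s => N (z s)) (Icc 0 T)) :
    ContinuousOn (B.mildDeriv α N z₀ u₁ z) (Icc 0 T) := by
  obtain ⟨C, hK⟩ := B.isWeaklySingular_convKernelDeriv hα1 hα2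
  exact ((B.continuousOn_freeDeriv hα1 hα2 z₀ u₁).mono fun t ht => ht.1).add
    (hK.continuousOn_opConv hF)

theorem _root_.IsVolterraSol.apply_zero {H : Type*} [NormedAddCommGroup H] [NormedSpace ℝ H]
    {K : ℝ → H →L[ℝ] H} {N : H → H} {z₀ z : ℝ → H} {T : ℝ} (h : IsVolterraSol K N z₀ T z)
    (hT : 0 ≤ T) : z 0 = z₀ 0 := by
  rw [h.2 0 ⟨le_rfl, hT⟩, opConv, intervalIntegral.integral_same, add_zero]

theorem negPow_eq_integral_mildDeriv (hα1 : 1 < α) (hα2 : α < 2) (hN : Continuous N)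
    (hz : IsVolterraSol (B.convKernel α) N (B.freeSol α z₀ u₁) T z) {t : ℝ} (ht : t ∈ Icc 0 T) :
    B.negPow (1 / α) (z t) =
      B.negPow (1 / α) z₀ + ∫ s in (0 : ℝ)..t, B.mildDeriv α N z₀ u₁ z s := by
  have hγ : 0 ≤ 1 / α := by have : 0 < α := by linarith
                            positivity
  have hF : ContinuousOn (fun s => N (z s)) (Icc 0 T) := hN.comp_continuousOn hz.1
  have hsub : Icc 0 t ⊆ Icc 0 T := Icc_subset_Icc_right ht.2
  have hd : IntervalIntegrable (B.mildDeriv α N z₀ u₁ z) volume 0 t := by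
    refine ContinuousOn.intervalIntegrable ?_
    rw [uIcc_of_le ht.1]
    exact (B.continuousOn_mildDeriv hα1 hα2 hF).mono hsub
  refine B.coord_ext fun i => ?_
  rw [(B.isVolterraSol_iff hα1 hα2 hN z₀ u₁ hz.1).1 hz t ht i, coord_add,
    B.coord_intervalIntegral hd,
    modeSol_eq_integral hα1 hα2 (B.ev_pos i) _ _ ht.1 (B.continuousOn_coord (hF.mono hsub) i)]
  congr 1
  refine intervalIntegral.integral_congr fun s hs => ?_
  rw [uIcc_of_le ht.1] at hs
  rw [mildDeriv, coord_add, B.coord_freeDeriv hα1 hα2 _ _ hs.1,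
    B.coord_opConv_convKernelDeriv hα1 hα2 hs.1
      (hF.mono (Icc_subset_Icc_right (hs.2.trans ht.2))), B.coord_negPow hγ,
    sub_eq_add_neg (1 : ℝ) (1 / α), Real.rpow_add (B.ev_pos i), Real.rpow_one]
  ring

/-- `A^{-1/α}` applied to the fractional derivative of a solution of the Volterra equation. -/
def mildCaputo (α : ℝ) (N : Lp ℝ 2 m → Lp ℝ 2 m) (z : ℝ → Lp ℝ 2 m) (t : ℝ) : Lp ℝ 2 m :=
  B.negPow (1 / α) (N (z t)) - B.negPow (2 * (1 / α) - 1) (z t)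

theorem continuousOn_mildCaputo (hN : Continuous N) (hz : ContinuousOn z (Icc 0 T)) :
    ContinuousOn (B.mildCaputo α N z) (Icc 0 T) :=
  ((B.negPow _).continuous.comp_continuousOn (hN.comp_continuousOn hz)).sub
    ((B.negPow _).continuous.comp_continuousOn hz)

/-- The power `A^{-1/α}` brings the fractional derivative `N(z) - A u`, which lives in `V_{-1/α}`,
back into `L²`. In coordinates, `k_{2-α}` convolved with `k_α * (F - λ x)` is `k_2 * (F - λ x)`. -/
theorem negPow_caputoIntegral (hα1 : 1 < α) (hα2 : α < 2) (hN : Continuous N)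
    (hz : IsVolterraSol (B.convKernel α) N (B.freeSol α z₀ u₁) T z) {t : ℝ} (ht : t ∈ Icc 0 T) :
    B.negPow (1 / α) (caputoIntegral α (fun s => B.negPow (1 / α) (z s))
      (B.mildDeriv α N z₀ u₁ z) t) = ∫ s in (0 : ℝ)..t, (t - s) • B.mildCaputo α N z s := by
  have hα0 : 0 < α := by linarith
  have hγ : 0 ≤ 1 / α := by positivity
  have hγ2 : 0 ≤ 2 * (1 / α) - 1 := by
    rw [sub_nonneg, mul_one_div, one_le_div hα0]; exact hα2.le
  have hF : ContinuousOn (fun s => N (z s)) (Icc 0 T) := hN.comp_continuousOn hz.1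
  have hx : ContinuousOn (fun s => B.negPow (1 / α) (z s)) (Icc 0 T) :=
    (B.negPow _).continuous.comp_continuousOn hz.1
  have hsub : Icc 0 t ⊆ Icc 0 T := Icc_subset_Icc_right ht.2
  have hdc := (B.continuousOn_mildCaputo (α := α) hN hz.1).mono hsub
  have hint : IntervalIntegrable (fun s => (t - s) • B.mildCaputo α N z s) volume 0 t := by
    refine ContinuousOn.intervalIntegrable ?_
    rw [uIcc_of_le ht.1]
    exact (by fun_prop : ContinuousOn (fun s : ℝ => t - s) (Icc 0 t)).smul hdc
  refine B.coord_ext fun i => ?_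
  have hFi := B.continuousOn_coord (hF.mono hsub) i
  have hxi := B.continuousOn_coord (hx.mono hsub) i
  have hG : ContinuousOn (fun s => B.coord (N (z s)) i +
      (-B.ev i) * B.coord (B.negPow (1 / α) (z s)) i) (Icc 0 t) :=
    hFi.add (continuousOn_const.mul hxi)
  have hcoord := (B.isVolterraSol_iff hα1 hα2 hN z₀ u₁ hz.1).1 hz
  have hz0 : z 0 = z₀ := by rw [hz.apply_zero (ht.1.trans ht.2), B.freeSol_zero hα1 hα2]
  have hy : ∀ s ∈ Icc 0 t, B.coord (B.negPow (1 / α) (z s)) i -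
      B.coord (B.negPow (1 / α) (z 0)) i - s * B.coord u₁ i =
      halfConv (fracKernel α) (fun s => B.coord (N (z s)) i +
      (-B.ev i) * B.coord (B.negPow (1 / α) (z s)) i) s := by
    intro s hs
    have hs' : Icc 0 s ⊆ Icc 0 t := Icc_subset_Icc_right hs.2
    have h1 := modeSol_volterra hα1 (B.ev i) (B.coord (B.negPow (1 / α) z₀) i) (B.coord u₁ i)
      hs.1 (hFi.mono hs') (continuousOn_halfConv_mlKernel hα1 hα2 (B.ev_pos i) (hFi.mono hs'))
    have h2 : halfConv (fracKernel α) (modeSol α (B.ev i) (B.coord (B.negPow (1 / α) z₀) i)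
        (B.coord u₁ i) fun s => B.coord (N (z s)) i) s =
        halfConv (fracKernel α) (fun s => B.coord (B.negPow (1 / α) (z s)) i) s :=
      halfConv_congr hs.1 (fun _ _ => rfl) fun r hr =>
        (hcoord r ⟨hr.1.le, (hr.2.le.trans hs.2).trans ht.2⟩ i).symm
    rw [h2, ← hcoord s (hsub hs) i] at h1
    rw [halfConv_add_right (c := fun s => (-B.ev i) * B.coord (B.negPow (1 / α) (z s)) i) hs.1
      (intervalIntegrable_fracKernel hα0 _ _) (hFi.mono hs')
      (continuousOn_const.mul (hxi.mono hs')), halfConv_const_mul_right, hz0]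
    linear_combination h1
  rw [B.coord_negPow hγ, B.coord_caputoIntegral hα2 ht.1 (hx.mono hsub),
    B.mildDeriv_zero hα1 hα2, caputo_of_eq_halfConv hα0 hα2 ht.1 hG hy,
    B.coord_intervalIntegral hint, ← halfConv_const_mul_right, halfConv]
  refine intervalIntegral.integral_congr fun s _ => ?_
  rw [coord_smul, fracKernel_two, mildCaputo, coord_sub, B.coord_negPow hγ, B.coord_negPow hγ,
    B.coord_negPow hγ2, B.ev_rpow_one_sub_two_mul]
  ring

/-- The fractional derivative of a solution of the Volterra equation. -/
def mildDual (α : ℝ) (N : Lp ℝ 2 m → Lp ℝ 2 m) (z : ℝ → Lp ℝ 2 m) (t : ℝ) :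
    StrongDual ℝ (E.V (1 / α)) :=
  -- The pairing of `D` with `φ` is `(A^{-1/α} D, A^{1/α} φ)`.
  (innerSL ℝ (B.mildCaputo α N z t)).comp (B.ofV (1 / α)).toContinuousLinearMap

theorem mildDual_apply (t : ℝ) (φ : E.V (1 / α)) :
    B.mildDual α N z t φ = inner ℝ (B.mildCaputo α N z t) (B.ofV _ φ) := rfl

theorem continuousOn_mildDual (hN : Continuous N) (hz : ContinuousOn z (Icc 0 T)) :
    ContinuousOn (B.mildDual α N z) (Icc 0 T) := by
  have h1 : Continuous fun L : StrongDual ℝ (Lp ℝ 2 m) =>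
      L.comp (B.ofV (1 / α)).toContinuousLinearMap := by fun_prop
  exact h1.comp_continuousOn
    ((innerSL ℝ).continuous.comp_continuousOn (B.continuousOn_mildCaputo hN hz))

/-- Convolution with `k_2` is double integration, so the inner primitive serves as first weak
derivative. -/
theorem isCaputoDeriv_mildDual (hα1 : 1 < α) (hα2 : α < 2) (hN : Continuous N) (hT : 0 ≤ T)
    (hz : IsVolterraSol (B.convKernel α) N (B.freeSol α z₀ u₁) T z) :
    IsCaputoDeriv E α T (fun s => B.negPow (1 / α) (z s)) (B.mildDeriv α N z₀ u₁ z)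
      (B.mildDual α N z) := by
  have hγ : 0 ≤ 1 / α := by have : 0 < α := by linarith
                            positivity
  intro φ
  have hdc := B.continuousOn_mildCaputo (α := α) hN hz.1
  have hD : ContinuousOn (fun s => B.mildDual α N z s φ) (Icc 0 T) :=
    hdc.inner continuousOn_const
  have hDi : ∀ t ∈ Icc 0 T, IntervalIntegrable (fun s => B.mildDual α N z s φ) volume 0 t := by
    intro t ht
    refine ContinuousOn.intervalIntegrable ?_
    rw [uIcc_of_le ht.1]
    exact hD.mono (Icc_subset_Icc_right ht.2)
  refine ⟨fun t => ∫ s in (0 : ℝ)..t, B.mildDual α N z s φ, ⟨?_, ?_⟩, ?_, ?_⟩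
  · refine ContinuousOn.intervalIntegrable ?_
    have h2 : IntegrableOn (fun s => B.mildDual α N z s φ) (uIcc 0 T) := by
      rw [uIcc_of_le hT]; exact hD.integrableOn_Icc
    exact intervalIntegral.continuousOn_primitive_interval (a := 0) (b := T) h2
  · have key : ∀ t ∈ Icc 0 T, inner ℝ (caputoIntegral α (fun s => B.negPow (1 / α) (z s))
        (B.mildDeriv α N z₀ u₁ z) t) (E.incl _ φ) =
        ∫ s in (0 : ℝ)..t, ∫ r in (0 : ℝ)..s, B.mildDual α N z r φ := by
      intro t ht
      have hsub : Icc 0 t ⊆ Icc 0 T := Icc_subset_Icc_right ht.2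
      have hint : IntervalIntegrable (fun s => (t - s) • B.mildCaputo α N z s) volume 0 t := by
        refine ContinuousOn.intervalIntegrable ?_
        rw [uIcc_of_le ht.1]
        exact (by fun_prop : ContinuousOn (fun s : ℝ => t - s) (Icc 0 t)).smul (hdc.mono hsub)
      have h1 := (innerSL ℝ (B.ofV (1 / α) φ)).intervalIntegral_comp_comm hint
      rw [← B.negPow_ofV hγ φ, ← B.inner_negPow_comm hγ, B.negPow_caputoIntegral hα1 hα2 hN hz ht,
        real_inner_comm, ← innerSL_apply_apply ℝ, ← h1, ← halfConv_two_left ht.1 (hD.mono hsub),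
        halfConv]
      refine intervalIntegral.integral_congr fun s _ => ?_
      simp only [innerSL_apply_apply, fracKernel_two]
      rw [inner_smul_right, mildDual_apply, real_inner_comm]
    intro t ht
    simp only
    rw [key t ht, key 0 (left_mem_Icc.2 hT), intervalIntegral.integral_same, zero_add]
  · exact hDi T (right_mem_Icc.2 hT)
  · intro t _
    simp only [intervalIntegral.integral_same, zero_add]

/-- A solution of the Volterra equation gives a weak solution. -/
theorem isWeakSolWith_of_isVolterraSol (hα1 : 1 < α) (hα2 : α < 2) (hγ : 0 ≤ 1 / α) {f : ℝ → ℝ}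
    (hN : Continuous N) (hNf : ∀ z, (N z : X → ℝ) =ᵐ[m] fun x => f (B.negPow (1 / α) z x))
    {u₀ : E.V (1 / α)} (hT : 0 < T)
    (hz : IsVolterraSol (B.convKernel α) N (B.freeSol α (B.ofV _ u₀) u₁) T z) :
    IsWeakSolWith E α f u₀ u₁ T (fun t => B.toV hγ (z t))
      (B.mildDeriv α N (B.ofV _ u₀) u₁ z) (B.mildDual α N z) := by
  have hα0 : 0 < α := by linarith
  have hγ2 : 1 / 2 ≤ 1 / α := one_div_le_one_div_of_le hα0 hα2.le
  have hF : ContinuousOn (fun s => N (z s)) (Icc 0 T) := hN.comp_continuousOn hz.1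
  have hdu := B.continuousOn_mildDeriv (z₀ := B.ofV _ u₀) (u₁ := u₁) hα1 hα2 hF
  have hz0 : z 0 = B.ofV _ u₀ := by rw [hz.apply_zero hT.le, B.freeSol_zero hα1 hα2]
  have hincl : ∀ t, E.incl _ (B.toV hγ (z t)) = B.negPow (1 / α) (z t) := fun t => B.incl_toV hγ _
  have h0 : (0 : ℝ) ∈ Icc 0 T := left_mem_Icc.2 hT.le
  have hle : 𝓝[>] (0 : ℝ) ≤ 𝓝[Icc 0 T] 0 := nhdsWithin_le_iff.2 (Icc_mem_nhdsGT hT)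
  refine ⟨hT, (B.toV hγ).continuous.comp_continuousOn hz.1, fun t ht => ?_, hdu, ?_, ?_,
    B.mildDeriv_zero hα1 hα2, ?_, ?_, ?_⟩
  · simp only [hincl]
    exact hasDerivWithinAt_of_eq_integral hT.le hdu
      (fun s hs => B.negPow_eq_integral_mildDeriv hα1 hα2 hN hz hs) ht
  · simp only [hincl]
    exact B.isCaputoDeriv_mildDual hα1 hα2 hN hT.le hz
  · rw [hz0, B.toV_ofV]
  -- The choice `σ = 0` suffices, where `V_0` carries the norm of `L²`.
  · refine ⟨0, le_rfl, by positivity, fun t => B.toV le_rfl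
      (B.negPow (1 / α) (z t) - E.incl _ u₀), fun t _ => ?_, ?_⟩
    · rw [B.incl_toV, B.negPow_zero, hincl]
    · simp only [LinearIsometry.norm_map]
      have h2 := (((B.negPow (1 / α)).continuous.comp_continuousOn hz.1) 0 h0).tendsto.mono_left hle
      have h3 := (h2.sub_const (E.incl _ u₀)).norm
      rw [Function.comp_apply, hz0, B.negPow_ofV hγ, sub_self, norm_zero] at h3
      exact h3
  -- The largest admissible `β`. The derivative converges in `L²`, hence in `V_{-β}` through the
  -- bounded inclusion `L`.
  · set β := 1 - 1 / α with hβ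
    have hβ0 : 0 < β := by rw [hβ, sub_pos, div_lt_one hα0]; exact hα1
    set L : E.V β →L[ℝ] Lp ℝ 2 m :=
      (B.negPow β).comp (B.ofV β).toContinuousLinearMap with hL
    refine ⟨β, hβ0, le_rfl, fun t => (innerSL ℝ
      (B.mildDeriv α N (B.ofV _ u₀) u₁ z t - u₁)).comp L, fun t _ φ => ?_, ?_⟩
    · rw [← B.negPow_ofV hβ0.le φ]
      rfl
    · have h1 : Tendsto (fun t => ‖B.mildDeriv α N (B.ofV _ u₀) u₁ z t - u₁‖ * ‖L‖) (𝓝[>] 0)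
          (𝓝 0) := by
        have h2 := ((hdu 0 h0).tendsto.mono_left hle).sub_const u₁
        rw [B.mildDeriv_zero hα1 hα2, sub_self] at h2
        simpa using h2.norm.mul_const ‖L‖
      refine squeeze_zero (fun t => norm_nonneg _) (fun t => ?_) h1
      refine (ContinuousLinearMap.opNorm_comp_le _ _).trans_eq ?_
      rw [innerSL_apply_norm]
  · intro φ
    refine Eventually.of_forall fun t => ⟨⟨_, B.negPow_mem_dom hγ2 (z t)⟩,
      ⟨_, B.negPow_mem_dom hγ2 (B.ofV _ φ)⟩, N (z t), (hincl t).symm, B.negPow_ofV hγ φ, ?_, ?_⟩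
    · simp only [hincl]
      exact hNf _
    -- The form term cancels the second term of `mildCaputo`, and `A^{-1/α}` moves from `N(z)` to
    -- the test function.
    · rw [B.form_negPow hγ2, mildDual_apply, mildCaputo, inner_sub_left, sub_add_cancel,
        B.inner_negPow_comm hγ, B.negPow_ofV hγ]

end Mild

end EigenBasis

end DirichletForm

/-! ### Local well-posedness. -/

theorem thetaA_pos {q : ℝ} (hq : 1 < q) : 0 < thetaA q :=
  div_pos (by linarith) (by linarith)

/-- At `α = α₀` the left side is `0`. Otherwise the exponent is `r = θ / (θ - 1/α)` and equality
holds; `θ α > 1` is needed, and `q ≤ 2` gives it through `θ ≥ 1`. -/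
theorem growth_exponent_le {α q r : ℝ} (hα : 1 < α) (hq : 1 < q)
    (h : (2 < q ∧ α = alphaZero q) ∨
      (2 < q ∧ alphaZero q < α ∧ r = thetaA q * α / (thetaA q * α - 1)) ∨
      (q ≤ 2 ∧ r = thetaA q * α / (thetaA q * α - 1))) :
    r * (thetaA q - 1 / α) ≤ thetaA q := by
  have hθ := thetaA_pos hq
  have hα0 : 0 < α := by linarith
  have key : 1 < thetaA q * α → r = thetaA q * α / (thetaA q * α - 1) →
      r * (thetaA q - 1 / α) ≤ thetaA q := by
    intro h1 hr
    have h2 : thetaA q * α - 1 ≠ 0 := by linarith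
    rw [hr]
    refine le_of_eq ?_
    field_simp
  rcases h with ⟨-, h⟩ | ⟨-, h, hr⟩ | ⟨h, hr⟩
  · rw [h, alphaZero, one_div_one_div, sub_self, mul_zero]
    exact hθ.le
  · refine key ?_ hr
    rwa [alphaZero, div_lt_iff₀ hθ, mul_comm] at h
  · refine key ?_ hr
    have h1 : 1 ≤ thetaA q := by
      rw [thetaA, le_div_iff₀ (by linarith)]
      linarith
    nlinarith

namespace DirichletForm.EigenBasis

variable {X : Type u} [MeasurableSpace X] {m : Measure X} {E : DirichletForm m} {ι : Type u}
  (B : E.EigenBasis ι)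

/-- The embedding into `L^{2r}` is Lipschitz, so the curve is continuous with values in `L^{2r}` on
a compact interval, and bounded; every time exponent is then allowed. -/
theorem memBochner_negPow [IsFiniteMeasure m] {q γ r T : ℝ} (hq : 1 < q)
    (hs : E.SobolevEmbedding q) (hr : 1 < r) (hγ : r * (thetaA q - γ) ≤ thetaA q) (a : ℝ≥0∞)
    {z : ℝ → Lp ℝ 2 m} (hz : ContinuousOn z (Icc 0 T)) :
    MemBochner T a (ENNReal.ofReal (2 * r)) (fun t => B.negPow γ (z t)) := by
  obtain ⟨C, hC, h⟩ := B.eLpNorm_negPow_le hq hs hr hγ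
  have hfact : Fact (1 ≤ ENNReal.ofReal (2 * r)) := ⟨by
    rw [← ENNReal.ofReal_one]
    exact ENNReal.ofReal_le_ofReal (by linarith)⟩
  have hmem : ∀ w, MemLp (B.negPow γ w) (ENNReal.ofReal (2 * r)) m := fun w =>
    ⟨Lp.aestronglyMeasurable _, (h w).trans_lt ENNReal.ofReal_lt_top⟩
  set G : Lp ℝ 2 m → Lp ℝ (ENNReal.ofReal (2 * r)) m := fun w => (hmem w).toLp _ with hG
  have hlip : LipschitzWith ⟨C, hC⟩ G := LipschitzWith.of_dist_le_mul fun w w' => by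
    have h1 : G w - G w' = G (w - w') := by
      rw [hG, ← MemLp.toLp_sub]
      refine MemLp.toLp_congr _ _ ?_
      rw [map_sub]
      exact (Lp.coeFn_sub _ _).symm
    rw [dist_eq_norm, dist_eq_norm, h1, hG, Lp.norm_toLp]
    exact ENNReal.toReal_le_of_le_ofReal (mul_nonneg hC (norm_nonneg _)) (h _)
  have hGz : ContinuousOn (fun t => G (z t)) (Icc 0 T) := hlip.continuous.comp_continuousOn hz
  obtain ⟨M, hM⟩ := isCompact_Icc.exists_bound_of_continuousOn hGz
  refine ⟨hfact, fun t => G (z t), Eventually.of_forall fun t => (hmem _).coeFn_toLp, ?_⟩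
  refine MemLp.of_bound ((hGz.mono Ioo_subset_Icc_self).aestronglyMeasurable measurableSet_Ioo) M ?_
  filter_upwards [ae_restrict_mem measurableSet_Ioo] with t ht
  exact hM t (Ioo_subset_Icc_self ht)

/-- A notion of solution which amounts to the Volterra equation for `A ^ (1 / α) u` is locally
well-posed, and its solutions extend. -/
theorem wellPosed_of_iff_isVolterraSol {α : ℝ} (hα1 : 1 < α) (hα2 : α < 2) (hγ : 0 ≤ 1 / α)
    {N : Lp ℝ 2 m → Lp ℝ 2 m} (hN : IsLocallyLipschitz N) (z₀ u₁ : Lp ℝ 2 m)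
    {P : ℝ → (ℝ → E.V (1 / α)) → Prop} (hpos : ∀ {T u}, P T u → 0 < T)
    (hsol : ∀ {T u}, P T u →
      IsVolterraSol (B.convKernel α) N (B.freeSol α z₀ u₁) T fun t => B.ofV _ (u t))
    (hof : ∀ {T z}, 0 < T → IsVolterraSol (B.convKernel α) N (B.freeSol α z₀ u₁) T z →
      P T fun t => B.toV hγ (z t)) :
    (∃ T u, IsUniqueSol P T u) ∧
      ∀ T u, P T u → IsUniqueSol P T u ∧
        ∃ τ : ℝ, 0 < τ ∧ ∃ v : ℝ → E.V (1 / α), EqOn v u (Icc 0 T) ∧ IsUniqueSol P (T + τ) v := by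
  obtain ⟨C, hK⟩ := B.isWeaklySingular_convKernel hα1 hα2
  have hfree : ∀ T, ContinuousOn (B.freeSol α z₀ u₁) (Icc 0 T) := fun T =>
    (B.continuousOn_freeSol hα1 hα2 z₀ u₁).mono Icc_subset_Ici_self
  have huniq : ∀ {T u}, P T u → IsUniqueSol P T u := fun {T u} h =>
    ⟨h, fun w hw t ht => by
      rw [← B.toV_ofV hγ (w t), ← B.toV_ofV hγ (u t)]
      exact congrArg _ (hK.volterra_unique hN (hpos h).le (hfree T) (hsol hw) (hsol h) ht)⟩
  refine ⟨?_, fun T u h => ⟨huniq h, ?_⟩⟩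
  -- Local existence is extension from the degenerate interval `[0, 0]`.
  · have h0 : IsVolterraSol (B.convKernel α) N (B.freeSol α z₀ u₁) 0 (B.freeSol α z₀ u₁) := by
      refine ⟨hfree 0, fun t ht => ?_⟩
      rw [Icc_self, mem_singleton_iff] at ht
      rw [ht, opConv, intervalIntegral.integral_same, add_zero]
    obtain ⟨τ, hτ, Z, -, hZ⟩ := hK.volterra_extend hN le_rfl (hfree _) h0
    rw [zero_add] at hZ
    exact ⟨τ, _, huniq (hof hτ hZ)⟩
  · obtain ⟨τ, hτ, Z, hZu, hZ⟩ := hK.volterra_extend hN (hpos h).le (hfree _) (hsol h)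
    refine ⟨τ, hτ, _, fun t ht => ?_, huniq (hof (by linarith [hpos h]) hZ)⟩
    simp only [hZu ht, B.toV_ofV]

end DirichletForm.EigenBasis

end

theorem mainTheorem2 {X : Type*} [MetricSpace X] [MeasurableSpace X] [BorelSpace X]
    (hX : TotallyBounded (univ : Set X))
    (m : Measure X) [IsFiniteMeasure m] [m.InnerRegularCompactLTTop] [m.IsOpenPosMeasure]
    (E : DirichletForm m) (hcompact : E.CompactEmbedding) (hpos : E.PositiveSpectrum)
    (qA : ℝ) (hqA : 1 < qA) (hsob : E.SobolevEmbedding qA)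
    (α : ℝ) (hα1 : 1 < α) (hα2 : α < 2) (f : ℝ → ℝ) (hf : ContDiff ℝ 1 f)
    (u₀ : E.V (1 / α)) (u₁ : Lp ℝ 2 m) :
    -- subcritical case
    (2 < qA → α < alphaZero qA → Hf2 f →
      (∃ T u, IsUniqueSol (IsWeakSolSub E α f u₀ u₁) T u) ∧
      ∀ T u, IsWeakSolSub E α f u₀ u₁ T u →
        IsUniqueSol (IsWeakSolSub E α f u₀ u₁) T u ∧
        ∃ τ : ℝ, 0 < τ ∧ ∃ v : ℝ → E.V (1 / α), EqOn v u (Icc 0 T) ∧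
          IsUniqueSol (IsWeakSolSub E α f u₀ u₁) (T + τ) v) ∧
    -- critical and supercritical case
    (∀ r : ℝ, 1 < r →
      ((2 < qA ∧ α = alphaZero qA) ∨
        (2 < qA ∧ alphaZero qA < α ∧ r = thetaA qA * α / (thetaA qA * α - 1)) ∨
        (qA ≤ 2 ∧ r = thetaA qA * α / (thetaA qA * α - 1))) →
      Hf1 f r →
      ∀ (p : ℝ) (q : ℝ≥0∞), 1 ≤ p → p < 1 / (2 - α) →
        ENNReal.HolderConjugate (ENNReal.ofReal p) q →
      (∃ T u, IsUniqueSol (IsWeakSolSuper E α q f u₀ u₁) T u) ∧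
      ∀ T u, IsWeakSolSuper E α q f u₀ u₁ T u →
        IsUniqueSol (IsWeakSolSuper E α q f u₀ u₁) T u ∧
        ∃ τ : ℝ, 0 < τ ∧ ∃ v : ℝ → E.V (1 / α), EqOn v u (Icc 0 T) ∧
          IsUniqueSol (IsWeakSolSuper E α q f u₀ u₁) (T + τ) v) := by
  obtain ⟨ι, ⟨B⟩⟩ := E.exists_eigenBasis hcompact hpos
  have hγ : 0 ≤ 1 / α := by positivity
  refine ⟨fun _ hα hf2 => ?_, fun r hr1 hcase hgr p q _ _ _ => ?_⟩
  -- The condition `α < α₀` places `V_{1/α}` in `L^∞`.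
  · have hθ : thetaA qA < 1 / α := by
      rwa [lt_one_div (thetaA_pos hqA) (by linarith)]
    obtain ⟨N, hNf, hN⟩ := B.exists_nonlinearity_of_lt hqA hsob hγ hθ hf hf2.1
    have hNc := IsLocallyLipschitz.continuous hN
    refine B.wellPosed_of_iff_isVolterraSol hα1 hα2 hγ hN (B.ofV _ u₀) u₁ ?_ ?_ ?_
    · rintro T u ⟨du, D, h, -⟩
      exact h.pos
    · rintro T u ⟨du, D, h, -⟩
      exact B.isVolterraSol_of_isWeakSolWith hα1 hα2 hNc hNf h
    · intro T z hT hz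
      exact ⟨_, _, B.isWeakSolWith_of_isVolterraSol hα1 hα2 hγ hNc hNf hT hz,
        B.continuousOn_mildDual hNc hz.1⟩
  · have hle := growth_exponent_le hα1 hqA hcase
    obtain ⟨N, hNf, hN⟩ := B.exists_nonlinearity_of_growth hqA hsob hr1 hle hf hgr
    have hNc := IsLocallyLipschitz.continuous hN
    refine B.wellPosed_of_iff_isVolterraSol hα1 hα2 hγ hN (B.ofV _ u₀) u₁ ?_ ?_ ?_
    · rintro T u ⟨du, D, h, -⟩
      exact h.pos
    · rintro T u ⟨du, D, h, -⟩
      exact B.isVolterraSol_of_isWeakSolWith hα1 hα2 hNc hNf h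
    · intro T z hT hz
      -- Under this growth condition `f(u)` is already continuous in time with values in `L²`, so
      -- the `L^q` part of the fractional derivative is taken to be `0`, and `ρ = r`.
      refine ⟨_, _, B.isWeakSolWith_of_isVolterraSol hα1 hα2 hγ hNc hNf hT hz,
        ⟨r, hr1, ?_⟩, B.mildDual α N z, 0, B.continuousOn_mildDual hNc hz.1, MemLp.zero,
        Eventually.of_forall fun t φ => ?_⟩
      · simp only [B.incl_toV]
        exact B.memBochner_negPow hqA hsob hr1 hle _ hz.1
      · rw [Pi.zero_apply, inner_zero_left, add_zero]
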